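/- **Setting.** Let $M$ be a smooth $n$-manifold and let $W\subseteq TM$ be open (in particular $W=TM$ or $W=TM\setminus\{0\}$), with induced coordinates $(x^\mu,y^a)$, $\partial_\mu=\partial/\partial x^\mu$, $\dot\partial_a=\partial/\partial y^a$. Let $N^a_\mu$ be a smooth nonlinear connection on $W$, $\delta_\mu=\partial_\mu-N^a_\mu\dot\partial_a$ and $R^a_{\mu\nu}=\delta_\nu N^a_\mu-\delta_\mu N^a_\nu$. Let $\lambda_i=\lambda_i^\alpha\delta_\alpha+\lambda_i^a\dot\partial_a$ ($i=1,\dots,n$) be smooth vector fields on $W$ whose horizontal parts are linearly independent and whose vertical parts are linearly independent. Let $(\lambda_{i\alpha})$, $(\lambda_{ia})$ be the inverse matrices of $(\lambda_i^\alpha)$, $(\lambda_i^a)$. Repeated indices, including $i$, are summed. Let $g_{\alpha\beta}=\lambda_{i\alpha}\lambda_{i\beta}$, with inverse $g^{\alpha\beta}=\lambda_i^\alpha\lambda_i^\beta$; horizontal indices are raised and lowered with $g$. Put $t_{(\mu\nu)}=\frac12(t_{\mu\nu}+t_{\nu\mu})$, $t_{[\mu\nu]}=\frac12(t_{\mu\nu}-t_{\nu\mu})$,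 and let $\mathfrak S$ denote cyclic sums (in $\mathfrak S_{\mu,\nu,\alpha}X^\alpha{}_{\mu\nu\alpha}$ only the lower indices are permuted). *Canonical $d$-connection:* $\Gamma^\alpha_{\mu\nu}=\lambda_i^\alpha\delta_\nu\lambda_{i\mu}$, $\Gamma^a_{b\nu}=\lambda_i^a\delta_\nu\lambda_{ib}$, $C^\alpha_{\mu c}=\lambda_i^\alpha\dot\partial_c\lambda_{i\mu}$, $C^a_{bc}=\lambda_i^a\dot\partial_c\lambda_{ib}$; its horizontal and vertical covariant derivatives are written $|$ and $\|$. Put $\Lambda^\alpha_{\mu\nu}=\Gamma^\alpha_{\mu\nu}-\Gamma^\alpha_{\nu\mu}$ and $C_\mu=\Lambda^\alpha_{\mu\alpha}$. *Natural metric $d$-connection:* $\mathring\Gamma^\alpha_{\mu\nu}=\frac12g^{\alpha\epsilon}(\delta_\mu g_{\epsilon\nu}+\delta_\nu g_{\epsilon\mu}-\delta_\epsilon g_{\mu\nu})$, $\mathring C^\alpha_{\mu c}=\frac12g^{\alpha\epsilon}\dot\partial_cg_{\mu\epsilon}$. Its horizontal covariant derivative is written $\mathring|$. Its horizontal curvature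 is $\mathring R(\delta_\mu,\delta_\nu)\delta_\beta=\mathring R^\alpha_{\beta\mu\nu}\delta_\alpha$, where $\mathring R(X,Y)=[\mathring D_X,\mathring D_Y]-\mathring D_{[X,Y]}$. Put $\mathring R_{\beta\nu}=\mathring R^\alpha_{\beta\nu\alpha}$, $\mathring{\mathcal R}=g^{\alpha\beta}\mathring R_{\alpha\beta}$ and $\mathring G_{\mu\nu}=\mathring R_{\mu\nu}-\frac12g_{\mu\nu}\mathring{\mathcal R}$. *Fundamental tensors:* $\gamma^\alpha_{\mu\nu}=\Gamma^\alpha_{\mu\nu}-\mathring\Gamma^\alpha_{\mu\nu}$, $\gamma^\alpha_{\mu c}=C^\alpha_{\mu c}-\mathring C^\alpha_{\mu c}$, $\gamma_{\alpha\mu\nu}=g_{\alpha\epsilon}\gamma^\epsilon_{\mu\nu}$, $\gamma_{\mu\nu}{}^\alpha=g^{\alpha\epsilon}\gamma_{\mu\nu\epsilon}$, $\Lambda_{\alpha\mu\nu}=g_{\alpha\epsilon}\Lambda^\epsilon_{\mu\nu}$, $\Omega^\alpha_{\mu\nu}=\gamma^\alpha_{\mu\nu}+\gamma^\alpha_{\nu\mu}$,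 $\xi_{\mu\nu}=\gamma_{\mu\nu}{}^\alpha{}_{|\alpha}$, $\gamma_{\mu\nu}=C_\alpha\gamma_{\mu\nu}{}^\alpha$, $\eta_{\mu\nu}=C_\beta\Lambda^\beta_{\mu\nu}$, $\varpi_{\mu\nu}=\gamma^\beta_{\alpha\mu}\gamma^\alpha_{\nu\beta}+\gamma^\beta_{\mu\alpha}\gamma^\alpha_{\beta\nu}$, $\sigma_{\mu\nu}=\gamma^\beta_{\alpha\mu}\gamma^\alpha_{\beta\nu}$, $N_\beta=\dot\partial_aN^a_\beta$, $N^\beta=g^{\beta\epsilon}N_\epsilon$, $Z_{\mu\nu}=C_\mu N_\nu$, $M_{\mu\nu}=N^\beta\Lambda_{\mu\nu\beta}$, $Q_{\mu\nu}=\gamma^\epsilon_{\mu a}R^a_{\nu\epsilon}$, $A_{\mu\nu}=N^\beta\gamma_{\beta\mu\nu}-Z_{\mu\nu}$; and $\sigma,\varpi,Z,Q$ are the $g$-traces. *Energy–momentum tensor, electromagnetic field and current of the general theory:* $$T_{\mu\nu}=\tfrac12g_{\mu\nu}(\sigma-\varpi-Q+2Z)-(\sigma_{\mu\nu}-\varpi_{\mu\nu}-Q_{(\mu\nu)})+\big(\tfrac12N_\beta\Omega^\beta_{\mu\nu}-Z_{(\mu\nu)}\big)+\tfrac12\mathfrak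 S_{\mu,\nu,\alpha}\mathring C^\alpha_{\mu a}R^a_{\nu\alpha},$$ $$F_{\mu\nu}=(\gamma_{\mu\nu}-\xi_{\mu\nu}+\eta_{\mu\nu}+N_\beta\Lambda^\beta_{\mu\nu})+(M_{[\mu\nu]}-Z_{[\mu\nu]})+\tfrac32\mathfrak S_{\mu,\nu,\epsilon}C^\epsilon_{\nu a}R^a_{\epsilon\mu},\qquad J^\mu=F^{\mu\nu}{}_{\mathring|\nu}.$$ *Horizontal field equations:* the Euler–Lagrange equations $$\frac{\partial\mathcal H}{\partial\lambda_{j\beta}}-\partial_\gamma\frac{\partial\mathcal H}{\partial\lambda_{j\beta,\gamma}}-\dot\partial_a\frac{\partial\mathcal H}{\partial\lambda_{j\beta;a}}=0,\qquad \mathcal H=\det(\lambda_{i\beta})\,g^{\mu\nu}(\Lambda^\alpha_{\epsilon\mu}\Lambda^\epsilon_{\alpha\nu}-C_\mu C_\nu),$$ where $\lambda_{j\beta,\gamma}=\partial_\gamma\lambda_{j\beta}$, $\lambda_{j\beta;a}=\dot\partial_a\lambda_{j\beta}$, and $N^a_\mu$ is independent of the horizontal fundamental vector fields, that is, it is held fixed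 in the variation. **Theorem.** Fix any coordinate chart of $M$; all hypotheses and conclusions below are in this chart. (1) *Integrability case.* Suppose that $R^a_{\mu\nu}=0$ and that the horizontal field equations hold. Then (a) $T_{\mu\nu}$ is symmetric, and $$T_{\mu\nu}=\big\{\tfrac12g_{\mu\nu}(\sigma-\varpi)+(\varpi_{\mu\nu}-\sigma_{\mu\nu})\big\}+g_{\mu\nu}Z+A_{(\mu\nu)};$$ (b) $\mathring G_{\mu\nu}=T_{\mu\nu}$, and the conservation law $T^\mu{}_{\nu\mathring|\mu}=0$ holds, where $T^\mu{}_\nu=g^{\mu\epsilon}T_{\epsilon\nu}$; (c) $F_{\mu\nu}=(\gamma_{\mu\nu}-\xi_{\mu\nu}+\eta_{\mu\nu})+N^\beta(\gamma_{\mu\nu\beta}+\Lambda_{\beta\mu\nu})+A_{[\mu\nu]}$, and $F_{\mu\nu}=\delta_\nu C_\mu-\delta_\mu C_\nu$; (d) $\mathfrak S_{\mu,\nu,\sigma}F_{\mu\nu\mathring|\sigma}=0$; (e) $J^\mu{}_{\mathring|\mu}=0$. (2) *Cartan-type case.* If the canonical $d$-connection is of Cartan type, that is $y^a{}_{|\mu}=0$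 and $y^a{}_{\|c}=\delta^a_c$, then $N^a_\mu=y^b(\lambda_i^a\partial_\mu\lambda_{ib})$ and $R^a_{\mu\nu}=0$. Hence the Cartan-type case is a special case of (1): under the horizontal field equations all relations (a)–(e) hold. -/

import Mathlib

open scoped Manifold ContDiff

noncomputable section

namespace EAP

/-- Coordinates `(x, y)` on the tangent bundle of an `n`-dimensional manifold: `x` is the positional
argument, `y` the directional argument. -/
abbrev Coord (n : ℕ) : Type := EuclideanSpace ℝ (Fin n) × EuclideanSpace ℝ (Fin n)

/-- Partial derivative `∂f/∂x^μ`. -/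
def pdx {n : ℕ} (μ : Fin n) (f : Coord n → ℝ) (u : Coord n) : ℝ :=
  fderiv ℝ f u (EuclideanSpace.single μ 1, 0)

/-- Partial derivative `∂f/∂y^a`. -/
def pdy {n : ℕ} (a : Fin n) (f : Coord n → ℝ) (u : Coord n) : ℝ :=
  fderiv ℝ f u (0, EuclideanSpace.single a 1)

/-! ### The Lagrangian as a function of the horizontal fields and their first derivatives -/

section Lagrangian

variable {n : ℕ}

/-- `Γ^α_{μν} = λ_i^α (λ_{iμ,ν} - N^a_ν λ_{iμ;a})` as a function of the values `N^a_μ = N a μ`,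
`λ_{iβ} = l i β`, `λ_{iβ,γ} = lx i β γ` and `λ_{iβ;a} = ly i β a`. -/
def jetGamma (N : Fin n → Fin n → ℝ) (l : Fin n → Fin n → ℝ) (lx ly : Fin n → Fin n → Fin n → ℝ)
    (α μ ν : Fin n) : ℝ :=
  ∑ i, (Matrix.of l)⁻¹ α i * (lx i μ ν - ∑ a, N a ν * ly i μ a)

/-- `Λ^α_{μν} = Γ^α_{μν} - Γ^α_{νμ}`. -/
def jetLam (N : Fin n → Fin n → ℝ) (l : Fin n → Fin n → ℝ) (lx ly : Fin n → Fin n → Fin n → ℝ)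
    (α μ ν : Fin n) : ℝ :=
  jetGamma N l lx ly α μ ν - jetGamma N l lx ly α ν μ

/-- `C_μ = Λ^α_{μα}`. -/
def jetC (N : Fin n → Fin n → ℝ) (l : Fin n → Fin n → ℝ) (lx ly : Fin n → Fin n → Fin n → ℝ)
    (μ : Fin n) : ℝ :=
  ∑ α, jetLam N l lx ly α μ α

/-- The scalar Lagrangian `𝓗 = |λ| g^{μν} (Λ^α_{εμ} Λ^ε_{αν} - C_μ C_ν)`, where
`|λ| = det (λ_{iβ})` and `g^{μν} = λ_i^μ λ_i^ν`. -/
def lagrangian (N : Fin n → Fin n → ℝ) (l : Fin n → Fin n → ℝ)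
    (lx ly : Fin n → Fin n → Fin n → ℝ) : ℝ :=
  (Matrix.of l).det * ∑ μ, ∑ ν, (∑ i, (Matrix.of l)⁻¹ μ i * (Matrix.of l)⁻¹ ν i) *
    ((∑ α, ∑ ε, jetLam N l lx ly α ε μ * jetLam N l lx ly ε α ν)
      - jetC N l lx ly μ * jetC N l lx ly ν)

/-- The array whose only nonzero entry is a `1` at position `(j, β)`. -/
def unit2 (j β : Fin n) : Fin n → Fin n → ℝ := Pi.single j (Pi.single β 1)

/-- The array whose only nonzero entry is a `1` at position `(j, β, γ)`. -/
def unit3 (j β γ : Fin n) : Fin n → Fin n → Fin n → ℝ :=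
  Pi.single j (Pi.single β (Pi.single γ 1))

/-- `∂𝓗/∂λ_{jβ}`. -/
def dLag (N : Fin n → Fin n → ℝ) (l : Fin n → Fin n → ℝ) (lx ly : Fin n → Fin n → Fin n → ℝ)
    (j β : Fin n) : ℝ :=
  deriv (fun t : ℝ => lagrangian N (l + t • unit2 j β) lx ly) 0

/-- `∂𝓗/∂λ_{jβ,γ}`. -/
def dLagX (N : Fin n → Fin n → ℝ) (l : Fin n → Fin n → ℝ) (lx ly : Fin n → Fin n → Fin n → ℝ)
    (j β γ : Fin n) : ℝ :=
  deriv (fun t : ℝ => lagrangian N l (lx + t • unit3 j β γ) ly) 0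

/-- `∂𝓗/∂λ_{jβ;a}`. -/
def dLagY (N : Fin n → Fin n → ℝ) (l : Fin n → Fin n → ℝ) (lx ly : Fin n → Fin n → Fin n → ℝ)
    (j β a : Fin n) : ℝ :=
  deriv (fun t : ℝ => lagrangian N l lx (ly + t • unit3 j β a)) 0

end Lagrangian

/-! ### Extended absolute parallelism geometry in a coordinate chart -/

/-- The components, in a chart, of a nonlinear connection and of the fundamental vector fields:
`N u a μ = N^a_μ(u)`, `lamH u i α = λ_i^α(u)`, `lamV u i a = λ_i^a(u)`, so that
`λ_i = λ_i^α δ_α + λ_i^a ∂/∂y^a` in the adapted basis. -/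
structure LocalData (n : ℕ) where
  N : Coord n → Fin n → Fin n → ℝ
  lamH : Coord n → Fin n → Fin n → ℝ
  lamV : Coord n → Fin n → Fin n → ℝ

namespace LocalData

variable {n : ℕ} (S : LocalData n)

/-- `δ_μ f = ∂f/∂x^μ - N^a_μ ∂f/∂y^a`. -/
def del (μ : Fin n) (f : Coord n → ℝ) (u : Coord n) : ℝ :=
  pdx μ f u - ∑ a, S.N u a μ * pdy a f u

/-- `λ_{iα}`, where `(λ_{iα})` is the inverse of `(λ_i^α)`. -/
def coH (u : Coord n) (i α : Fin n) : ℝ := (Matrix.of (S.lamH u))⁻¹ α i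

/-- `λ_{ia}`, where `(λ_{ia})` is the inverse of `(λ_i^a)`. -/
def coV (u : Coord n) (i a : Fin n) : ℝ := (Matrix.of (S.lamV u))⁻¹ a i

/-- The horizontal metric `g_{αβ} = λ_{iα} λ_{iβ}`. -/
def g (u : Coord n) (α β : Fin n) : ℝ := ∑ i, S.coH u i α * S.coH u i β

/-- The inverse horizontal metric `g^{αβ} = λ_i^α λ_i^β`. -/
def gInv (u : Coord n) (α β : Fin n) : ℝ := ∑ i, S.lamH u i α * S.lamH u i β

/-- Curvature of the nonlinear connection, `R^a_{μν} = δ_ν N^a_μ - δ_μ N^a_ν`. -/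
def curvN (u : Coord n) (a μ ν : Fin n) : ℝ :=
  S.del ν (fun v => S.N v a μ) u - S.del μ (fun v => S.N v a ν) u

/-- `N_β = ∂N^a_β/∂y^a`. -/
def NDown (u : Coord n) (β : Fin n) : ℝ := ∑ a, pdy a (fun v => S.N v a β) u

/-- `N^β = g^{βε} N_ε`. -/
def NUp (u : Coord n) (β : Fin n) : ℝ := ∑ ε, S.gInv u β ε * S.NDown u ε

/-! #### The canonical `d`-connection -/

/-- `Γ^α_{μν} = λ_i^α δ_ν λ_{iμ}`. -/
def Gam (u : Coord n) (α μ ν : Fin n) : ℝ :=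
  ∑ i, S.lamH u i α * S.del ν (fun v => S.coH v i μ) u

/-- `Γ^a_{bν} = λ_i^a δ_ν λ_{ib}`. -/
def GamV (u : Coord n) (a b ν : Fin n) : ℝ :=
  ∑ i, S.lamV u i a * S.del ν (fun v => S.coV v i b) u

/-- `C^α_{μc} = λ_i^α ∂λ_{iμ}/∂y^c`. -/
def CH (u : Coord n) (α μ c : Fin n) : ℝ :=
  ∑ i, S.lamH u i α * pdy c (fun v => S.coH v i μ) u

/-- `C^a_{bc} = λ_i^a ∂λ_{ib}/∂y^c`. -/
def CV (u : Coord n) (a b c : Fin n) : ℝ :=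
  ∑ i, S.lamV u i a * pdy c (fun v => S.coV v i b) u

/-- Horizontal torsion `Λ^α_{μν} = Γ^α_{μν} - Γ^α_{νμ}`. -/
def Lam (u : Coord n) (α μ ν : Fin n) : ℝ := S.Gam u α μ ν - S.Gam u α ν μ

/-- The horizontal basic vector `C_μ = Λ^α_{μα}`. -/
def C (u : Coord n) (μ : Fin n) : ℝ := ∑ α, S.Lam u α μ α

/-! #### The natural metric `d`-connection -/

/-- `oΓ^α_{μν} = ½ g^{αε} (δ_μ g_{εν} + δ_ν g_{εμ} - δ_ε g_{μν})`. -/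
def oGam (u : Coord n) (α μ ν : Fin n) : ℝ :=
  1 / 2 * ∑ ε, S.gInv u α ε * (S.del μ (fun v => S.g v ε ν) u + S.del ν (fun v => S.g v ε μ) u
    - S.del ε (fun v => S.g v μ ν) u)

/-- `oC^α_{μc} = ½ g^{αε} ∂g_{με}/∂y^c`. -/
def oCH (u : Coord n) (α μ c : Fin n) : ℝ :=
  1 / 2 * ∑ ε, S.gInv u α ε * pdy c (fun v => S.g v μ ε) u

/-- Horizontal curvature `oR^α_{βμν}` of the natural metric `d`-connection, that is
`R(δ_μ, δ_ν) δ_β = oR^α_{βμν} δ_α` with `R(X,Y) = D_X D_Y - D_Y D_X - D_[X,Y]`; here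
`[δ_μ, δ_ν] = R^a_{μν} ∂/∂y^a`. -/
def oRiem (u : Coord n) (α β μ ν : Fin n) : ℝ :=
  S.del μ (fun v => S.oGam v α β ν) u - S.del ν (fun v => S.oGam v α β μ) u
    + ∑ ε, (S.oGam u ε β ν * S.oGam u α ε μ - S.oGam u ε β μ * S.oGam u α ε ν)
    - ∑ a, S.curvN u a μ ν * S.oCH u α β a

/-- Horizontal Ricci tensor `oR_{βν} = oR^α_{βνα}`. -/
def oRic (u : Coord n) (β ν : Fin n) : ℝ := ∑ α, S.oRiem u α β ν α

/-- Horizontal Ricci scalar. -/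
def oScal (u : Coord n) : ℝ := ∑ α, ∑ β, S.gInv u α β * S.oRic u α β

/-- Horizontal Einstein tensor `oG_{μσ} = oR_{μσ} - ½ g_{μσ} oR`. -/
def oEin (u : Coord n) (μ σ : Fin n) : ℝ := S.oRic u μ σ - 1 / 2 * S.g u μ σ * S.oScal u

/-- Horizontal covariant derivative `V^α_{o|κ}` for the natural metric `d`-connection. -/
def ocovU (V : Coord n → Fin n → ℝ) (u : Coord n) (α κ : Fin n) : ℝ :=
  S.del κ (fun v => V v α) u + ∑ ε, V u ε * S.oGam u α ε κ

/-- Horizontal covariant derivative `V^α_{β o|κ}`, for `V u α β = V^α_β(u)`. -/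
def ocovUD (V : Coord n → Fin n → Fin n → ℝ) (u : Coord n) (α β κ : Fin n) : ℝ :=
  S.del κ (fun v => V v α β) u + ∑ ε, V u ε β * S.oGam u α ε κ - ∑ ε, V u α ε * S.oGam u ε β κ

/-- Horizontal covariant derivative `V_{αβ o|κ}`. -/
def ocovDD (V : Coord n → Fin n → Fin n → ℝ) (u : Coord n) (α β κ : Fin n) : ℝ :=
  S.del κ (fun v => V v α β) u - ∑ ε, V u ε β * S.oGam u ε α κ - ∑ ε, V u α ε * S.oGam u ε β κ

/-- Horizontal covariant derivative `V^{αβ}_{o|κ}`. -/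
def ocovUU (V : Coord n → Fin n → Fin n → ℝ) (u : Coord n) (α β κ : Fin n) : ℝ :=
  S.del κ (fun v => V v α β) u + ∑ ε, V u ε β * S.oGam u α ε κ + ∑ ε, V u α ε * S.oGam u β ε κ

/-! #### Contortion and the fundamental tensors -/

/-- Contortion `γ^α_{μν} = Γ^α_{μν} - oΓ^α_{μν}`. -/
def ga (u : Coord n) (α μ ν : Fin n) : ℝ := S.Gam u α μ ν - S.oGam u α μ ν

/-- Contortion `γ^α_{μc} = C^α_{μc} - oC^α_{μc}`. -/
def gaC (u : Coord n) (α μ c : Fin n) : ℝ := S.CH u α μ c - S.oCH u α μ c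

/-- `Ω^α_{μν} = γ^α_{μν} + γ^α_{νμ}`. -/
def Om (u : Coord n) (α μ ν : Fin n) : ℝ := S.ga u α μ ν + S.ga u α ν μ

/-- `γ_{αμν} = g_{αε} γ^ε_{μν}`. -/
def gaD (u : Coord n) (α μ ν : Fin n) : ℝ := ∑ ε, S.g u α ε * S.ga u ε μ ν

/-- `Λ_{αμν} = g_{αε} Λ^ε_{μν}`. -/
def LamD (u : Coord n) (α μ ν : Fin n) : ℝ := ∑ ε, S.g u α ε * S.Lam u ε μ ν

/-- `γ_{μν}^α = g^{αε} γ_{μνε}`. -/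
def gaU (u : Coord n) (μ ν α : Fin n) : ℝ := ∑ ε, S.gInv u α ε * S.gaD u μ ν ε

/-- `ξ_{μν} = γ_{μν}^α_{|α}`, the horizontal covariant derivative being that of the canonical
`d`-connection. -/
def xi (u : Coord n) (μ ν : Fin n) : ℝ :=
  ∑ α, (S.del α (fun v => S.gaU v μ ν α) u + ∑ ε, S.gaU u μ ν ε * S.Gam u α ε α
    - ∑ ε, S.gaU u ε ν α * S.Gam u ε μ α - ∑ ε, S.gaU u μ ε α * S.Gam u ε ν α)

/-- `γ_{μν} = C_α γ_{μν}^α`. -/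
def ga2 (u : Coord n) (μ ν : Fin n) : ℝ := ∑ α, S.C u α * S.gaU u μ ν α

/-- `η_{μν} = C_β Λ^β_{μν}`. -/
def eta (u : Coord n) (μ ν : Fin n) : ℝ := ∑ β, S.C u β * S.Lam u β μ ν

/-- `ϖ_{μν} = γ^β_{αμ} γ^α_{νβ} + γ^β_{μα} γ^α_{βν}`. -/
def varpi (u : Coord n) (μ ν : Fin n) : ℝ :=
  ∑ α, ∑ β, (S.ga u β α μ * S.ga u α ν β + S.ga u β μ α * S.ga u α β ν)

/-- `σ_{μν} = γ^β_{αμ} γ^α_{βν}`. -/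
def sig (u : Coord n) (μ ν : Fin n) : ℝ := ∑ α, ∑ β, S.ga u β α μ * S.ga u α β ν

/-- Trace `g^{μν} t_{μν}`. -/
def tr (t : Coord n → Fin n → Fin n → ℝ) (u : Coord n) : ℝ :=
  ∑ μ, ∑ ν, S.gInv u μ ν * t u μ ν

/-- `Z_{μν} = C_μ N_ν`. -/
def Z (u : Coord n) (μ ν : Fin n) : ℝ := S.C u μ * S.NDown u ν

/-- `M_{μν} = N^β Λ_{μνβ}`. -/
def Mt (u : Coord n) (μ ν : Fin n) : ℝ := ∑ β, S.NUp u β * S.LamD u μ ν β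

/-- `Q_{μν} = γ^ε_{μa} R^a_{νε}`. -/
def Q (u : Coord n) (μ ν : Fin n) : ℝ := ∑ ε, ∑ a, S.gaC u ε μ a * S.curvN u a ν ε

/-- `A_{μν} = N^β γ_{βμν} - Z_{μν}`. -/
def A (u : Coord n) (μ ν : Fin n) : ℝ := (∑ β, S.NUp u β * S.gaD u β μ ν) - S.Z u μ ν

/-- Symmetric part `t_{(μν)} = ½ (t_{μν} + t_{νμ})`. -/
def sym (t : Coord n → Fin n → Fin n → ℝ) (u : Coord n) (μ ν : Fin n) : ℝ :=
  1 / 2 * (t u μ ν + t u ν μ)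

/-- Skew-symmetric part `t_{[μν]} = ½ (t_{μν} - t_{νμ})`. -/
def skew (t : Coord n → Fin n → Fin n → ℝ) (u : Coord n) (μ ν : Fin n) : ℝ :=
  1 / 2 * (t u μ ν - t u ν μ)

/-- The horizontal energy–momentum tensor of the general theory (no condition on `N`):
`T_{μν} = ½ g_{μν} (σ - ϖ - Q + 2Z) - (σ_{μν} - ϖ_{μν} - Q_{(μν)})
  + (½ N_β Ω^β_{μν} - Z_{(μν)}) + ½ 𝔖_{μ,ν,α} oC^α_{μa} R^a_{να}`,
where `𝔖_{μ,ν,α}` is the cyclic sum over the lower indices, after which the lower `α` is contracted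
with the upper one. -/
def T (u : Coord n) (μ ν : Fin n) : ℝ :=
  1 / 2 * S.g u μ ν * (S.tr S.sig u - S.tr S.varpi u - S.tr S.Q u + 2 * S.tr S.Z u)
    - (S.sig u μ ν - S.varpi u μ ν - sym S.Q u μ ν)
    + (1 / 2 * (∑ β, S.NDown u β * S.Om u β μ ν) - sym S.Z u μ ν)
    + 1 / 2 * ∑ α, ∑ a, (S.oCH u α μ a * S.curvN u a ν α + S.oCH u α ν a * S.curvN u a α μ
        + S.oCH u α α a * S.curvN u a μ ν)

/-- `T^μ_ν = g^{με} T_{εν}`. -/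
def TUp (u : Coord n) (μ ν : Fin n) : ℝ := ∑ ε, S.gInv u μ ε * S.T u ε ν

/-- The horizontal electromagnetic field strength of the general theory (no condition on `N`):
`F_{μν} = (γ_{μν} - ξ_{μν} + η_{μν} + N_β Λ^β_{μν}) + (M_{[μν]} - Z_{[μν]})
  + (3/2) 𝔖_{μ,ν,ε} C^ε_{νa} R^a_{εμ}`. -/
def F (u : Coord n) (μ ν : Fin n) : ℝ :=
  (S.ga2 u μ ν - S.xi u μ ν + S.eta u μ ν + ∑ β, S.NDown u β * S.Lam u β μ ν)
    + (skew S.Mt u μ ν - skew S.Z u μ ν)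
    + 3 / 2 * ∑ ε, ∑ a, (S.CH u ε ν a * S.curvN u a ε μ + S.CH u ε ε a * S.curvN u a μ ν
        + S.CH u ε μ a * S.curvN u a ν ε)

/-- `F^{μν} = g^{μα} g^{νβ} F_{αβ}`. -/
def FUp (u : Coord n) (μ ν : Fin n) : ℝ :=
  ∑ α, ∑ β, S.gInv u μ α * S.gInv u ν β * S.F u α β

/-- The current density `J^μ = F^{μν}_{o|ν}`. -/
def J (u : Coord n) (μ : Fin n) : ℝ := ∑ ν, S.ocovUU S.FUp u μ ν ν

/-! #### Field equations and special cases -/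

/-- Components of `λ_{iβ,γ} = ∂λ_{iβ}/∂x^γ`. -/
def coHx (u : Coord n) (i β γ : Fin n) : ℝ := pdx γ (fun v => S.coH v i β) u

/-- Components of `λ_{iβ;a} = ∂λ_{iβ}/∂y^a`. -/
def coHy (u : Coord n) (i β a : Fin n) : ℝ := pdy a (fun v => S.coH v i β) u

/-- The Euler–Lagrange expression `δ𝓗/δλ_{jβ} = ∂𝓗/∂λ_{jβ} - ∂/∂x^γ (∂𝓗/∂λ_{jβ,γ})
- ∂/∂y^a (∂𝓗/∂λ_{jβ;a})`. The nonlinear connection does not depend on the horizontal fundamental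
vector fields, so it is held fixed in the partial derivatives of `𝓗`. -/
def eulerLagrange (u : Coord n) (j β : Fin n) : ℝ :=
  dLag (S.N u) (S.coH u) (S.coHx u) (S.coHy u) j β
    - ∑ γ, pdx γ (fun v => dLagX (S.N v) (S.coH v) (S.coHx v) (S.coHy v) j β γ) u
    - ∑ a, pdy a (fun v => dLagY (S.N v) (S.coH v) (S.coHx v) (S.coHy v) j β a) u

/-- The horizontal unified field equations on `D`. -/
def FieldEquations (D : Set (Coord n)) : Prop :=
  ∀ u ∈ D, ∀ j β, S.eulerLagrange u j β = 0

/-- The nonlinear connection is integrable on `D`: `R^a_{μν} = 0`. -/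
def IntegrableN (D : Set (Coord n)) : Prop :=
  ∀ u ∈ D, ∀ a μ ν, S.curvN u a μ ν = 0

/-- The canonical `d`-connection is of Cartan type on `D`: `y^a_{|μ} = 0` and `y^a_{||c} = δ^a_c`. -/
def CartanType (D : Set (Coord n)) : Prop :=
  ∀ u ∈ D, (∀ a μ, S.del μ (fun v => v.2 a) u + ∑ b, u.2 b * S.GamV u a b μ = 0) ∧
    ∀ a c, pdy c (fun v => v.2 a) u + ∑ b, u.2 b * S.CV u a b c = if a = c then 1 else 0

end LocalData

/-! ### EAP-spaces -/

section Global

variable {n : ℕ}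

/-- Coordinate expression of `e' ∘ e⁻¹`. -/
def trans {M : Type*} [TopologicalSpace M]
    (e e' : OpenPartialHomeomorph M (EuclideanSpace ℝ (Fin n))) (x : EuclideanSpace ℝ (Fin n)) :
    EuclideanSpace ℝ (Fin n) := e' (e.symm x)

/-- `p^{a'}_a = ∂x^{a'}/∂x^a`, for the change from the coordinates `x` of `e` to the coordinates
`x'` of `e'`. -/
def jac {M : Type*} [TopologicalSpace M]
    (e e' : OpenPartialHomeomorph M (EuclideanSpace ℝ (Fin n))) (x : EuclideanSpace ℝ (Fin n))
    (a' a : Fin n) : ℝ :=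
  fderiv ℝ (trans e e') x (EuclideanSpace.single a 1) a'

/-- The induced change of coordinates `(x, y) ↦ (x', y')`, `y^{a'} = p^{a'}_a y^a`. -/
def transT {M : Type*} [TopologicalSpace M]
    (e e' : OpenPartialHomeomorph M (EuclideanSpace ℝ (Fin n))) (u : Coord n) : Coord n :=
  (trans e e' u.1, fderiv ℝ (trans e e') u.1 u.2)

/-- The coordinate domain in `ℝⁿ × ℝⁿ` of the part of a set `W` of tangent vectors that lies over
the domain of the chart `e`. -/
def chartDom {M : Type*} [TopologicalSpace M] [ChartedSpace (EuclideanSpace ℝ (Fin n)) M]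
    (W : Set (TangentBundle (𝓡 n) M))
    (e : OpenPartialHomeomorph M (EuclideanSpace ℝ (Fin n))) : Set (Coord n) :=
  {u | u.1 ∈ e.target ∧ tangentMap (𝓡 n) (𝓡 n) e.symm ⟨u.1, u.2⟩ ∈ W}

/-- An extended absolute parallelism structure on an open set `W` of the tangent bundle of `M`
(`W = TM`, or `TM` without its null section): a smooth nonlinear connection together with `n`
smooth vector fields `λ_i` whose horizontal parts, and whose vertical parts, are linearly
independent; given by components in all charts with the transformation laws of a change of
coordinates. The value of `comp e` matters only on `chartDom W e`. -/
structure Space (n : ℕ) (M : Type*) [TopologicalSpace M]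
    [ChartedSpace (EuclideanSpace ℝ (Fin n)) M] (W : Set (TangentBundle (𝓡 n) M)) where
  comp : OpenPartialHomeomorph M (EuclideanSpace ℝ (Fin n)) → LocalData n
  smooth_N : ∀ e ∈ IsManifold.maximalAtlas (𝓡 n) ∞ M, ∀ a μ,
    ContDiffOn ℝ ∞ (fun u => (comp e).N u a μ) (chartDom W e)
  smooth_lamH : ∀ e ∈ IsManifold.maximalAtlas (𝓡 n) ∞ M, ∀ i α,
    ContDiffOn ℝ ∞ (fun u => (comp e).lamH u i α) (chartDom W e)
  smooth_lamV : ∀ e ∈ IsManifold.maximalAtlas (𝓡 n) ∞ M, ∀ i a,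
    ContDiffOn ℝ ∞ (fun u => (comp e).lamV u i a) (chartDom W e)
  indep_lamH : ∀ e ∈ IsManifold.maximalAtlas (𝓡 n) ∞ M, ∀ u ∈ chartDom W e,
    LinearIndependent ℝ ((comp e).lamH u)
  indep_lamV : ∀ e ∈ IsManifold.maximalAtlas (𝓡 n) ∞ M, ∀ u ∈ chartDom W e,
    LinearIndependent ℝ ((comp e).lamV u)
  /-- `N^{a'}_{α'} = p^{a'}_a p^α_{α'} N^a_α + p^{a'}_a p^a_{c'α'} y^{c'}`, where
  `p^a_{c'α'} = ∂p^a_{c'}/∂x^{α'}`. -/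
  trans_N : ∀ e ∈ IsManifold.maximalAtlas (𝓡 n) ∞ M, ∀ e' ∈ IsManifold.maximalAtlas (𝓡 n) ∞ M,
    ∀ u ∈ chartDom W e, e.symm u.1 ∈ e'.source → ∀ a' α',
      (comp e').N (transT e e' u) a' α' =
        (∑ a, ∑ α, jac e e' u.1 a' a * jac e' e (trans e e' u.1) α α' * (comp e).N u a α)
        + ∑ a, ∑ c', jac e e' u.1 a' a *
            fderiv ℝ (fun x' => jac e' e x' a c') (trans e e' u.1) (EuclideanSpace.single α' 1) *
            (transT e e' u).2 c'
  /-- `λ_i^{α'} = p^{α'}_α λ_i^α`. -/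
  trans_lamH : ∀ e ∈ IsManifold.maximalAtlas (𝓡 n) ∞ M,
    ∀ e' ∈ IsManifold.maximalAtlas (𝓡 n) ∞ M,
    ∀ u ∈ chartDom W e, e.symm u.1 ∈ e'.source → ∀ i α',
      (comp e').lamH (transT e e' u) i α' = ∑ α, jac e e' u.1 α' α * (comp e).lamH u i α
  /-- `λ_i^{a'} = p^{a'}_a λ_i^a`. -/
  trans_lamV : ∀ e ∈ IsManifold.maximalAtlas (𝓡 n) ∞ M,
    ∀ e' ∈ IsManifold.maximalAtlas (𝓡 n) ∞ M,
    ∀ u ∈ chartDom W e, e.symm u.1 ∈ e'.source → ∀ i a',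
      (comp e').lamV (transT e e' u) i a' = ∑ a, jac e e' u.1 a' a * (comp e).lamV u i a

end Global

end EAP

end

/-! ### Frame calculus over an algebra with commuting derivations -/

namespace EAP

/-! The vanishing of the curvature of `N` says that the adapted derivatives δ_μ commute (`dl_comm`).
Over the algebra of smooth functions on the chart domain they then behave like ordinary partial
derivatives, and the horizontal fields with their duals form a classical parallelisation. Horizontal
geometry thus becomes absolute parallelism geometry over an abstract commutative algebra
(`ParallelFrame`), where every claim is an algebraic identity. The directional variables survive
only through the one-form N_β.

Identities are proved in frame components. The canonical connection is flat and makes the frame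
parallel; it differs from the Levi-Civita connection by the contortion `G`, which is skew in its
first two indices. In the frame the Levi-Civita connection form is therefore minus `G`, and
`oRiem_eq` is a change of gauge. The matrix Bianchi identity `Fm_bianchi`, contracted twice in
`div_Ric`, makes the Einstein tensor divergence-free.

For the variation, the Lagrangian at a point is det λ times the trace of a quadratic expression in
the torsion `L` (`lagrangian_eq`). Derivatives of the coframe enter only through δ_ν λ_{iμ}, so the
momentum conjugate to λ_{jβ;a} is -N^a_γ P^γ, where P^γ is the momentum conjugate to λ_{jβ,γ}
(`dLagY_eq`). The total divergence of the momenta is then δ_γ P^γ - N_γ P^γ. Its first term becomes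
a covariant divergence because det λ is a density, and its second term is the source of all the N_β
terms in the field equations. The result is that the Euler–Lagrange expression is det λ times the
frame array `el` (`eulerLagrange_ev`).

The symmetric part of `el` is -2 times the Einstein tensor minus T (`el_symm`). Its skew part is 2
times F minus the curl of C; this uses the contracted Jacobi identity `div_L` (`el_skew`). The field
equations thus amount to both equalities. The conservation law of T is then the contracted Bianchi
identity, the cyclic identity for F is that the exterior derivative squares to zero, and the current
is conserved because the double divergence of a skew tensor vanishes.

In the Cartan-type case, the functions y_i = λ_{ia} y^a satisfy δ_μ y_i = 0 and ∂y_i/∂y^c = λ_{ic}.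
Applying the commutator of δ_μ and δ_ν to y_i gives R^a_{μν} λ_{ia} = 0, hence R = 0. -/

/-- A parallelisation `a i μ = λ_i^μ` with its dual `b i μ = λ_{iμ}`, over a commutative algebra with
commuting derivations `d μ`. -/
structure ParallelFrame (ι A : Type*) [Fintype ι] [DecidableEq ι] [CommRing A] [Algebra ℝ A] where
  d : ι → Derivation ℝ A A
  a : ι → ι → A
  b : ι → ι → A
  comm : ∀ μ ν f, d μ (d ν f) = d ν (d μ f)
  ab : ∀ i j, ∑ μ, a i μ * b j μ = if i = j then 1 else 0
  ba : ∀ μ ν, ∑ i, a i μ * b i ν = if μ = ν then 1 else 0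

namespace ParallelFrame

variable {ι A : Type*} [Fintype ι] [DecidableEq ι] [CommRing A] [Algebra ℝ A]
variable (P : ParallelFrame ι A)

/-- The derivation along the `i`-th frame field. -/
def D (i : ι) : Derivation ℝ A A := ∑ μ, P.a i μ • P.d μ

lemma D_apply (i : ι) (f : A) : P.D i f = ∑ μ, P.a i μ * P.d μ f := by
  have h : ⇑(P.D i) = ∑ μ, ⇑(P.a i μ • P.d μ) :=
    map_sum (Derivation.coeFnAddMonoidHom (R := ℝ) (A := A) (M := A)) _ _
  rw [h, Finset.sum_apply]
  rfl

/-- The covector with frame components `f`. -/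
def T1 (f : ι → A) (μ : ι) : A := ∑ i, P.b i μ * f i

/-- The covariant tensor with frame components `t`. -/
def T2 (t : ι → ι → A) (μ ν : ι) : A := ∑ i, ∑ j, P.b i μ * P.b j ν * t i j

/-- The covariant tensor of rank three with frame components `t`. -/
def T3 (t : ι → ι → ι → A) (μ ν σ : ι) : A :=
  ∑ i, ∑ j, ∑ k, P.b i μ * P.b j ν * P.b k σ * t i j k

/-- The vector with frame components `f`. -/
def V1 (f : ι → A) (μ : ι) : A := ∑ i, P.a i μ * f i

lemma T2_eq (t : ι → ι → A) (μ ν : ι) : P.T2 t μ ν = P.T1 (fun i => P.T1 (t i) ν) μ := by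
  simp only [T2, T1, Finset.mul_sum, mul_assoc]

lemma T2_eq' (t : ι → ι → A) (μ ν : ι) :
    P.T2 t μ ν = P.T1 (fun j => P.T1 (fun i => t i j) μ) ν := by
  rw [T2, Finset.sum_comm]
  simp only [T1, Finset.mul_sum]
  exact Finset.sum_congr rfl fun _ _ => Finset.sum_congr rfl fun _ _ => by ring

lemma T3_eq (t : ι → ι → ι → A) (μ ν σ : ι) :
    P.T3 t μ ν σ = P.T1 (fun i => P.T2 (t i) ν σ) μ := by
  simp only [T2, T1, T3, Finset.mul_sum, mul_assoc]

lemma T3_eq' (t : ι → ι → ι → A) (μ ν σ : ι) :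
    P.T3 t μ ν σ = P.T1 (fun k => P.T2 (fun i j => t i j k) μ ν) σ := by
  simp only [T2, T1, T3, Finset.mul_sum]
  rw [Finset.sum_congr rfl fun i _ => Finset.sum_comm, Finset.sum_comm]
  exact Finset.sum_congr rfl fun _ _ => Finset.sum_congr rfl fun _ _ =>
    Finset.sum_congr rfl fun _ _ => by ring

lemma sum_V1_mul_T1 (f g : ι → A) : ∑ μ, P.V1 f μ * P.T1 g μ = ∑ i, f i * g i := by
  calc ∑ μ, P.V1 f μ * P.T1 g μ
      = ∑ μ, ∑ i, ∑ j, (P.a i μ * P.b j μ) * (f i * g j) := by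
        simp only [V1, T1, Finset.sum_mul_sum]
        exact Finset.sum_congr rfl fun _ _ => Finset.sum_congr rfl fun _ _ =>
          Finset.sum_congr rfl fun _ _ => by ring
    _ = ∑ i, ∑ j, (∑ μ, P.a i μ * P.b j μ) * (f i * g j) := by
        rw [Finset.sum_comm]
        refine Finset.sum_congr rfl fun i _ => ?_
        rw [Finset.sum_comm]
        simp only [Finset.sum_mul]
    _ = _ := by simp [P.ab]

lemma sum_a_mul_T1 (i : ι) (f : ι → A) : ∑ μ, P.a i μ * P.T1 f μ = f i := by
  have h : ∀ μ, P.a i μ = P.V1 (fun j => if j = i then 1 else 0) μ := fun μ => by simp [V1]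
  simp only [h, sum_V1_mul_T1]
  simp

lemma sum_b_mul_V1 (i : ι) (f : ι → A) : ∑ μ, P.b i μ * P.V1 f μ = f i := by
  have h : ∀ μ, P.b i μ = P.T1 (fun j => if j = i then 1 else 0) μ := fun μ => by simp [T1]
  simp only [h, mul_comm (P.T1 _ _), sum_V1_mul_T1]
  simp

lemma T1_sum_a (f : ι → A) (μ : ι) : P.T1 (fun i => ∑ ν, P.a i ν * f ν) μ = f μ := by
  simp only [T1, Finset.mul_sum]
  rw [Finset.sum_comm]
  have h : ∀ ν, ∑ i, P.b i μ * (P.a i ν * f ν) = (∑ i, P.a i ν * P.b i μ) * f ν := fun ν => by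
    rw [Finset.sum_mul]
    exact Finset.sum_congr rfl fun _ _ => by ring
  simp [h, P.ba]

lemma V1_sum_b (f : ι → A) (μ : ι) : P.V1 (fun i => ∑ ν, P.b i ν * f ν) μ = f μ := by
  simp only [V1, Finset.mul_sum]
  rw [Finset.sum_comm]
  have h : ∀ ν, ∑ i, P.a i μ * (P.b i ν * f ν) = (∑ i, P.a i μ * P.b i ν) * f ν := fun ν => by
    rw [Finset.sum_mul]
    exact Finset.sum_congr rfl fun _ _ => by ring
  simp [h, P.ba]

/-- Contraction with the frame recovers the components. With its rank two and three versions this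
lets a relation between frame components be deduced from a coordinate identity. -/
lemma T1_inj {f g : ι → A} (h : ∀ μ, P.T1 f μ = P.T1 g μ) (i : ι) : f i = g i := by
  rw [← P.sum_a_mul_T1 i f, ← P.sum_a_mul_T1 i g]
  simp only [h]

lemma V1_inj {f g : ι → A} (h : ∀ μ, P.V1 f μ = P.V1 g μ) (i : ι) : f i = g i := by
  rw [← P.sum_b_mul_V1 i f, ← P.sum_b_mul_V1 i g]
  simp only [h]

lemma T2_inj {t s : ι → ι → A} (h : ∀ μ ν, P.T2 t μ ν = P.T2 s μ ν) (i j : ι) :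
    t i j = s i j := by
  refine P.T1_inj (fun ν => ?_) j
  exact P.T1_inj (f := fun i => P.T1 (t i) ν) (g := fun i => P.T1 (s i) ν)
    (fun μ => by simpa only [T2_eq] using h μ ν) i

lemma T3_inj {t s : ι → ι → ι → A} (h : ∀ μ ν σ, P.T3 t μ ν σ = P.T3 s μ ν σ) (i j k : ι) :
    t i j k = s i j k := by
  refine P.T2_inj (fun ν σ => ?_) j k
  exact P.T1_inj (f := fun i => P.T2 (t i) ν σ) (g := fun i => P.T2 (s i) ν σ)
    (fun μ => by simpa only [T3_eq] using h μ ν σ) i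

lemma d_eq (μ : ι) (f : A) : P.d μ f = P.T1 (fun i => P.D i f) μ := by
  simp only [D_apply, T1_sum_a]

/-- Frame components of the canonical connection coefficients. -/
def B (k i j : ι) : A := ∑ μ, P.a i μ * P.D j (P.b k μ)

lemma D_b (j k μ : ι) : P.D j (P.b k μ) = P.T1 (fun i => P.B k i j) μ := by
  simp only [B, T1_sum_a]

lemma d_b (ν k μ : ι) : P.d ν (P.b k μ) = P.T2 (P.B k) μ ν := by
  rw [d_eq, T2_eq']
  simp only [D_b]

/-- Differentiating the duality relation `ab` moves the derivative from the coframe to the frame, at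
the cost of a sign. -/
lemma D_a (j k α : ι) : P.D j (P.a k α) = -P.V1 (fun i => P.B i k j) α := by
  have h : ∀ i, ∑ μ, P.b i μ * P.D j (P.a k μ) = -P.B i k j := fun i => by
    have := congrArg (P.D j) (P.ab k i)
    have h0 : P.D j (if k = i then 1 else 0) = 0 := by split_ifs <;> simp
    rw [h0, map_sum] at this
    simp only [Derivation.leibniz, smul_eq_mul, Finset.sum_add_distrib] at this
    rw [B]
    linear_combination this
  rw [← P.V1_sum_b (fun μ => P.D j (P.a k μ)) α]
  simp only [h, V1, mul_neg, Finset.sum_neg_distrib]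

/-- The `B` term comes from differentiating the coframe that carries the free index. The analogues
for higher rank have one such term per index. -/
lemma D_T1 (j : ι) (f : ι → A) (μ : ι) :
    P.D j (P.T1 f μ) = P.T1 (fun i => P.D j (f i) + ∑ m, P.B m i j * f m) μ := by
  have h : P.T1 (fun i => ∑ m, P.B m i j * f m) μ = ∑ m, f m * P.T1 (fun i => P.B m i j) μ := by
    simp only [T1, Finset.mul_sum]
    rw [Finset.sum_comm]
    exact Finset.sum_congr rfl fun _ _ => Finset.sum_congr rfl fun _ _ => by ring
  have h2 : P.T1 (fun i => P.D j (f i) + ∑ m, P.B m i j * f m) μ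
      = P.T1 (fun i => P.D j (f i)) μ + P.T1 (fun i => ∑ m, P.B m i j * f m) μ := by
    simp only [T1, mul_add, Finset.sum_add_distrib]
  rw [h2, h]
  conv_lhs => rw [T1, map_sum]
  simp only [Derivation.leibniz, smul_eq_mul, D_b, Finset.sum_add_distrib]
  rfl

lemma d_T1 (f : ι → A) (μ ν : ι) :
    P.d ν (P.T1 f μ) = P.T2 (fun i j => P.D j (f i) + ∑ m, P.B m i j * f m) μ ν := by
  rw [d_eq, T2_eq']
  simp only [D_T1]

lemma D_T2 (k : ι) (t : ι → ι → A) (μ ν : ι) :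
    P.D k (P.T2 t μ ν) = P.T2 (fun i j => P.D k (t i j) + ∑ m, P.B m i k * t m j
      + ∑ m, P.B m j k * t i m) μ ν := by
  rw [T2_eq, D_T1, T2_eq]
  congr 1
  ext i
  rw [D_T1]
  have : ∑ m, P.B m i k * P.T1 (t m) ν = P.T1 (fun j => ∑ m, P.B m i k * t m j) ν := by
    simp only [T1, Finset.mul_sum]
    rw [Finset.sum_comm]
    exact Finset.sum_congr rfl fun _ _ => Finset.sum_congr rfl fun _ _ => by ring
  rw [this]
  simp only [T1, ← Finset.sum_add_distrib, ← mul_add]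
  exact Finset.sum_congr rfl fun _ _ => by ring

lemma d_T2 (t : ι → ι → A) (μ ν σ : ι) :
    P.d σ (P.T2 t μ ν) = P.T3 (fun i j k => P.D k (t i j) + ∑ m, P.B m i k * t m j
      + ∑ m, P.B m j k * t i m) μ ν σ := by
  rw [d_eq, T3_eq']
  simp only [D_T2]

end ParallelFrame
end EAP

/-! ### Torsion, contortion and Christoffel symbols in the frame -/

noncomputable section
namespace EAP
namespace ParallelFrame

variable {ι A : Type*} [Fintype ι] [DecidableEq ι] [CommRing A] [Algebra ℝ A]
variable (P : ParallelFrame ι A)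

/-- The constant `1/2`. -/
def half (A : Type*) [CommRing A] [Algebra ℝ A] : A := algebraMap ℝ A (1 / 2)

lemma two_mul_half : 2 * half A = 1 := by
  have h : (2 : A) = algebraMap ℝ A 2 := (map_ofNat _ 2).symm
  rw [half, h, ← map_mul]
  norm_num

/-- Frame components of the torsion. -/
def L (k i j : ι) : A := P.B k i j - P.B k j i

/-- Frame components of the contortion. -/
def G (k i j : ι) : A := half A * (P.L k i j - P.L i k j + P.L j i k)

lemma L_swap (k i j : ι) : P.L k j i = -P.L k i j := by simp only [L]; ring

/-- Both connections are metric and the frame is orthonormal, so their difference is skew in the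
first pair of indices. -/
lemma G_swap (k i j : ι) : P.G i k j = -P.G k i j := by simp only [G, L]; ring

/-- The Levi-Civita connection has no torsion, so the torsion of the canonical connection is carried
by the contortion alone. -/
lemma G_sub (k i j : ι) : P.G k i j - P.G k j i = P.L k i j := by
  simp only [G, L]
  linear_combination (P.B k i j - P.B k j i) * two_mul_half (A := A)

/-- Frame components of the trace of the torsion. -/
def c (i : ι) : A := ∑ k, P.L k i k

lemma G_self (k i : ι) : P.G k k i = 0 := by simp only [G, L]; ring

lemma sum_G (i : ι) : ∑ k, P.G k i k = P.c i := by
  refine Finset.sum_congr rfl fun k _ => ?_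
  rw [← G_sub, G_self, sub_zero]

/-- The canonical connection coefficients. -/
def Gam (α μ ν : ι) : A := ∑ i, P.a i α * P.d ν (P.b i μ)

/-- The metric. -/
def g (α β : ι) : A := ∑ i, P.b i α * P.b i β

/-- The inverse metric. -/
def gInv (α β : ι) : A := ∑ i, P.a i α * P.a i β

/-- The Christoffel symbols of the metric. -/
def oGam (α μ ν : ι) : A :=
  half A * ∑ ε, P.gInv α ε * (P.d μ (P.g ε ν) + P.d ν (P.g ε μ) - P.d ε (P.g μ ν))

/-- The mixed tensor with frame components `t`. -/
def M (t : ι → ι → ι → A) (α μ ν : ι) : A := P.V1 (fun k => P.T2 (t k) μ ν) α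

lemma Gam_eq (α μ ν : ι) : P.Gam α μ ν = P.M P.B α μ ν := by
  simp only [Gam, d_b, M, V1]

lemma g_eq (α β : ι) : P.g α β = P.T2 (fun i j => if i = j then 1 else 0) α β := by
  simp [g, T2]

lemma T1_sum (f : ι → ι → A) (μ : ι) : ∑ k, P.T1 (f k) μ = P.T1 (fun i => ∑ k, f k i) μ := by
  simp only [T1, Finset.mul_sum]
  rw [Finset.sum_comm]

lemma mul_T1 (x : A) (f : ι → A) (μ : ι) : x * P.T1 f μ = P.T1 (fun i => x * f i) μ := by
  simp only [T1, Finset.mul_sum]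
  exact Finset.sum_congr rfl fun _ _ => by ring

lemma T2_add (f f' : ι → ι → A) (μ ν : ι) :
    P.T2 f μ ν + P.T2 f' μ ν = P.T2 (fun i j => f i j + f' i j) μ ν := by
  simp only [T2, mul_add, Finset.sum_add_distrib]

lemma T2_sub (f f' : ι → ι → A) (μ ν : ι) :
    P.T2 f μ ν - P.T2 f' μ ν = P.T2 (fun i j => f i j - f' i j) μ ν := by
  simp only [T2, mul_sub, Finset.sum_sub_distrib]

lemma T2_sum (f : ι → ι → ι → A) (μ ν : ι) :
    ∑ k, P.T2 (f k) μ ν = P.T2 (fun i j => ∑ k, f k i j) μ ν := by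
  simp only [T2_eq, T1_sum]

lemma mul_T2 (x : A) (f : ι → ι → A) (μ ν : ι) :
    x * P.T2 f μ ν = P.T2 (fun i j => x * f i j) μ ν := by
  simp only [T2_eq, mul_T1]

lemma T2_swap (f : ι → ι → A) (μ ν : ι) : P.T2 f ν μ = P.T2 (fun i j => f j i) μ ν := by
  rw [T2_eq, T2_eq']

lemma T1_mul_T1 (f f' : ι → A) (μ ν : ι) :
    P.T1 f μ * P.T1 f' ν = P.T2 (fun i j => f i * f' j) μ ν := by
  rw [T1, T1, Finset.sum_mul_sum, T2]
  exact Finset.sum_congr rfl fun _ _ => Finset.sum_congr rfl fun _ _ => by ring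

lemma T3_add (f f' : ι → ι → ι → A) (μ ν σ : ι) :
    P.T3 f μ ν σ + P.T3 f' μ ν σ = P.T3 (fun i j k => f i j k + f' i j k) μ ν σ := by
  simp only [T3, mul_add, Finset.sum_add_distrib]

lemma T3_rotate (f : ι → ι → ι → A) (μ ν σ : ι) :
    P.T3 f ν σ μ = P.T3 (fun i j k => f j k i) μ ν σ := by
  rw [P.T3_eq' f, T3_eq]

lemma T3_swap (f : ι → ι → ι → A) (μ ν σ : ι) :
    P.T3 f μ σ ν = P.T3 (fun i j k => f i k j) μ ν σ := by
  rw [T3_eq, T3_eq]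
  simp only [P.T2_swap _ ν σ]

lemma T3_sub (f f' : ι → ι → ι → A) (μ ν σ : ι) :
    P.T3 f μ ν σ - P.T3 f' μ ν σ = P.T3 (fun i j k => f i j k - f' i j k) μ ν σ := by
  simp only [T3, mul_sub, Finset.sum_sub_distrib]

lemma sum_gInv (α : ι) (X : ι → A) :
    ∑ ε, P.gInv α ε * X ε = P.V1 (fun k => ∑ ε, P.a k ε * X ε) α := by
  simp only [gInv, V1, Finset.sum_mul, Finset.mul_sum]
  rw [Finset.sum_comm]
  exact Finset.sum_congr rfl fun _ _ => Finset.sum_congr rfl fun _ _ => by ring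

lemma d_g (μ ε ν : ι) :
    P.d μ (P.g ε ν) = P.T3 (fun i j k => P.B i j k + P.B j i k) ε ν μ := by
  rw [g_eq, d_T2]
  congr 1
  ext i j k
  have : P.D k (if i = j then 1 else 0) = 0 := by split_ifs <;> simp
  simp [this, add_comm]

lemma sum_a_mul_T3 (f : ι → ι → ι → A) (i ν σ : ι) :
    ∑ μ, P.a i μ * P.T3 f μ ν σ = P.T2 (f i) ν σ := by
  simp only [T3_eq, sum_a_mul_T1]

/-- By `d_g` the derivative of the metric has components B_{ijk} + B_{jik}. The Koszul combination
of three such terms is exactly twice `B` minus `G`. -/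
lemma oGam_eq (α μ ν : ι) :
    P.oGam α μ ν = P.M (fun k i j => P.B k i j - P.G k i j) α μ ν := by
  have h : ∀ ε, P.d μ (P.g ε ν) + P.d ν (P.g ε μ) - P.d ε (P.g μ ν) =
      P.T3 (fun k i j => (P.B k j i + P.B j k i) + (P.B k i j + P.B i k j)
        - (P.B i j k + P.B j i k)) ε μ ν := fun ε => by
    rw [d_g, d_g, d_g, P.T3_swap _ ε μ ν, P.T3_rotate _ ε μ ν, T3_add, T3_sub]
  rw [oGam, sum_gInv]
  simp only [h, sum_a_mul_T3]
  rw [M, V1, V1, Finset.mul_sum]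
  refine Finset.sum_congr rfl fun k _ => ?_
  rw [mul_left_comm, mul_T2]
  congr 2
  ext i j
  simp only [G, L]
  linear_combination (P.B k i j) * two_mul_half (A := A)

end ParallelFrame
end EAP
end

/-! ### Levi-Civita curvature as a matrix-valued form in the frame -/

noncomputable section
namespace EAP
namespace ParallelFrame

variable {ι A : Type*} [Fintype ι] [DecidableEq ι] [CommRing A] [Algebra ℝ A]
variable (P : ParallelFrame ι A)

lemma T2_congr {f f' : ι → ι → A} (h : ∀ i j, f i j = f' i j) (μ ν : ι) :
    P.T2 f μ ν = P.T2 f' μ ν := by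
  rw [show f = f' from funext fun i => funext fun j => h i j]

lemma T1_sub (f f' : ι → A) (μ : ι) : P.T1 f μ - P.T1 f' μ = P.T1 (fun i => f i - f' i) μ := by
  simp only [T1, mul_sub, Finset.sum_sub_distrib]

lemma V1_T1 (f : ι → ι → A) (α μ : ι) :
    P.V1 (fun k => P.T1 (f k) μ) α = P.T1 (fun i => P.V1 (fun k => f k i) α) μ := by
  simp only [V1, T1, Finset.mul_sum]
  rw [Finset.sum_comm]
  exact Finset.sum_congr rfl fun _ _ => Finset.sum_congr rfl fun _ _ => by ring

lemma trace_mixed (h : ι → ι → A) : ∑ α, P.V1 (fun k => P.T1 (h k) α) α = ∑ k, h k k := by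
  simp only [V1]
  rw [Finset.sum_comm]
  simp only [sum_a_mul_T1]

lemma trace_mul_mixed (x y : ι → ι → A) :
    ∑ α, ∑ β, P.V1 (fun k => P.T1 (x k) α) β * P.V1 (fun k => P.T1 (y k) β) α
      = ∑ k, ∑ i, x k i * y i k := by
  have h : ∀ α, ∑ β, P.V1 (fun k => P.T1 (x k) α) β * P.V1 (fun k => P.T1 (y k) β) α
      = ∑ k, P.V1 (fun i => y i k) α * P.T1 (x k) α := fun α => by
    simp only [P.V1_T1 y, sum_V1_mul_T1]
    exact Finset.sum_congr rfl fun _ _ => mul_comm _ _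
  simp only [h]
  rw [Finset.sum_comm]
  simp only [sum_V1_mul_T1]
  exact Finset.sum_congr rfl fun _ _ => Finset.sum_congr rfl fun _ _ => mul_comm _ _

lemma M_eq (f : ι → ι → ι → A) (α μ ν : ι) :
    P.M f α μ ν = P.V1 (fun k => P.T1 (fun i => P.T1 (f k i) ν) μ) α := by
  simp only [M, T2_eq]

lemma M_eq' (f : ι → ι → ι → A) (α μ ν : ι) :
    P.M f α μ ν = P.V1 (fun k => P.T1 (fun j => P.T1 (fun i => f k i j) μ) ν) α := by
  simp only [M, T2_eq']

lemma M_swap (f : ι → ι → ι → A) (α μ ν : ι) :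
    P.M f α ν μ = P.M (fun k i j => f k j i) α μ ν := by
  simp only [M, P.T2_swap _ μ ν]

lemma M_sub (f f' : ι → ι → ι → A) (α μ ν : ι) :
    P.M f α μ ν - P.M f' α μ ν = P.M (fun k i j => f k i j - f' k i j) α μ ν := by
  simp only [M, ← T2_sub, V1, mul_sub, Finset.sum_sub_distrib]

lemma sum_T1_mul_M (v : ι → A) (f : ι → ι → ι → A) (μ ν : ι) :
    ∑ β, P.T1 v β * P.M f β μ ν = P.T2 (fun i j => ∑ k, v k * f k i j) μ ν := by
  simp only [M, mul_comm (P.T1 v _), sum_V1_mul_T1, mul_comm (P.T2 _ _ _), mul_T2, T2_sum]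

/-- The torsion of the canonical connection. -/
def Lam (α μ ν : ι) : A := P.Gam α μ ν - P.Gam α ν μ

/-- The trace of the torsion. -/
def C (μ : ι) : A := ∑ α, P.Lam α μ α

/-- The contortion. -/
def ga (α μ ν : ι) : A := P.Gam α μ ν - P.oGam α μ ν

lemma Lam_eq (α μ ν : ι) : P.Lam α μ ν = P.M P.L α μ ν := by
  rw [Lam, Gam_eq, Gam_eq, P.M_swap P.B α μ ν, M_sub]
  rfl

lemma ga_eq (α μ ν : ι) : P.ga α μ ν = P.M P.G α μ ν := by
  rw [ga, Gam_eq, oGam_eq, M_sub]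
  simp only [sub_sub_cancel]

lemma C_eq (μ : ι) : P.C μ = P.T1 P.c μ := by
  simp only [C, Lam_eq, M_eq', trace_mixed, T1_sum]
  rfl

lemma oGam_comm (α μ ν : ι) : P.oGam α ν μ = P.oGam α μ ν := by
  rw [oGam_eq, oGam_eq, M_swap]
  congr 1
  ext k i j
  have := P.G_sub k i j
  simp only [L] at this
  linear_combination this

/-- The contracted Christoffel symbols. -/
def kap (ε : ι) : A := ∑ α, P.oGam α α ε

/-- The contortion is skew in its first pair, so its trace there vanishes. Thus `kap` can be
computed from the canonical coefficients, which makes it the logarithmic derivative of det λ. -/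
lemma kap_eq (ε : ι) : P.kap ε = ∑ α, P.Gam α α ε := by
  have h : ∑ α, P.ga α α ε = 0 := by
    simp only [ga_eq, M_eq, trace_mixed]
    simp [T1, G_self]
  simp only [ga, Finset.sum_sub_distrib] at h
  exact (sub_eq_zero.mp h).symm

lemma d_a (ν k α : ι) : P.d ν (P.a k α) = -∑ ε, P.a k ε * P.Gam α ε ν := by
  have h : ∑ ε, P.a k ε * P.Gam α ε ν = P.T1 (fun j => P.V1 (fun i => P.B i k j) α) ν := by
    simp only [Gam_eq, M_eq, V1_T1, sum_a_mul_T1]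
  rw [h, d_eq]
  simp only [D_a, T1, mul_neg, Finset.sum_neg_distrib]

/-- `kap` is closed because it is a logarithmic derivative. No logarithm is needed: after expansion
one term is a second derivative, where the derivations commute, and the other is a trace of a
product of two matrices. -/
lemma d_kap (μ ν : ι) : P.d μ (P.kap ν) = P.d ν (P.kap μ) := by
  have h : ∀ μ ν, P.d μ (P.kap ν) = -(∑ α, ∑ ε, P.Gam ε α ν * P.Gam α ε μ)
      + ∑ α, ∑ i, P.a i α * P.d μ (P.d ν (P.b i α)) := fun μ ν => by
    have hk : P.kap ν = ∑ α, ∑ i, P.a i α * P.d ν (P.b i α) := by simp only [kap_eq, Gam]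
    rw [hk]
    simp only [map_sum]
    rw [← Finset.sum_neg_distrib, ← Finset.sum_add_distrib]
    refine Finset.sum_congr rfl fun α _ => ?_
    simp only [Derivation.leibniz, smul_eq_mul, Finset.sum_add_distrib]
    rw [add_comm]
    congr 1
    simp only [d_a, mul_neg, Finset.sum_neg_distrib, Finset.mul_sum]
    rw [Finset.sum_comm]
    congr 1
    refine Finset.sum_congr rfl fun ε _ => ?_
    rw [show P.Gam ε α ν = ∑ i, P.a i ε * P.d ν (P.b i α) from rfl, Finset.sum_mul]
    exact Finset.sum_congr rfl fun _ _ => by ring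
  rw [h, h, Finset.sum_comm]
  simp only [P.comm μ ν]
  congr 2
  exact Finset.sum_congr rfl fun _ _ => Finset.sum_congr rfl fun _ _ => mul_comm _ _

/-- The curvature of the Levi-Civita connection. -/
def oRiem (α β μ ν : ι) : A :=
  P.d μ (P.oGam α β ν) - P.d ν (P.oGam α β μ)
    + ∑ ε, (P.oGam ε β ν * P.oGam α ε μ - P.oGam ε β μ * P.oGam α ε ν)

/-- The Ricci tensor. -/
def oRic (β ν : ι) : A := ∑ α, P.oRiem α β ν α

/-- The only term of the Ricci tensor whose symmetry is not formal is the derivative of the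
contracted Christoffel symbols, which `d_kap` settles. -/
lemma oRic_comm (β ν : ι) : P.oRic β ν = P.oRic ν β := by
  have h : ∀ β ν, P.oRic β ν = P.d ν (P.kap β) - ∑ α, P.d α (P.oGam α β ν)
      + ((∑ α, ∑ ε, P.oGam ε β α * P.oGam α ε ν) - ∑ ε, P.oGam ε β ν * P.kap ε) :=
    fun β ν => by
    simp only [oRic, oRiem, kap, map_sum, Finset.sum_add_distrib, Finset.sum_sub_distrib,
      Finset.mul_sum]
    rw [Finset.sum_comm (f := fun ε α => P.oGam ε β ν * P.oGam α α ε)]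
    simp only [fun α => P.oGam_comm α α β, fun α ε => P.oGam_comm α α ε]
  rw [h, h, P.d_kap ν β]
  congr 1
  · simp only [P.oGam_comm _ β ν]
  · congr 1
    · rw [Finset.sum_comm]
      refine Finset.sum_congr rfl fun _ _ => Finset.sum_congr rfl fun _ _ => ?_
      rw [mul_comm, P.oGam_comm _ ν, P.oGam_comm _ β]
    · simp only [P.oGam_comm _ β ν]

/-- Frame components of the Levi-Civita curvature. -/
def R (k i p q : ι) : A :=
  P.D q (P.G k i p) - P.D p (P.G k i q) + ∑ m, P.L m p q * P.G k i m
    + ∑ m, (P.G k m p * P.G m i q - P.G k m q * P.G m i p)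

/-- The Levi-Civita connection form in the frame, up to sign. -/
def om (ν : ι) : Matrix ι ι A := Matrix.of fun k i => P.T1 (P.G k i) ν

/-- Entrywise derivative of a matrix. -/
def dm (μ : ι) (X : Matrix ι ι A) : Matrix ι ι A := X.map (P.d μ)

lemma dm_mul (μ : ι) (X Y : Matrix ι ι A) : P.dm μ (X * Y) = P.dm μ X * Y + X * P.dm μ Y := by
  ext i j
  simp only [dm, Matrix.map_apply, Matrix.mul_apply, Matrix.add_apply, map_sum,
    Derivation.leibniz, smul_eq_mul, Finset.sum_add_distrib]
  rw [add_comm]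
  congr 1
  exact Finset.sum_congr rfl fun _ _ => mul_comm _ _

lemma dm_add (μ : ι) (X Y : Matrix ι ι A) : P.dm μ (X + Y) = P.dm μ X + P.dm μ Y := by
  ext i j; simp [dm]

lemma dm_sub (μ : ι) (X Y : Matrix ι ι A) : P.dm μ (X - Y) = P.dm μ X - P.dm μ Y := by
  ext i j; simp [dm]

lemma dm_comm (μ ν : ι) (X : Matrix ι ι A) : P.dm μ (P.dm ν X) = P.dm ν (P.dm μ X) := by
  ext i j; simp [dm, P.comm μ ν]

/-- The curvature form of the Levi-Civita connection in the frame. -/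
def Fm (μ ν : ι) : Matrix ι ι A :=
  P.dm ν (P.om μ) - P.dm μ (P.om ν) + P.om μ * P.om ν - P.om ν * P.om μ

/-- The term of `R` linear in `L` arises because the form index of `om` is carried by the coframe,
which is not closed. -/
lemma Fm_apply (μ ν k i : ι) : P.Fm μ ν k i = P.T2 (P.R k i) μ ν := by
  simp only [Fm, dm, om, Matrix.add_apply, Matrix.sub_apply, Matrix.map_apply, Matrix.of_apply,
    Matrix.mul_apply, d_T1, T1_mul_T1, T2_sum]
  rw [P.T2_swap (fun i_1 j => P.D j (P.G k i i_1) + ∑ m, P.B m i_1 j * P.G k i m) μ ν,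
    P.T2_swap (fun i_1 j => ∑ k_1, P.G k k_1 i_1 * P.G k_1 i j) μ ν, T2_sub, T2_add, T2_sub]
  refine P.T2_congr (fun p q => ?_) μ ν
  simp only [R, L, sub_mul, Finset.sum_sub_distrib]
  ring

/-- The Christoffel matrices are the gauge transform by the coframe of the connection form `-om`, so
their curvature is the conjugate of `Fm`. The pure gauge part is the canonical connection, which is
flat and contributes nothing. -/
lemma oRiem_eq (α β μ ν : ι) :
    P.oRiem α β μ ν = P.V1 (fun k => P.T1 (fun i => P.T2 (P.R k i) μ ν) β) α := by
  set a' : Matrix ι ι A := Matrix.of fun α k => P.a k α with ha'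
  set b' : Matrix ι ι A := Matrix.of fun k β => P.b k β with hb'
  have hba : b' * a' = 1 := by
    ext i j
    simp only [ha', hb', Matrix.mul_apply, Matrix.of_apply, Matrix.one_apply, mul_comm (P.b _ _),
      P.ab, eq_comm]
  have hab : a' * b' = 1 := by
    ext i j
    simp only [ha', hb', Matrix.mul_apply, Matrix.of_apply, Matrix.one_apply, P.ba]
  let Γ : ι → Matrix ι ι A := fun ν => Matrix.of fun α β => P.oGam α β ν
  have hΓ : ∀ ν, Γ ν = a' * (P.dm ν b' - P.om ν * b') := fun ν => by
    ext α β
    simp only [Γ, Matrix.of_apply, oGam_eq, Matrix.mul_apply, Matrix.sub_apply, dm, ha', hb', om,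
      Matrix.map_apply, d_b, M, V1, T2_eq]
    refine Finset.sum_congr rfl fun k _ => ?_
    congr 1
    have : ∑ j, P.T1 (P.G k j) ν * P.b j β = P.T1 (fun j => P.T1 (P.G k j) ν) β :=
      Finset.sum_congr rfl fun _ _ => mul_comm _ _
    simp only [this, T1_sub]
  have hda : ∀ μ, P.dm μ a' = -(a' * P.dm μ b' * a') := fun μ => by
    have h := congrArg (P.dm μ) hab
    have h1 : P.dm μ (1 : Matrix ι ι A) = 0 := by
      ext i j
      simp only [dm, Matrix.map_apply, Matrix.one_apply, Matrix.zero_apply]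
      split_ifs <;> simp
    rw [dm_mul, h1] at h
    have h2 := congrArg (· * a') h
    simp only [add_mul, zero_mul, mul_assoc, hba, mul_one] at h2
    rw [mul_assoc]
    exact eq_neg_of_add_eq_zero_left h2
  -- Half of the curvature before skew-symmetrisation; the first and third to fourth terms on the
  -- right are symmetric in the two indices and drop out of `h2`.
  have key : ∀ μ ν, P.dm μ (Γ ν) + Γ μ * Γ ν = a' * (P.dm μ (P.dm ν b') - P.dm μ (P.om ν) * b'
      - P.om ν * P.dm μ b' - P.om μ * P.dm ν b' + P.om μ * P.om ν * b') := fun μ ν => by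
    have hb1 : ∀ X, b' * (a' * X) = X := fun X => by rw [← mul_assoc, hba, one_mul]
    rw [hΓ, hΓ, dm_mul, dm_sub, dm_mul, hda]
    simp only [mul_sub, sub_mul, mul_add, neg_mul, mul_assoc, hb1]
    abel
  have h2 : P.dm μ (Γ ν) + Γ μ * Γ ν - (P.dm ν (Γ μ) + Γ ν * Γ μ) = a' * (P.Fm μ ν * b') := by
    rw [key, key, P.dm_comm ν μ, Fm]
    simp only [mul_sub, sub_mul, mul_add, add_mul, mul_assoc]
    abel
  have h3 := congrFun (congrFun h2 α) β
  simp only [Matrix.sub_apply, Matrix.add_apply, Matrix.mul_apply, Fm_apply] at h3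
  simp only [dm, Matrix.map_apply, Γ, Matrix.of_apply, ha', hb'] at h3
  rw [oRiem, Finset.sum_sub_distrib]
  simp only [mul_comm (P.oGam _ β _)]
  rw [V1]
  simp only [T1, mul_comm (P.b _ β)]
  linear_combination h3

/-- Frame components of the Ricci tensor. -/
def Ric (i q : ι) : A := ∑ k, P.R k i q k

lemma oRic_eq (β ν : ι) : P.oRic β ν = P.T2 P.Ric β ν := by
  have h : ∀ k α, P.T1 (fun i => P.T2 (P.R k i) ν α) β
      = P.T1 (fun q => P.T2 (fun i p => P.R k i p q) β ν) α := fun k α => by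
    rw [← T3_eq, ← T3_eq']
  simp only [oRic, oRiem_eq, h, trace_mixed, T2_sum]
  rfl

lemma Ric_comm (i j : ι) : P.Ric i j = P.Ric j i := by
  refine P.T2_inj (s := fun i j => P.Ric j i) (fun μ ν => ?_) i j
  rw [← oRic_eq, oRic_comm, oRic_eq, T2_swap]

/-- The connection form takes values in skew matrices, hence so does its curvature. -/
lemma R_swap (k i p q : ι) : P.R i k p q = -P.R k i p q := by
  simp only [R, P.G_swap k i]
  have h : ∀ m, P.G i m p * P.G m k q - P.G i m q * P.G m k p
      = -(P.G k m p * P.G m i q - P.G k m q * P.G m i p) := fun m => by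
    rw [P.G_swap m i, P.G_swap m i, P.G_swap k m, P.G_swap k m]; ring
  simp only [h, Finset.sum_neg_distrib, mul_neg, map_neg]
  ring

lemma R_swap' (k i p q : ι) : P.R k i q p = -P.R k i p q := by
  simp only [R, P.L_swap _ p q, neg_mul, Finset.sum_neg_distrib, Finset.sum_sub_distrib]
  ring

/-- Second Bianchi identity for the connection form `-om`: the second derivatives cancel since the
derivations commute, and the remaining terms cancel in the noncommutative matrix ring. -/
lemma Fm_bianchi (μ ν σ : ι) :
    (P.dm σ (P.Fm μ ν) - (P.om σ * P.Fm μ ν - P.Fm μ ν * P.om σ))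
      + (P.dm μ (P.Fm ν σ) - (P.om μ * P.Fm ν σ - P.Fm ν σ * P.om μ))
      + (P.dm ν (P.Fm σ μ) - (P.om ν * P.Fm σ μ - P.Fm σ μ * P.om ν)) = 0 := by
  simp only [Fm, dm_sub, dm_add, dm_mul]
  rw [P.dm_comm σ μ (P.om ν), P.dm_comm σ ν (P.om μ), P.dm_comm ν μ (P.om σ)]
  noncomm_ring

end ParallelFrame
end EAP
end

/-! ### Contracted Bianchi identity and divergence formulas -/

noncomputable section
namespace EAP
namespace ParallelFrame

variable {ι A : Type*} [Fintype ι] [DecidableEq ι] [CommRing A] [Algebra ℝ A]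
variable (P : ParallelFrame ι A)

lemma T2_mul_T1 (t : ι → ι → A) (f : ι → A) (μ ν σ : ι) :
    P.T2 t μ ν * P.T1 f σ = P.T3 (fun i j k => t i j * f k) μ ν σ := by
  simp only [T2, T1, T3, Finset.sum_mul]
  simp only [Finset.mul_sum]
  exact Finset.sum_congr rfl fun _ _ => Finset.sum_congr rfl fun _ _ =>
    Finset.sum_congr rfl fun _ _ => by ring

lemma T3_sum (f : ι → ι → ι → ι → A) (μ ν σ : ι) :
    ∑ m, P.T3 (f m) μ ν σ = P.T3 (fun i j k => ∑ m, f m i j k) μ ν σ := by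
  simp only [T3_eq, T1_sum, T2_sum]

lemma T3_rotate' (f : ι → ι → ι → A) (μ ν σ : ι) :
    P.T3 f σ μ ν = P.T3 (fun i j k => f k i j) μ ν σ := by
  rw [T3_rotate, T3_rotate]

/-- Frame components of the exterior covariant derivative of the curvature, before the cyclic
sum. -/
def dR (k i p q r : ι) : A :=
  P.D r (P.R k i p q) + ∑ m, P.B m p r * P.R k i m q + ∑ m, P.B m q r * P.R k i p m
    - (∑ m, P.G k m r * P.R m i p q - ∑ m, P.R k m p q * P.G m i r)

/-- This is `Fm_bianchi` read off in the frame. The form indices are differentiated with the plain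
coframe derivative `B`, which is harmless because the identity is one of exterior forms. -/
lemma dR_cyclic (k i p q r : ι) : P.dR k i p q r + P.dR k i q r p + P.dR k i r p q = 0 := by
  have h : ∀ μ ν σ, P.d σ (P.Fm μ ν k i) - ((P.om σ * P.Fm μ ν) k i - (P.Fm μ ν * P.om σ) k i)
      = P.T3 (P.dR k i) μ ν σ := fun μ ν σ => by
    simp only [Matrix.mul_apply, Fm_apply, om, Matrix.of_apply, d_T2]
    simp only [mul_comm (P.T1 _ _), T2_mul_T1, T3_sum, T3_sub]
    congr 1
    ext p q r
    simp only [dR, mul_comm (P.G _ _ _)]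
  refine P.T3_inj (t := fun p q r => P.dR k i p q r + P.dR k i q r p + P.dR k i r p q)
    (s := fun _ _ _ => 0) (fun μ ν σ => ?_) p q r
  have h1 := congrFun (congrFun (P.Fm_bianchi μ ν σ) k) i
  simp only [Matrix.add_apply, Matrix.sub_apply, dm, Matrix.map_apply, Matrix.zero_apply, h] at h1
  rw [P.T3_rotate _ μ ν σ, P.T3_rotate' _ μ ν σ, T3_add, T3_add] at h1
  rw [h1]
  simp [T3]

lemma sum_R_right (k p : ι) : ∑ i, P.R k i p i = -P.Ric k p := by
  rw [Ric, ← Finset.sum_neg_distrib]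
  exact Finset.sum_congr rfl fun i _ => by rw [P.R_swap i k]

lemma sum_R_right' (k p : ι) : ∑ i, P.R k i i p = P.Ric k p := by
  rw [Ric]
  exact Finset.sum_congr rfl fun i _ => by rw [P.R_swap i k, P.R_swap' i k]; ring

lemma sum_R_left (i q : ι) : ∑ k, P.R k i k q = -P.Ric i q := by
  rw [Ric, ← Finset.sum_neg_distrib]
  exact Finset.sum_congr rfl fun k _ => by rw [P.R_swap' k i]

lemma sum_G' (m : ι) : ∑ i, P.G m i i = -P.c m := by
  rw [← sum_G, ← Finset.sum_neg_distrib]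
  exact Finset.sum_congr rfl fun i _ => P.G_swap i m i

lemma sum_G_mul_symm {s : ι → ι → A} (hs : ∀ i j, s i j = s j i) (p : ι) :
    ∑ k, ∑ m, P.G k m p * s k m = 0 := by
  have h : ∑ k, ∑ m, P.G k m p * s k m = -∑ k, ∑ m, P.G k m p * s k m := by
    conv_lhs => rw [Finset.sum_comm]
    simp only [← Finset.sum_neg_distrib]
    exact Finset.sum_congr rfl fun k _ => Finset.sum_congr rfl fun m _ => by
      rw [P.G_swap k m, hs]; ring
  linear_combination half A * h - (∑ k, ∑ m, P.G k m p * s k m) * two_mul_half (A := A)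

/-- The contracted Bianchi identity. -/
lemma div_Ric (p : ι) :
    2 * (∑ k, (P.D k (P.Ric k p) - P.c k * P.Ric k p + ∑ m, P.G m p k * P.Ric k m))
      = P.D p (∑ k, P.Ric k k) := by
  -- Bianchi with q = i and r = k, summed over both. The three derivative terms give minus the
  -- divergence of Ricci twice and the derivative of the scalar curvature once.
  have h0 : ∑ k, ∑ i, (P.dR k i p i k + P.dR k i i k p + P.dR k i k p i) = 0 := by
    simp only [dR_cyclic, Finset.sum_const_zero]
  simp only [dR, Finset.sum_add_distrib, Finset.sum_sub_distrib] at h0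
  have e1 : ∑ k, ∑ i, P.D k (P.R k i p i) = -∑ k, P.D k (P.Ric k p) := by
    simp only [← map_sum, sum_R_right, map_neg, Finset.sum_neg_distrib]
  have e2 : ∑ k, ∑ i, P.D p (P.R k i i k) = ∑ k, P.D p (P.Ric k k) := by
    simp only [← map_sum, sum_R_right']
  have e3 : ∑ k, ∑ i, P.D i (P.R k i k p) = -∑ k, P.D k (P.Ric k p) := by
    rw [Finset.sum_comm]
    simp only [← map_sum, sum_R_left, map_neg, Finset.sum_neg_distrib]
  have b1 : ∑ k, ∑ i, ∑ m, P.B m p k * P.R k i m i = -∑ k, ∑ m, P.B m p k * P.Ric k m := by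
    simp only [← Finset.sum_neg_distrib]
    refine Finset.sum_congr rfl fun k _ => ?_
    rw [Finset.sum_comm]
    simp only [← Finset.mul_sum, sum_R_right, mul_neg]
  have b2 : ∑ k, ∑ i, ∑ m, P.B m i p * P.R k i m k = ∑ k, ∑ m, P.B m k p * P.Ric k m := by
    rw [Finset.sum_comm]
    refine Finset.sum_congr rfl fun k _ => ?_
    rw [Finset.sum_comm]
    simp only [← Finset.mul_sum, Ric]
  have b3 : ∑ k, ∑ i, ∑ m, P.B m k p * P.R k i i m = ∑ k, ∑ m, P.B m k p * P.Ric k m := by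
    refine Finset.sum_congr rfl fun k _ => ?_
    rw [Finset.sum_comm]
    simp only [← Finset.mul_sum, sum_R_right']
  have b4 : ∑ k, ∑ i, ∑ m, P.B m p i * P.R k i k m = -∑ k, ∑ m, P.B m p k * P.Ric k m := by
    rw [Finset.sum_comm]
    simp only [← Finset.sum_neg_distrib]
    refine Finset.sum_congr rfl fun k _ => ?_
    rw [Finset.sum_comm]
    simp only [← Finset.mul_sum, sum_R_left, mul_neg]
  have b5 : (∑ k, ∑ m, P.B m k p * P.Ric k m) - ∑ k, ∑ m, P.B m p k * P.Ric k m
      = -∑ k, ∑ m, P.G m p k * P.Ric k m := by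
    have : ∑ k, ∑ m, P.G m k p * P.Ric k m = 0 := by
      rw [Finset.sum_comm]
      exact P.sum_G_mul_symm (fun i j => P.Ric_comm j i) p
    rw [← sub_eq_zero, ← this]
    simp only [← Finset.sum_neg_distrib, ← Finset.sum_sub_distrib]
    refine Finset.sum_congr rfl fun k _ => Finset.sum_congr rfl fun m _ => ?_
    have := P.G_sub m k p
    rw [L] at this
    linear_combination -P.Ric k m * this
  have g1 : ∑ k, ∑ i, ∑ m, P.G k m k * P.R m i p i = -∑ k, P.c k * P.Ric k p := by
    have : ∀ k, ∑ i, ∑ m, P.G k m k * P.R m i p i = ∑ m, -(P.G k m k * P.Ric m p) := fun k => by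
      rw [Finset.sum_comm]
      simp only [← Finset.mul_sum, sum_R_right, mul_neg]
    simp only [this]
    rw [Finset.sum_comm, ← Finset.sum_neg_distrib]
    simp only [Finset.sum_neg_distrib, ← Finset.sum_mul, sum_G]
  have g2 : ∑ k, ∑ i, ∑ m, P.R k m k p * P.G m i i = ∑ k, P.c k * P.Ric k p := by
    have : ∀ k, ∑ i, ∑ m, P.R k m k p * P.G m i i = ∑ m, P.R k m k p * -P.c m := fun k => by
      rw [Finset.sum_comm]
      simp only [← Finset.mul_sum, sum_G']
    simp only [this]
    rw [Finset.sum_comm]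
    simp only [← Finset.sum_mul, sum_R_left]
    exact Finset.sum_congr rfl fun _ _ => by ring
  have g3 : ∑ k, ∑ i, ∑ m, P.G k m p * P.R m i i k = 0 := by
    rw [← P.sum_G_mul_symm P.Ric_comm p]
    refine Finset.sum_congr rfl fun k _ => ?_
    rw [Finset.sum_comm]
    simp only [← Finset.mul_sum, sum_R_right']
    exact Finset.sum_congr rfl fun m _ => by rw [P.Ric_comm]
  have g4 : ∑ k, ∑ i, ∑ m, P.R k m i k * P.G m i p = 0 := by
    rw [← P.sum_G_mul_symm P.Ric_comm p, Finset.sum_comm]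
    rw [Finset.sum_congr rfl fun i _ => Finset.sum_comm, Finset.sum_comm]
    refine Finset.sum_congr rfl fun k _ => Finset.sum_congr rfl fun i _ => ?_
    rw [← Finset.sum_mul, Ric, mul_comm]
  have t1 : ∑ k, ∑ i, ∑ m, P.R k m p i * P.G m i k = ∑ k, ∑ i, ∑ m, P.R k i p m * P.G i m k :=
    Finset.sum_congr rfl fun _ _ => Finset.sum_comm
  have t2 : ∑ k, ∑ i, ∑ m, P.G k m i * P.R m i k p = -∑ k, ∑ i, ∑ m, P.R k i p m * P.G m k i := by
    rw [Finset.sum_congr rfl fun i _ => Finset.sum_comm, Finset.sum_comm]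
    rw [Finset.sum_congr rfl fun i _ => Finset.sum_comm]
    simp only [← Finset.sum_neg_distrib]
    exact Finset.sum_congr rfl fun k _ => Finset.sum_congr rfl fun i _ =>
      Finset.sum_congr rfl fun m _ => by rw [P.R_swap' k i p m]; ring
  -- The terms in which the curvature is not traced to Ricci cancel because `B` minus `G`, the
  -- Levi-Civita coefficient, is symmetric in its last two indices.
  have t3 : (∑ k, ∑ i, ∑ m, P.B m i k * P.R k i p m) + (∑ k, ∑ i, ∑ m, P.B m k i * P.R k i m p)
      + (∑ k, ∑ i, ∑ m, P.R k i p m * P.G i m k) + (∑ k, ∑ i, ∑ m, P.R k i p m * P.G m k i)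
      = 0 := by
    simp only [← Finset.sum_add_distrib]
    refine Finset.sum_eq_zero fun k _ => Finset.sum_eq_zero fun i _ =>
      Finset.sum_eq_zero fun m _ => ?_
    have := P.G_sub m k i
    rw [L] at this
    rw [P.R_swap' k i p m, P.G_swap m i]
    linear_combination P.R k i p m * this
  simp only [Finset.sum_add_distrib, Finset.sum_sub_distrib, map_sum]
  linear_combination -h0 + e1 + e2 + e3 + b1 + b2 + b3 + b4 + 2 * b5 - g1 + t1 - t2 + g2 - g3 + g4
    + t3

/-- The frame is parallel for the canonical connection, so only the frame components are
differentiated. -/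
lemma div_V1 (X : ι → A) :
    ∑ α, (P.d α (P.V1 X α) + ∑ ε, P.V1 X ε * P.Gam α ε α) = ∑ k, P.D k (X k) := by
  have h : ∀ α, P.d α (P.V1 X α) = (∑ k, P.a k α * P.d α (X k))
      - ∑ ε, P.V1 X ε * P.Gam α ε α := fun α => by
    rw [V1, map_sum]
    simp only [Derivation.leibniz, smul_eq_mul, Finset.sum_add_distrib, d_a, mul_neg,
      Finset.sum_neg_distrib, V1, Finset.mul_sum, Finset.sum_mul]
    rw [Finset.sum_comm (f := fun ε k => P.a k ε * X k * P.Gam α ε α), sub_eq_add_neg]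
    congr 2
    exact Finset.sum_congr rfl fun _ _ => Finset.sum_congr rfl fun _ _ => by ring
  simp only [h, sub_add_cancel, D_apply]
  rw [Finset.sum_comm]

/-- The Levi-Civita divergence differs from the canonical one by the trace of the contortion, which
is `c`. -/
lemma div_V1' (X : ι → A) :
    ∑ α, (P.d α (P.V1 X α) + ∑ ε, P.V1 X ε * P.oGam α ε α) = ∑ k, (P.D k (X k) - P.c k * X k) := by
  have h : ∀ ε, ∑ α, P.oGam α ε α = (∑ α, P.Gam α ε α) - P.T1 P.c ε := fun ε => by
    have : ∑ α, P.ga α ε α = P.T1 P.c ε := by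
      simp only [ga_eq, M_eq', trace_mixed, T1_sum, sum_G]
    simp only [ga, Finset.sum_sub_distrib] at this
    linear_combination -this
  have h2 : ∀ Γ : ι → ι → ι → A, ∑ α, ∑ ε, P.V1 X ε * Γ α ε α = ∑ ε, P.V1 X ε * ∑ α, Γ α ε α :=
    fun Γ => by
    rw [Finset.sum_comm]
    simp only [Finset.mul_sum]
  rw [Finset.sum_sub_distrib, ← div_V1, Finset.sum_add_distrib, Finset.sum_add_distrib, h2, h2]
  simp only [h, mul_sub, Finset.sum_sub_distrib, sum_V1_mul_T1]
  simp only [mul_comm (X _)]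
  ring

end ParallelFrame
end EAP
end

/-! ### Divergence of the Einstein tensor, curl of C, and conservation identities -/

noncomputable section
namespace EAP
namespace ParallelFrame

variable {ι A : Type*} [Fintype ι] [DecidableEq ι] [CommRing A] [Algebra ℝ A]
variable (P : ParallelFrame ι A)

lemma sum_gInv_T2 (t : ι → ι → A) (μ ν : ι) :
    ∑ ε, P.gInv μ ε * P.T2 t ε ν = P.V1 (fun i => P.T1 (t i) ν) μ := by
  simp only [sum_gInv, T2_eq, sum_a_mul_T1]

/-- The divergence of a covariant tensor in the frame. -/
lemma div_T2 (t : ι → ι → A) (V : ι → ι → A)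
    (hV : ∀ μ ν, V μ ν = P.V1 (fun i => P.T1 (t i) ν) μ) (ν : ι) :
    ∑ μ, (P.d μ (V μ ν) + ∑ ε, V ε ν * P.oGam μ ε μ - ∑ ε, V μ ε * P.oGam ε ν μ)
      = P.T1 (fun j => ∑ i, (P.D i (t i j) - P.c i * t i j + ∑ m, P.G m j i * t i m)) ν := by
  have h1 : ∑ μ, ∑ ε, V μ ε * P.oGam ε ν μ
      = ∑ i, P.T1 (fun j => ∑ m, (P.B m j i - P.G m j i) * t i m) ν := by
    have : ∀ μ, ∑ ε, V μ ε * P.oGam ε ν μ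
        = P.V1 (fun i => P.T1 (fun k => P.T1 (fun j => ∑ m, (P.B m j k - P.G m j k) * t i m) ν) μ) μ :=
      fun μ => by
      simp only [hV, V1_T1, oGam_eq, M, mul_comm (P.T1 _ _), sum_V1_mul_T1]
      simp only [← V1_T1]
      simp only [V1, Finset.mul_sum]
      rw [Finset.sum_comm]
      refine Finset.sum_congr rfl fun i _ => ?_
      rw [← T2_eq', ← T2_sum, Finset.mul_sum]
      refine Finset.sum_congr rfl fun m _ => ?_
      rw [mul_left_comm, mul_comm (P.T2 _ _ _), mul_T2]
      congr 1
      exact P.T2_congr (fun _ _ => mul_comm _ _) _ _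
    simp only [this, trace_mixed]
  rw [Finset.sum_sub_distrib, h1]
  simp only [hV]
  rw [P.div_V1' (fun i => P.T1 (t i) ν), ← Finset.sum_sub_distrib, ← T1_sum]
  refine Finset.sum_congr rfl fun i _ => ?_
  rw [D_T1, mul_T1, T1_sub, T1_sub]
  congr 1
  ext j
  simp only [sub_mul, Finset.sum_sub_distrib]
  ring

/-- The scalar curvature. -/
def oScal : A := ∑ α, ∑ β, P.gInv α β * P.oRic α β

lemma trace_T2 (t : ι → ι → A) : ∑ α, ∑ β, P.gInv α β * P.T2 t α β = ∑ i, t i i := by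
  have h : ∀ α, ∑ β, P.gInv α β * P.T2 t α β = P.V1 (fun j => P.T1 (fun i => t i j) α) α :=
    fun α => by simp only [P.T2_swap _ _ α, sum_gInv_T2]
  simp only [h, trace_mixed]

lemma oScal_eq : P.oScal = ∑ i, P.Ric i i := by
  simp only [oScal, oRic_eq, trace_T2]

/-- The Einstein tensor. -/
def oEin (μ ν : ι) : A := P.oRic μ ν - half A * P.g μ ν * P.oScal

/-- Frame components of the Einstein tensor. -/
def Ein (i j : ι) : A := P.Ric i j - half A * (if i = j then 1 else 0) * ∑ k, P.Ric k k

lemma oEin_eq (μ ν : ι) : P.oEin μ ν = P.T2 P.Ein μ ν := by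
  rw [oEin, oRic_eq, g_eq, oScal_eq, mul_right_comm, mul_T2, T2_sub]
  exact P.T2_congr (fun i j => by rw [Ein]; ring) _ _

lemma D_half (i : ι) : P.D i (half A) = 0 := Derivation.map_algebraMap _ _

/-- In the trace part of the Einstein tensor the torsion trace and the contortion term cancel,
leaving minus half the derivative of the scalar curvature. What remains is half of `div_Ric`. -/
lemma div_Ein (j : ι) :
    ∑ i, (P.D i (P.Ein i j) - P.c i * P.Ein i j + ∑ m, P.G m j i * P.Ein i m) = 0 := by
  have h := P.div_Ric j
  have hd : ∀ i, P.D i (if i = j then 1 else 0) = 0 := fun i => by split_ifs <;> simp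
  have h1 : ∑ i, P.D i (P.Ein i j) = (∑ i, P.D i (P.Ric i j))
      - half A * P.D j (∑ k, P.Ric k k) := by
    simp only [Ein, map_sub, Derivation.leibniz, smul_eq_mul, D_half, hd, Finset.sum_sub_distrib]
    simp [mul_comm]
  have h2 : ∑ i, P.c i * P.Ein i j = (∑ i, P.c i * P.Ric i j)
      - half A * P.c j * ∑ k, P.Ric k k := by
    simp only [Ein, mul_sub, Finset.sum_sub_distrib]
    simp
    ring
  have h3 : ∑ i, ∑ m, P.G m j i * P.Ein i m = (∑ i, ∑ m, P.G m j i * P.Ric i m)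
      - half A * P.c j * ∑ k, P.Ric k k := by
    simp only [Ein, mul_sub, Finset.sum_sub_distrib]
    have : ∀ i, ∑ m, P.G m j i * (half A * (if i = m then 1 else 0) * ∑ k, P.Ric k k)
        = P.G i j i * (half A * ∑ k, P.Ric k k) := fun i => by simp
    simp only [this, ← Finset.sum_mul, sum_G]
    ring
  simp only [Finset.sum_add_distrib, Finset.sum_sub_distrib] at h ⊢
  rw [h1, h2, h3]
  linear_combination half A * h - ((∑ i, P.D i (P.Ric i j)) - (∑ i, P.c i * P.Ric i j)
    + ∑ i, ∑ m, P.G m j i * P.Ric i m) * two_mul_half (A := A)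

lemma div_oEin (V : ι → ι → A) (hV : ∀ μ ν, V μ ν = ∑ ε, P.gInv μ ε * P.oEin ε ν) (ν : ι) :
    ∑ μ, (P.d μ (V μ ν) + ∑ ε, V ε ν * P.oGam μ ε μ - ∑ ε, V μ ε * P.oGam ε ν μ) = 0 := by
  rw [P.div_T2 P.Ein V (fun μ ν => by simp only [hV, oEin_eq, sum_gInv_T2])]
  simp [T1, div_Ein]

/-- Frame components of the exterior derivative of the torsion trace. -/
def dc (i j : ι) : A := P.D j (P.c i) - P.D i (P.c j) + ∑ k, P.c k * P.L k i j

lemma curl_C (μ ν : ι) : P.d ν (P.C μ) - P.d μ (P.C ν) = P.T2 P.dc μ ν := by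
  rw [C_eq, C_eq, d_T1, d_T1, P.T2_swap _ μ ν, T2_sub]
  refine P.T2_congr (fun i j => ?_) _ _
  simp only [dc, L, sub_mul, Finset.sum_sub_distrib, mul_comm (P.c _)]
  ring

lemma sum_L (i : ι) : ∑ k, P.L k k i = -P.c i := by
  rw [c, ← Finset.sum_neg_distrib]
  exact Finset.sum_congr rfl fun k _ => P.L_swap k i k

/-- The contracted Jacobi identity of the frame. -/
lemma div_L (p q : ι) : ∑ m, P.D m (P.L m p q) = P.dc p q := by
  have hL : ∀ m μ ν, P.T2 (P.L m) μ ν = P.d ν (P.b m μ) - P.d μ (P.b m ν) := fun m μ ν => by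
    rw [d_b, d_b, P.T2_swap _ μ ν, T2_sub]
    rfl
  let J : ι → ι → ι → ι → A := fun m p q r => P.D r (P.L m p q) + ∑ n, P.B n p r * P.L m n q
    + ∑ n, P.B n q r * P.L m p n
  -- By `hL` the array `L m` is, up to sign, the exterior derivative of the covector dual to the
  -- m-th frame field, so its own exterior derivative vanishes. This is the Jacobi identity of the
  -- frame; contracting r with m gives the lemma.
  have hJ : ∀ m p q r, J m p q r + J m q r p + J m r p q = 0 := fun m p q r => by
    refine P.T3_inj (t := fun p q r => J m p q r + J m q r p + J m r p q)
      (s := fun _ _ _ => 0) (fun μ ν σ => ?_) p q r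
    rw [← T3_add, ← T3_add, ← P.T3_rotate (J m), ← P.T3_rotate' (J m)]
    simp only [J, ← d_T2, hL, map_sub]
    rw [P.comm σ ν, P.comm σ μ, P.comm μ ν]
    simp [T3]
  have h0 : ∑ m, (J m p q m + J m q m p + J m m p q) = 0 := by simp [hJ]
  simp only [J, Finset.sum_add_distrib] at h0
  have e1 : ∑ m, P.D p (P.L m q m) = P.D p (P.c q) := by rw [← map_sum]; rfl
  have e2 : ∑ m, P.D q (P.L m m p) = -P.D q (P.c p) := by
    rw [← map_sum, sum_L, map_neg]
  have e3 : ∑ m, ∑ n, P.B n q p * P.L m n m = ∑ n, P.c n * P.B n q p := by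
    rw [Finset.sum_comm]
    simp only [← Finset.mul_sum, mul_comm (P.c _)]; rfl
  have e4 : ∑ m, ∑ n, P.B n p q * P.L m m n = -∑ n, P.c n * P.B n p q := by
    rw [Finset.sum_comm]
    simp only [← Finset.mul_sum, sum_L, mul_neg, mul_comm (P.c _), Finset.sum_neg_distrib]
  -- The quadratic terms not containing the trace `c` combine into two products of torsions that
  -- agree after exchanging the summation indices.
  have e5 : (∑ m, ∑ n, P.B n p m * P.L m n q) + (∑ m, ∑ n, P.B n q m * P.L m p n)
      + (∑ m, ∑ n, P.B n m p * P.L m q n) + (∑ m, ∑ n, P.B n m q * P.L m n p) = 0 := by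
    have : ∑ m, ∑ n, P.L n q m * P.L m p n = ∑ m, ∑ n, P.L m q n * P.L n p m :=
      Finset.sum_comm
    have h1 : (∑ m, ∑ n, P.B n p m * P.L m n q) + (∑ m, ∑ n, P.B n m p * P.L m q n)
        = -∑ m, ∑ n, P.L m q n * P.L n p m := by
      rw [← Finset.sum_add_distrib, ← Finset.sum_neg_distrib]
      refine Finset.sum_congr rfl fun m _ => ?_
      rw [← Finset.sum_add_distrib, ← Finset.sum_neg_distrib]
      refine Finset.sum_congr rfl fun n _ => ?_
      rw [P.L_swap m q n]
      simp only [L]; ring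
    have h2 : (∑ m, ∑ n, P.B n q m * P.L m p n) + (∑ m, ∑ n, P.B n m q * P.L m n p)
        = ∑ m, ∑ n, P.L n q m * P.L m p n := by
      rw [← Finset.sum_add_distrib]
      refine Finset.sum_congr rfl fun m _ => ?_
      rw [← Finset.sum_add_distrib]
      refine Finset.sum_congr rfl fun n _ => ?_
      simp only [L]; ring
    linear_combination h1 + h2 + this
  rw [dc]
  have e6 : ∑ k, P.c k * P.L k p q = (∑ n, P.c n * P.B n p q) - ∑ n, P.c n * P.B n q p := by
    simp only [L, mul_sub, Finset.sum_sub_distrib]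
  rw [e6]
  linear_combination h0 - e1 - e2 - e3 - e4 - e5

/-- The symmetric connection coefficients drop out of the cyclic sum of a skew tensor, and what is
left is the exterior derivative of a curl. -/
lemma cyclic_curl (F : ι → ι → A) (C : ι → A)
    (hF : ∀ μ ν, F μ ν = P.d ν (C μ) - P.d μ (C ν)) (μ ν σ : ι) :
    (P.d σ (F μ ν) - ∑ ε, F ε ν * P.oGam ε μ σ - ∑ ε, F μ ε * P.oGam ε ν σ)
    + (P.d μ (F ν σ) - ∑ ε, F ε σ * P.oGam ε ν μ - ∑ ε, F ν ε * P.oGam ε σ μ)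
    + (P.d ν (F σ μ) - ∑ ε, F ε μ * P.oGam ε σ ν - ∑ ε, F σ ε * P.oGam ε μ ν) = 0 := by
  have hs : ∀ μ ν, F μ ν = -F ν μ := fun μ ν => by rw [hF, hF]; ring
  have h : ∀ μ ν σ, ∑ ε, F μ ε * P.oGam ε ν σ = -∑ ε, F ε μ * P.oGam ε ν σ := fun μ ν σ => by
    rw [← Finset.sum_neg_distrib]
    exact Finset.sum_congr rfl fun ε _ => by rw [hs μ ε]; ring
  rw [h, h, h, hF, hF ν σ, hF σ μ]
  simp only [map_sub, P.oGam_comm _ μ σ, P.oGam_comm _ ν μ, P.oGam_comm _ σ ν]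
  rw [P.comm σ ν, P.comm σ μ, P.comm μ ν]
  ring

/-- In the divergence of a skew tensor only `kap` survives from the connection. Every term of the
second divergence then pairs the skew F with something symmetric, by commuting derivations and
closedness of `kap`, or cancels against its mirror image. -/
lemma div_div_skew (F : ι → ι → A) (hF : ∀ μ ν, F μ ν = -F ν μ) (J : ι → A)
    (hJ : ∀ μ, J μ = ∑ ν, (P.d ν (F μ ν) + ∑ ε, F ε ν * P.oGam μ ε ν + ∑ ε, F μ ε * P.oGam ν ε ν)) :
    ∑ μ, (P.d μ (J μ) + ∑ ε, J ε * P.oGam μ ε μ) = 0 := by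
  have hsk : ∀ X : ι → ι → A, (∀ μ ν, X μ ν = -X ν μ) → ∑ μ, ∑ ν, X μ ν = 0 := fun X hX => by
    have h : ∑ μ, ∑ ν, X μ ν = -∑ μ, ∑ ν, X μ ν := by
      conv_lhs => rw [Finset.sum_comm]
      simp only [← Finset.sum_neg_distrib]
      exact Finset.sum_congr rfl fun μ _ => Finset.sum_congr rfl fun ν _ => hX ν μ
    linear_combination half A * h - (∑ μ, ∑ ν, X μ ν) * two_mul_half (A := A)
  have hk : ∀ ε, ∑ ν, P.oGam ν ε ν = P.kap ε := fun ε => by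
    simp only [kap, P.oGam_comm _ _ ε]
  have h1 : ∀ μ, J μ = ∑ ν, P.d ν (F μ ν) + ∑ ε, F μ ε * P.kap ε := fun μ => by
    rw [hJ, Finset.sum_add_distrib, Finset.sum_add_distrib]
    rw [hsk (fun ν ε => F ε ν * P.oGam μ ε ν) (fun ν ε => by rw [hF, P.oGam_comm]; ring), add_zero,
      Finset.sum_comm (f := fun ν ε => F μ ε * P.oGam ν ε ν)]
    simp only [← Finset.mul_sum, hk]
  have h2 : ∑ μ, ∑ ε, J ε * P.oGam μ ε μ = ∑ ε, J ε * P.kap ε := by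
    rw [Finset.sum_comm]
    simp only [← Finset.mul_sum, hk]
  rw [Finset.sum_add_distrib, h2]
  simp only [h1, map_add, map_sum, Derivation.leibniz, smul_eq_mul, add_mul, Finset.sum_mul,
    Finset.sum_add_distrib]
  rw [hsk (fun μ ν => P.d μ (P.d ν (F μ ν))) (fun μ ν => by rw [P.comm, hF, map_neg, map_neg]),
    hsk (fun μ ν => F μ ν * P.d μ (P.kap ν)) (fun μ ν => by rw [P.d_kap, hF]; ring),
    hsk (fun μ ν => F μ ν * P.kap ν * P.kap μ) (fun μ ν => by rw [hF]; ring),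
    Finset.sum_comm (f := fun μ ν => P.kap ν * P.d μ (F μ ν))]
  have h3 : ∑ ν, ∑ μ, P.kap ν * P.d μ (F μ ν) = -∑ ν, ∑ μ, P.d μ (F ν μ) * P.kap ν := by
    simp only [← Finset.sum_neg_distrib]
    exact Finset.sum_congr rfl fun ν _ => Finset.sum_congr rfl fun μ _ => by
      rw [hF μ ν, map_neg]; ring
  rw [h3]
  ring

end ParallelFrame
end EAP
end

/-! ### Symmetric and skew parts of the Euler–Lagrange expression -/

noncomputable section
namespace EAP
namespace ParallelFrame

/-- A double or triple sum vanishes once its summand symmetrised over the summation indices does.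
Identities that hold only after renaming such indices thereby become pointwise polynomial
identities. -/
lemma sum2_eq_zero {ι A : Type*} [Fintype ι] [CommRing A] [Algebra ℝ A]
    {f : ι → ι → A} (h : ∀ a b, f a b + f b a = 0) : ∑ a, ∑ b, f a b = 0 := by
  have h1 : (∑ a, ∑ b, f a b) + ∑ a, ∑ b, f a b = 0 := by
    conv_lhs => arg 2; rw [Finset.sum_comm]
    simp only [← Finset.sum_add_distrib, h, Finset.sum_const_zero]
  linear_combination half A * h1 - (∑ a, ∑ b, f a b) * two_mul_half (A := A)

lemma sum3_eq_zero {ι A : Type*} [Fintype ι] [CommRing A] [Algebra ℝ A]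
    {f : ι → ι → ι → A}
    (h : ∀ a b c, f a b c + f a c b + f b a c + f b c a + f c a b + f c b a = 0) :
    ∑ a, ∑ b, ∑ c, f a b c = 0 := by
  have s1 : ∀ f : ι → ι → ι → A, ∑ a, ∑ b, ∑ c, f a c b = ∑ a, ∑ b, ∑ c, f a b c := fun f =>
    Finset.sum_congr rfl fun _ _ => Finset.sum_comm
  have s2 : ∀ f : ι → ι → ι → A, ∑ a, ∑ b, ∑ c, f b a c = ∑ a, ∑ b, ∑ c, f a b c := fun f =>
    Finset.sum_comm
  have h1 : ∑ a, ∑ b, ∑ c, (f a b c + f a c b + f b a c + f b c a + f c a b + f c b a) = 0 := by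
    simp only [h, Finset.sum_const_zero]
  simp only [Finset.sum_add_distrib] at h1
  rw [s1 f, s2 f, s2 (fun a b c => f a c b), s1 (fun a b c => f b a c), s2 f,
    s1 (fun a b c => f b c a), s2 (fun a b c => f a c b), s1 f] at h1
  have h6 : (6 : A) * algebraMap ℝ A (1 / 6) = 1 := by
    rw [← map_ofNat (algebraMap ℝ A) 6, ← map_mul]
    norm_num
  linear_combination algebraMap ℝ A (1 / 6) * h1 - (∑ a, ∑ b, ∑ c, f a b c) * h6

variable {ι A : Type*} [Fintype ι] [DecidableEq ι] [CommRing A] [Algebra ℝ A]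
variable (P : ParallelFrame ι A)

/-- Writing the contortion as the antisymmetrisation of an array without symmetries builds `G_swap`
into the notation, so that `ring` can see the cancellations. -/
lemma exists_G_eq : ∃ H : ι → ι → ι → A, ∀ k i j, P.G k i j = H k i j - H i k j :=
  ⟨fun k i j => half A * P.G k i j, fun k i j => by
    have := P.G_swap k i j
    linear_combination half A * this - P.G k i j * two_mul_half (A := A)⟩

lemma Ric_formula (i q : ι) : P.Ric i q = ∑ k, P.D k (P.G k i q) - P.D q (P.c i)
    + ∑ k, ∑ m, P.L m q k * P.G k i m + ∑ k, ∑ m, P.G k m q * P.G m i k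
    - ∑ m, P.c m * P.G m i q := by
  have h1 : ∑ k, P.D q (P.G k i k) = P.D q (P.c i) := by rw [← map_sum, sum_G]
  have h2 : ∑ k, ∑ m, P.G k m k * P.G m i q = ∑ m, P.c m * P.G m i q := by
    rw [Finset.sum_comm]
    simp only [← Finset.sum_mul, sum_G]
  simp only [Ric, R, Finset.sum_add_distrib, Finset.sum_sub_distrib, h1, h2]
  ring

/-- Frame components of `σ`. -/
def sigF (i j : ι) : A := ∑ k, ∑ l, P.G k l i * P.G l k j

/-- Frame components of `ϖ`. -/
def varpiF (i j : ι) : A := ∑ k, ∑ l, (P.G k l i * P.G l j k + P.G k i l * P.G l k j)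

/-- Frame components of the quadratic torsion tensor `Λ^α_{εμ} Λ^ε_{αν} - C_μ C_ν`. -/
def Lq (i j : ι) : A := ∑ k, ∑ l, P.L k l i * P.L l k j - P.c i * P.c j

/-- Frame components of the energy-momentum tensor when the nonlinear connection is integrable;
`n` are the frame components of `N_β`. -/
def TF (n : ι → A) (i j : ι) : A :=
  half A * (if i = j then 1 else 0) * ((∑ k, P.sigF k k) - (∑ k, P.varpiF k k)
      + 2 * ∑ k, P.c k * n k)
    - (P.sigF i j - P.varpiF i j)
    + (half A * (∑ k, n k * (P.G k i j + P.G k j i)) - half A * (P.c i * n j + P.c j * n i))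

/-- Frame components of the electromagnetic field strength when the nonlinear connection is
integrable. -/
def FF (n : ι → A) (i j : ι) : A :=
  (∑ k, P.c k * P.G i j k) - (∑ k, P.D k (P.G i j k)) + (∑ k, P.c k * P.L k i j)
    + (∑ k, n k * P.L k i j)
    + (half A * ((∑ k, n k * P.L i j k) - ∑ k, n k * P.L j i k)
      - half A * (P.c i * n j - P.c j * n i))

/-- Frame components of the Euler–Lagrange expression. -/
def el (n : ι → A) (b s : ι) : A :=
  (if b = s then 1 else 0) * (∑ k, P.Lq k k) - 2 * P.Lq b s
    - (2 * (∑ m, P.D m (P.L b s m)) - 2 * P.dc s b - 2 * P.D s (P.c b)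
      + 2 * (if b = s then 1 else 0) * ∑ m, P.D m (P.c m))
    + (2 * (∑ m, P.c m * P.L b s m) - 2 * (∑ m, P.c m * P.L m s b) - 2 * (P.c s * P.c b)
      + 2 * (if b = s then 1 else 0) * ∑ m, P.c m * P.c m)
    + (2 * (∑ m, n m * P.L b s m) - 2 * (∑ m, n m * P.L m s b) - 2 * (n s * P.c b)
      + 2 * (if b = s then 1 else 0) * ∑ m, P.c m * n m)

/-- Up to the divergence of `c` and terms quadratic in the fields, the Lagrangian is the scalar
curvature. The left side is the coefficient of the identity array in `el`, apart from the term with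
N_β. -/
lemma scalar_identity : (∑ k, P.Lq k k) - 2 * (∑ m, P.D m (P.c m)) + 2 * ∑ m, P.c m * P.c m
    = ∑ k, P.Ric k k + (∑ k, P.sigF k k - ∑ k, P.varpiF k k) := by
  have hG : ∀ k, ∑ i, P.D k (P.G k i i) = -P.D k (P.c k) := fun k => by
    rw [← map_sum, sum_G', map_neg]
  have hc : ∑ i, ∑ m, P.c m * P.G m i i = -∑ m, P.c m * P.c m := by
    rw [Finset.sum_comm]
    simp only [← Finset.mul_sum, sum_G', mul_neg, Finset.sum_neg_distrib]
  have hD : ∑ i, ∑ k, P.D k (P.G k i i) = -∑ m, P.D m (P.c m) := by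
    rw [Finset.sum_comm]
    simp only [hG, Finset.sum_neg_distrib]
  have key : ∑ i, ∑ k, ∑ m, (P.L k m i * P.L m k i - P.L m i k * P.G k i m - P.G k m i * P.G m i k
      - P.G k m i * P.G m k i + (P.G k m i * P.G m i k + P.G k i m * P.G m k i)) = 0 := by
    obtain ⟨H, hH⟩ := P.exists_G_eq
    refine sum3_eq_zero fun a b c => ?_
    simp only [← G_sub, hH]
    ring
  simp only [Finset.sum_add_distrib, Finset.sum_sub_distrib] at key
  simp only [Ric_formula, Lq, sigF, varpiF, Finset.sum_add_distrib, Finset.sum_sub_distrib, hc, hD]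
  linear_combination key

lemma dc_swap (i j : ι) : P.dc j i = -P.dc i j := by
  simp only [dc, P.L_swap _ i j, mul_neg, Finset.sum_neg_distrib]
  ring

/-- Skewness of the contortion turns the symmetrised torsion L_{bsm} + L_{sbm} into G_{mbs} +
G_{msb}, whose divergence is the second-order part of the Ricci tensor; the trace terms are
`scalar_identity`. -/
lemma el_symm (n : ι → A) (b s : ι) :
    P.el n b s + P.el n s b = -4 * (P.Ein b s - P.TF n b s) := by
  have hs := P.scalar_identity
  have r1 := P.Ric_formula b s
  have r2 := P.Ric_formula s b
  have rc := P.Ric_comm s b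
  have l1 : P.Lq b s = ∑ k, ∑ l, P.L k l b * P.L l k s - P.c b * P.c s := rfl
  have l2 : P.Lq s b = ∑ k, ∑ l, P.L k l s * P.L l k b - P.c s * P.c b := rfl
  have sg : P.sigF b s = ∑ k, ∑ l, P.G k l b * P.G l k s := rfl
  have vp : P.varpiF b s = (∑ k, ∑ l, P.G k l b * P.G l s k)
      + ∑ k, ∑ l, P.G k b l * P.G l k s := by
    simp only [varpiF, Finset.sum_add_distrib]
  have hD : (∑ m, P.D m (P.L b s m)) + (∑ m, P.D m (P.L s b m))
      = (∑ k, P.D k (P.G k b s)) + ∑ k, P.D k (P.G k s b) := by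
    simp only [← Finset.sum_add_distrib, ← map_add]
    refine Finset.sum_congr rfl fun m _ => congrArg _ ?_
    rw [← G_sub, ← G_sub, P.G_swap b s, P.G_swap m b, P.G_swap m s]
    ring
  have hL : ∀ n : ι → A, (∑ m, n m * P.L b s m) - (∑ m, n m * P.L m s b)
      + ((∑ m, n m * P.L s b m) - (∑ m, n m * P.L m b s)) = ∑ k, n k * (P.G k b s + P.G k s b) :=
    fun n => by
    simp only [← Finset.sum_add_distrib, ← Finset.sum_sub_distrib]
    refine Finset.sum_congr rfl fun m _ => ?_
    rw [P.L_swap m b s, ← G_sub, ← G_sub, ← G_sub, P.G_swap b s, P.G_swap m b, P.G_swap m s]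
    ring
  have hc := hL P.c
  have hn := hL n
  simp only [mul_add, Finset.sum_add_distrib] at hc
  -- All remaining terms quadratic in torsion and contortion; they cancel after exchanging k and l.
  have key : ∑ k, ∑ l, (P.L k l b * P.L l k s + P.L k l s * P.L l k b
      - (P.L l s k * P.G k b l + P.G k l s * P.G l b k)
      - (P.L l b k * P.G k s l + P.G k l b * P.G l s k)
      - 2 * (P.G k l b * P.G l k s - (P.G k l b * P.G l s k + P.G k b l * P.G l k s))) = 0 := by
    obtain ⟨H, hH⟩ := P.exists_G_eq
    refine sum2_eq_zero fun k l => ?_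
    simp only [← G_sub, hH]
    ring
  have h2 := two_mul_half (A := A)
  simp only [Finset.sum_add_distrib, Finset.sum_sub_distrib, ← Finset.mul_sum] at key
  simp only [el, Ein, TF, P.dc_swap b s, eq_comm (a := s)]
  linear_combination -2 * hD + 2 * (if b = s then 1 else 0) * hs + 2 * hc + 2 * hn + 2 * r1 + 2 * r2
    - 2 * rc - 2 * l1 - 2 * l2 + 4 * sg - 4 * vp - 2 * key
    - 2 * ((if b = s then 1 else 0) * (∑ k, P.Ric k k + (∑ k, P.sigF k k - ∑ k, P.varpiF k k
      + 2 * ∑ k, P.c k * n k)) + ∑ k, n k * (P.G k b s + P.G k s b)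
      - (P.c b * n s + P.c s * n b)) * h2

/-- Here L_{bsm} - L_{sbm} equals 2 G_{bsm} + L_{mbs}. The divergence of the first term is ξ, while
that of the second is the curl of `c` by `div_L`. -/
lemma el_skew (n : ι → A) (b s : ι) :
    P.el n b s - P.el n s b = 4 * (P.FF n b s - P.dc b s) := by
  have hG : ∀ m, P.L b s m - P.L s b m = 2 * P.G b s m + P.L m b s := fun m => by
    rw [← G_sub, ← G_sub, ← G_sub, P.G_swap b s, P.G_swap m b, P.G_swap m s]
    ring
  have hD : (∑ m, P.D m (P.L b s m)) - (∑ m, P.D m (P.L s b m))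
      = 2 * (∑ k, P.D k (P.G b s k)) + P.dc b s := by
    rw [← div_L, Finset.mul_sum]
    simp only [← Finset.sum_add_distrib, ← Finset.sum_sub_distrib, ← map_sub, hG]
    exact Finset.sum_congr rfl fun m _ => by
      rw [map_add, two_mul, map_add, two_mul]
  have hL : ∀ n : ι → A, (∑ m, n m * P.L b s m) - (∑ m, n m * P.L s b m)
      = 2 * (∑ m, n m * P.G b s m) + ∑ m, n m * P.L m b s := fun n => by
    simp only [Finset.mul_sum, ← Finset.sum_add_distrib, ← Finset.sum_sub_distrib]
    exact Finset.sum_congr rfl fun m _ => by linear_combination n m * hG m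
  have hs : ∀ n : ι → A, ∑ m, n m * P.L m s b = -∑ m, n m * P.L m b s := fun n => by
    simp only [P.L_swap _ b s, mul_neg, Finset.sum_neg_distrib]
  have hq : P.Lq s b = P.Lq b s := by
    rw [Lq, Lq, Finset.sum_comm, mul_comm (P.c s)]
    simp only [mul_comm (P.L _ _ s)]
  have hdc : P.dc b s = P.D s (P.c b) - P.D b (P.c s) + ∑ k, P.c k * P.L k b s := rfl
  have h2 := two_mul_half (A := A)
  have hc := hL P.c
  simp only [el, FF, P.dc_swap b s, eq_comm (a := s), hs, hq]
  linear_combination -2 * hD + 2 * hc - 2 * hdc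
    - 2 * (∑ k, n k * P.L b s k - ∑ k, n k * P.L s b k - (P.c b * n s - P.c s * n b)) * h2

end ParallelFrame
end EAP
end

/-! ### Divergence of the momentum and assembly of the field equations -/

noncomputable section
namespace EAP
namespace ParallelFrame

variable {ι A : Type*} [Fintype ι] [DecidableEq ι] [CommRing A] [Algebra ℝ A]
variable (P : ParallelFrame ι A)

/-- Frame components of the derivative of the Lagrangian, divided by `2 det λ`, with respect to the
derivatives of the coframe. -/
def S (j b c : ι) : A :=
  2 * (P.L b j c - P.L c j b) - 2 * ((if j = c then 1 else 0) * P.c b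
    - (if j = b then 1 else 0) * P.c c)

lemma S_swap (j b c : ι) : P.S j c b = -P.S j b c := by simp only [S]; ring

lemma D_V1 (i : ι) (f : ι → A) (α : ι) :
    P.D i (P.V1 f α) = P.V1 (fun b => P.D i (f b) - ∑ k, P.B b k i * f k) α := by
  conv_lhs => rw [V1, map_sum]
  simp only [Derivation.leibniz, smul_eq_mul, D_a, Finset.sum_add_distrib, mul_neg,
    Finset.sum_neg_distrib, V1, mul_sub, Finset.sum_sub_distrib, Finset.mul_sum]
  rw [Finset.sum_comm (f := fun x y => f x * (P.a y α * P.B y x i)), ← sub_eq_add_neg]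
  congr 1
  exact Finset.sum_congr rfl fun _ _ => Finset.sum_congr rfl fun _ _ => by ring

lemma V1_sub (f f' : ι → A) (μ : ι) : P.V1 f μ - P.V1 f' μ = P.V1 (fun i => f i - f' i) μ := by
  simp only [V1, mul_sub, Finset.sum_sub_distrib]

lemma V1_add (f f' : ι → A) (μ : ι) : P.V1 f μ + P.V1 f' μ = P.V1 (fun i => f i + f' i) μ := by
  simp only [V1, mul_add, Finset.sum_add_distrib]

lemma mul_V1 (x : A) (f : ι → A) (μ : ι) : x * P.V1 f μ = P.V1 (fun i => x * f i) μ := by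
  simp only [V1, Finset.mul_sum]
  exact Finset.sum_congr rfl fun _ _ => by ring

lemma V1_sum (f : ι → ι → A) (μ : ι) : ∑ k, P.V1 (f k) μ = P.V1 (fun i => ∑ k, f k i) μ := by
  simp only [V1, Finset.mul_sum]
  rw [Finset.sum_comm]

/-- Frame components of the momentum divergence. -/
def divS (j b : ι) : A :=
  ∑ c, (P.D c (P.S j b c) - P.c c * P.S j b c) - ∑ c, ∑ k, P.B b k c * P.S j k c

/-- The hypothesis makes e a density such as det λ. It converts the plain divergence over γ into a
Levi-Civita divergence, to which `div_V1'` applies; the index β is handled by differentiating the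
frame. -/
lemma sum_d_momentum {e : A} (he : ∀ γ, P.d γ e = e * P.kap γ) (j β : ι) :
    ∑ γ, P.d γ (e * P.V1 (fun c => P.V1 (fun b => P.S j b c) β) γ)
      = e * P.V1 (P.divS j) β := by
  have h := P.div_V1' (fun c => P.V1 (fun b => P.S j b c) β)
  have hk : ∀ X : ι → A, ∑ α, ∑ ε, X ε * P.oGam α ε α = ∑ ε, X ε * P.kap ε := fun X => by
    rw [Finset.sum_comm]
    simp only [← Finset.mul_sum, kap, P.oGam_comm _ _ _]
  simp only [Derivation.leibniz, smul_eq_mul, he]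
  rw [Finset.sum_add_distrib, hk] at h
  have h2 : ∑ γ, (e * P.d γ (P.V1 (fun c => P.V1 (fun b => P.S j b c) β) γ)
      + P.V1 (fun c => P.V1 (fun b => P.S j b c) β) γ * (e * P.kap γ))
      = e * (∑ γ, P.d γ (P.V1 (fun c => P.V1 (fun b => P.S j b c) β) γ)
        + ∑ γ, P.V1 (fun c => P.V1 (fun b => P.S j b c) β) γ * P.kap γ) := by
    rw [mul_add, Finset.mul_sum, Finset.mul_sum, Finset.sum_add_distrib]
    congr 1
    exact Finset.sum_congr rfl fun _ _ => by ring
  rw [h2, h]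
  congr 1
  simp only [D_V1, mul_V1, V1_sub, V1_sum]
  congr 1
  ext b
  simp only [divS, Finset.sum_sub_distrib]
  ring

/-- Frame components of the derivative of the Lagrangian, divided by `det λ`, with respect to the
coframe. -/
def dH (j b : ι) : A :=
  (if b = j then 1 else 0) * (∑ k, P.Lq k k) - 2 * (∑ i, ∑ k, P.L k j i * P.L b k i)
    - 2 * P.Lq b j + 2 * ∑ i, P.L b i j * P.c i

/-- The three summands are the force, the momentum divergence and the N_β term produced by the
directional derivatives. -/
lemma el_eq (n : ι → A) (j b : ι) :
    P.dH j b - P.divS j b + ∑ c, n c * P.S j b c = P.el n b j := by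
  have hS : ∀ n : ι → A, ∑ c, n c * P.S j b c = 2 * (∑ m, n m * P.L b j m)
      - 2 * (∑ m, n m * P.L m j b) - 2 * (n j * P.c b)
      + 2 * (if b = j then 1 else 0) * ∑ m, P.c m * n m := fun n => by
    have h : ∀ c, n c * P.S j b c = 2 * (n c * P.L b j c) - 2 * (n c * P.L c j b)
        - 2 * (n c * P.c b) * (if j = c then 1 else 0)
        + 2 * (if b = j then 1 else 0) * (P.c c * n c) := fun c => by
      simp only [S, eq_comm (a := b) (b := j)]; ring
    simp only [h, Finset.sum_add_distrib, Finset.sum_sub_distrib, ← Finset.mul_sum]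
    simp
  have hD : ∑ c, P.D c (P.S j b c) = 2 * (∑ m, P.D m (P.L b j m))
      - 2 * P.dc j b - 2 * P.D j (P.c b)
      + 2 * (if b = j then 1 else 0) * ∑ m, P.D m (P.c m) := by
    have h2 : ∀ i, P.D i (2 : A) = 0 := fun i => by
      rw [← map_ofNat (algebraMap ℝ A) 2]; exact Derivation.map_algebraMap _ _
    have hd : ∀ i j k : ι, P.D i (if j = k then 1 else 0) = 0 := fun i j k => by
      split_ifs <;> simp
    have h : ∀ c, P.D c (P.S j b c) = 2 * P.D c (P.L b j c) - 2 * P.D c (P.L c j b)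
        - 2 * (P.D c (P.c b)) * (if j = c then 1 else 0)
        + 2 * (if b = j then 1 else 0) * P.D c (P.c c) := fun c => by
      simp only [S, map_sub, Derivation.leibniz, smul_eq_mul, h2, hd, eq_comm (a := b)]
      ring
    rw [← div_L]
    simp only [h, Finset.sum_add_distrib, Finset.sum_sub_distrib, ← Finset.mul_sum]
    simp
  have hB : ∑ c, ∑ k, P.B b k c * P.S j k c
      = 2 * (∑ i, ∑ k, P.L k j i * P.L b k i) + 2 * ∑ m, P.c m * P.L b j m := by
    -- The momentum is skew in its last two indices, so only the skew half of `B`, that is half the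
    -- torsion, contributes.
    have h1 : ∑ c, ∑ k, (P.B b k c * P.S j k c - half A * (P.L b k c * P.S j k c)) = 0 :=
      sum2_eq_zero fun c k => by
        rw [P.S_swap j k c, L, L]
        linear_combination ((P.B b c k - P.B b k c) * P.S j k c) * two_mul_half (A := A)
    have h2 : ∑ c, ∑ k, (P.L b k c * (P.L k j c - P.L c j k) - 2 * (P.L k j c * P.L b k c)) = 0 :=
      sum2_eq_zero fun c k => by rw [P.L_swap b k c]; ring
    have h3 : ∑ c, ∑ k, P.L b k c * P.S j k c
        = 2 * (∑ c, ∑ k, P.L b k c * (P.L k j c - P.L c j k)) + 4 * ∑ m, P.c m * P.L b j m := by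
      have h : ∀ c k, P.L b k c * P.S j k c = 2 * (P.L b k c * (P.L k j c - P.L c j k))
          - 2 * (P.c k * P.L b k c) * (if j = c then 1 else 0)
          + 2 * (P.c c * P.L b k c) * (if j = k then 1 else 0) := fun c k => by
        rw [S]; ring
      have h' : ∑ k, P.c k * P.L b k j = -∑ k, P.c k * P.L b j k := by
        simp only [P.L_swap b j, mul_neg, Finset.sum_neg_distrib]
      simp only [h, Finset.sum_add_distrib, Finset.sum_sub_distrib, ← Finset.mul_sum]
      rw [Finset.sum_comm (f := fun c k => 2 * (P.c k * P.L b k c) * (if j = c then 1 else 0))]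
      simp [← Finset.mul_sum, h']
      ring
    have h4 : ∑ c, ∑ k, P.L b k c * (P.L k j c - P.L c j k)
        = 2 * (∑ i, ∑ k, P.L k j i * P.L b k i) := by
      rw [← sub_eq_zero, ← h2]
      simp only [Finset.mul_sum, ← Finset.sum_sub_distrib]
    simp only [Finset.sum_sub_distrib, ← Finset.mul_sum] at h1
    linear_combination h1 + half A * h3 + h4
      + ((∑ c, ∑ k, P.L b k c * (P.L k j c - P.L c j k)) + 2 * ∑ m, P.c m * P.L b j m)
        * two_mul_half (A := A)
  have hc : ∑ i, P.L b i j * P.c i = -∑ m, P.c m * P.L b j m := by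
    rw [← Finset.sum_neg_distrib]
    exact Finset.sum_congr rfl fun i _ => by rw [P.L_swap b j i]; ring
  rw [divS, Finset.sum_sub_distrib, hS, hS, hD, hB, dH, hc, el]
  ring

end ParallelFrame
end EAP
end

/-! ### Coordinate contractions in frame components -/

noncomputable section
namespace EAP
namespace ParallelFrame

variable {ι A : Type*} [Fintype ι] [DecidableEq ι] [CommRing A] [Algebra ℝ A]
variable (P : ParallelFrame ι A)

lemma sum_ga_sig (μ ν : ι) :
    ∑ α, ∑ β, P.ga β α μ * P.ga α β ν = P.T2 P.sigF μ ν := by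
  simp only [ga_eq, M_eq, trace_mul_mixed, T1_mul_T1, T2_sum]
  rfl

lemma sum_ga_varpi (μ ν : ι) :
    ∑ α, ∑ β, (P.ga β α μ * P.ga α ν β + P.ga β μ α * P.ga α β ν) = P.T2 P.varpiF μ ν := by
  have h1 : ∑ α, ∑ β, P.ga β α μ * P.ga α ν β
      = P.T2 (fun i j => ∑ k, ∑ l, P.G k l i * P.G l j k) μ ν := by
    have : ∀ β α, P.ga β α μ * P.ga α ν β = P.V1 (fun k => P.T1 (fun i => P.T1 (P.G k i) μ) α) β
        * P.V1 (fun k => P.T1 (fun j => P.T1 (fun i => P.G k i j) ν) β) α := fun β α => by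
      rw [ga_eq, ga_eq, M_eq, M_eq']
    simp only [this, trace_mul_mixed, T1_mul_T1, T2_sum]
  have h2 : ∑ α, ∑ β, P.ga β μ α * P.ga α β ν
      = P.T2 (fun i j => ∑ k, ∑ l, P.G k i l * P.G l k j) μ ν := by
    have : ∀ β α, P.ga β μ α * P.ga α β ν
        = P.V1 (fun k => P.T1 (fun j => P.T1 (fun i => P.G k i j) μ) α) β
        * P.V1 (fun k => P.T1 (fun i => P.T1 (P.G k i) ν) β) α := fun β α => by
      rw [ga_eq, ga_eq, M_eq', M_eq]
    simp only [this, trace_mul_mixed, T1_mul_T1, T2_sum]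
  simp only [Finset.sum_add_distrib]
  rw [h1, h2, T2_add]
  simp only [← Finset.sum_add_distrib]
  rfl

lemma sum_g_mul_M (f : ι → ι → ι → A) (α μ ν : ι) :
    ∑ ε, P.g α ε * P.M f ε μ ν = P.T3 f α μ ν := by
  have h : ∀ ε, P.g α ε = P.T1 (fun i => P.b i α) ε := fun ε =>
    Finset.sum_congr rfl fun _ _ => mul_comm _ _
  simp only [h, sum_T1_mul_M, T3_eq, ← T2_sum, ← mul_T2]
  rfl

lemma sum_gInv_mul_T3 (f : ι → ι → ι → A) (α μ ν : ι) :
    ∑ ε, P.gInv α ε * P.T3 f μ ν ε = P.M (fun k i j => f i j k) α μ ν := by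
  simp only [sum_gInv, T3_eq', sum_a_mul_T1, M]

lemma sum_gInv_mul_T1 (n : ι → A) (α : ι) :
    ∑ ε, P.gInv α ε * P.T1 n ε = P.V1 n α := by
  simp only [sum_gInv, sum_a_mul_T1]

lemma sum_V1_mul_T3 (n : ι → A) (f : ι → ι → ι → A) (μ ν : ι) :
    ∑ β, P.V1 n β * P.T3 f β μ ν = P.T2 (fun i j => ∑ k, n k * f k i j) μ ν := by
  simp only [T3_eq, sum_V1_mul_T1, mul_T2, T2_sum]

lemma sum_V1_mul_T3' (n : ι → A) (f : ι → ι → ι → A) (μ ν : ι) :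
    ∑ β, P.V1 n β * P.T3 f μ ν β = P.T2 (fun i j => ∑ k, n k * f i j k) μ ν := by
  simp only [T3_eq', sum_V1_mul_T1, mul_T2, T2_sum]

/-- All frame and coframe fields are parallel for the canonical connection, so the divergence acts
on the components alone. This evaluates ξ. -/
lemma div_M (f : ι → ι → ι → A) (μ ν : ι) :
    ∑ α, (P.d α (P.M f α μ ν) + ∑ ε, P.M f ε μ ν * P.Gam α ε α
      - ∑ ε, P.M f α ε ν * P.Gam ε μ α - ∑ ε, P.M f α μ ε * P.Gam ε ν α)
      = P.T2 (fun i j => ∑ k, P.D k (f k i j)) μ ν := by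
  have h1 : ∑ α, ∑ ε, P.M f α ε ν * P.Gam ε μ α
      = P.T2 (fun i j => ∑ k, ∑ m, P.B m i k * f k m j) μ ν := by
    have : ∀ α ε, P.M f α ε ν * P.Gam ε μ α
        = P.V1 (fun k => P.T1 (fun j => P.T1 (fun i => P.B k i j) μ) α) ε
        * P.V1 (fun k => P.T1 (fun i => P.T1 (f k i) ν) ε) α := fun α ε => by
      rw [Gam_eq, M_eq, M_eq', mul_comm]
    simp only [this, trace_mul_mixed, T1_mul_T1, T2_sum]
    congr 1
    ext i j
    exact Finset.sum_comm
  have h2 : ∑ α, ∑ ε, P.M f α μ ε * P.Gam ε ν α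
      = P.T2 (fun i j => ∑ k, ∑ m, P.B m j k * f k i m) μ ν := by
    have : ∀ α ε, P.M f α μ ε * P.Gam ε ν α
        = P.V1 (fun k => P.T1 (fun j => P.T1 (fun i => P.B k i j) ν) α) ε
        * P.V1 (fun k => P.T1 (fun j => P.T1 (fun i => f k i j) μ) ε) α := fun α ε => by
      rw [Gam_eq, M_eq', M_eq', mul_comm]
    simp only [this, trace_mul_mixed, mul_comm (P.T1 _ ν), T1_mul_T1, T2_sum]
    congr 1
    ext i j
    rw [Finset.sum_comm]
    simp only [mul_comm (P.B _ _ _)]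
  rw [Finset.sum_sub_distrib, Finset.sum_sub_distrib, h1, h2]
  simp only [M]
  rw [P.div_V1 (fun k => P.T2 (f k) μ ν)]
  simp only [D_T2]
  rw [T2_sum, T2_sub, T2_sub]
  refine P.T2_congr (fun i j => ?_) _ _
  simp only [Finset.sum_add_distrib]
  ring

end ParallelFrame
end EAP
end

/-! ### The algebra of smooth functions on an open set, and openness of chart domains -/

noncomputable section
namespace EAP

section Smooth

variable {E : Type*} [NormedAddCommGroup E] [NormedSpace ℝ E]

/-- The algebra of smooth real functions on a set. -/
def smoothFn (D : Set E) : Subalgebra ℝ (D → ℝ) where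
  carrier := {f | ∃ F : E → ℝ, ContDiffOn ℝ ∞ F D ∧ ∀ u : D, F u = f u}
  mul_mem' := by
    rintro f g ⟨F, hF, hF'⟩ ⟨G, hG, hG'⟩
    exact ⟨fun u => F u * G u, hF.mul hG, fun u => by simp [hF', hG']⟩
  add_mem' := by
    rintro f g ⟨F, hF, hF'⟩ ⟨G, hG, hG'⟩
    exact ⟨fun u => F u + G u, hF.add hG, fun u => by simp [hF', hG']⟩
  algebraMap_mem' r := ⟨fun _ => r, contDiffOn_const, fun _ => rfl⟩

open Classical in
/-- Extension by zero. -/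
def extendZero {E : Type*} {D : Set E} (f : D → ℝ) (u : E) : ℝ := if h : u ∈ D then f ⟨u, h⟩ else 0

lemma extendZero_of_mem {E : Type*} {D : Set E} (f : D → ℝ) {u : E} (h : u ∈ D) :
    extendZero f u = f ⟨u, h⟩ := dif_pos h

variable {D : Set E}

lemma contDiffOn_extendZero (f : smoothFn D) : ContDiffOn ℝ ∞ (extendZero f.1) D := by
  obtain ⟨F, hF, hF'⟩ := f.2
  exact hF.congr fun u hu => by rw [extendZero_of_mem _ hu, ← hF']

lemma differentiableAt_extendZero (hD : IsOpen D) (f : smoothFn D) {u : E} (hu : u ∈ D) :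
    DifferentiableAt ℝ (extendZero f.1) u :=
  ((contDiffOn_extendZero f).contDiffAt (hD.mem_nhds hu)).differentiableAt (by simp)

/-- Elements of `smoothFn D` are functions on `D` only; openness makes the derivative independent of
how they are extended. -/
lemma fderiv_congr_extendZero (hD : IsOpen D) {F : E → ℝ} {f : D → ℝ}
    (h : ∀ v (hv : v ∈ D), F v = f ⟨v, hv⟩) {u : E} (hu : u ∈ D) :
    fderiv ℝ F u = fderiv ℝ (extendZero f) u := by
  refine Filter.EventuallyEq.fderiv_eq ?_
  filter_upwards [hD.mem_nhds hu] with v hv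
  rw [h v hv, extendZero_of_mem _ hv]

/-- The derivation of the algebra of smooth functions given by a constant vector. -/
def pd (hD : IsOpen D) (v : E) : Derivation ℝ (smoothFn D) (smoothFn D) :=
  Derivation.mk'
    { toFun := fun f => ⟨fun u => fderiv ℝ (extendZero f.1) u v,
        ⟨fun u => fderiv ℝ (extendZero f.1) u v,
          ((contDiffOn_extendZero f).fderiv_of_isOpen hD (m := ∞) (by simp)).clm_apply
            contDiffOn_const, fun _ => rfl⟩⟩
      map_add' := fun f g => by
        ext u
        have h : fderiv ℝ (extendZero (f + g : smoothFn D).1) u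
            = fderiv ℝ (fun w => extendZero f.1 w + extendZero g.1 w) u :=
          (fderiv_congr_extendZero hD (fun w hw => by simp [extendZero_of_mem _ hw]) u.2).symm
        simp only [h, fderiv_fun_add (differentiableAt_extendZero hD f u.2)
          (differentiableAt_extendZero hD g u.2)]
        simp
      map_smul' := fun r f => by
        ext u
        have h : fderiv ℝ (extendZero (r • f : smoothFn D).1) u
            = fderiv ℝ (fun w => r * extendZero f.1 w) u :=
          (fderiv_congr_extendZero hD (fun w hw => by simp [extendZero_of_mem _ hw]) u.2).symm
        simp only [h, fderiv_const_mul (differentiableAt_extendZero hD f u.2)]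
        simp }
    (fun f g => by
      ext u
      have h : fderiv ℝ (extendZero (f * g : smoothFn D).1) u
          = fderiv ℝ (fun w => extendZero f.1 w * extendZero g.1 w) u :=
        (fderiv_congr_extendZero hD (fun w hw => by simp [extendZero_of_mem _ hw]) u.2).symm
      simp only [LinearMap.coe_mk, AddHom.coe_mk, h]
      rw [fderiv_fun_mul (differentiableAt_extendZero hD f u.2)
        (differentiableAt_extendZero hD g u.2)]
      simp [extendZero_of_mem _ u.2])

lemma fderiv_eq_pd (hD : IsOpen D) {F : E → ℝ} {f : smoothFn D}
    (h : ∀ v (hv : v ∈ D), F v = f.1 ⟨v, hv⟩) {u : E} (hu : u ∈ D) (v : E) :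
    fderiv ℝ F u v = (pd hD v f).1 ⟨u, hu⟩ := by
  rw [fderiv_congr_extendZero hD h hu]
  rfl

lemma pd_comm (hD : IsOpen D) (v w : E) (f : smoothFn D) :
    pd hD v (pd hD w f) = pd hD w (pd hD v f) := by
  ext ⟨u, hu⟩
  have hc := (contDiffOn_extendZero f).contDiffAt (hD.mem_nhds hu)
  have hd : DifferentiableAt ℝ (fderiv ℝ (extendZero f.1)) u :=
    (hc.fderiv_right (m := 1) (by norm_cast)).differentiableAt (by simp)
  have h : ∀ v w, (pd hD v (pd hD w f)).1 ⟨u, hu⟩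
      = fderiv ℝ (fderiv ℝ (extendZero f.1)) u v w := fun v w => by
    rw [← fderiv_eq_pd hD (F := fun z => fderiv ℝ (extendZero f.1) z w) (fun z hz => rfl) hu]
    rw [fderiv_clm_apply hd (differentiableAt_const w)]
    simp
  rw [h, h]
  exact (hc.isSymmSndFDerivAt (by
    rw [minSmoothness_of_isRCLikeNormedField]; exact WithTop.coe_le_coe.2 le_top)) v w

end Smooth

/-- The chart domain is the preimage of `W` under the tangent map of the inverse chart. Continuity
is available for the tangent map within the open target, where it agrees with the unrestricted one.
-/
lemma isOpen_chartDom {n : ℕ} {M : Type*} [TopologicalSpace M]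
    [ChartedSpace (EuclideanSpace ℝ (Fin n)) M] [IsManifold (𝓡 n) ∞ M]
    {W : Set (TangentBundle (𝓡 n) M)} (hW : IsOpen W)
    {e : OpenPartialHomeomorph M (EuclideanSpace ℝ (Fin n))}
    (he : e ∈ IsManifold.maximalAtlas (𝓡 n) ∞ M) : IsOpen (chartDom W e) := by
  have h1 : ContMDiffOn (𝓡 n) (𝓡 n) ∞ e.symm e.target :=
    contMDiffOn_symm_of_mem_maximalAtlas he
  have h2 := h1.continuousOn_tangentMapWithin (by simp) e.open_target.uniqueMDiffOn
  have h3 : ContinuousOn (fun u : Coord n =>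
      tangentMapWithin (𝓡 n) (𝓡 n) e.symm e.target ⟨u.1, u.2⟩) {u | u.1 ∈ e.target} := by
    refine h2.comp (f := (tangentBundleModelSpaceHomeomorph (𝓡 n)).symm)
      (tangentBundleModelSpaceHomeomorph (𝓡 n)).symm.continuous.continuousOn ?_
    intro u hu
    exact hu
  have h4 : IsOpen {u : Coord n | u.1 ∈ e.target} := e.open_target.preimage continuous_fst
  have h5 := h3.isOpen_inter_preimage h4 hW
  convert h5 using 1
  ext u
  simp only [chartDom, Set.mem_ofPred_eq, Set.mem_inter_iff, Set.mem_preimage]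
  refine and_congr_right fun hu => ?_
  rw [tangentMapWithin_eq_tangentMap (e.open_target.uniqueMDiffOn _ hu)
    ((h1.contMDiffAt (e.open_target.mem_nhds hu)).mdifferentiableAt (by simp))]

end EAP
end

/-! ### Partial derivatives of the Lagrangian with respect to the jet -/

noncomputable section
namespace EAP

section Det

variable {ι A : Type*} [Fintype ι] [DecidableEq ι] [CommRing A] [Algebra ℝ A]

lemma derivation_prod {ι A : Type*} [DecidableEq ι] [CommRing A] [Algebra ℝ A]
    (d : Derivation ℝ A A) (s : Finset ι) (f : ι → A) :
    d (∏ i ∈ s, f i) = ∑ i ∈ s, d (f i) * ∏ j ∈ s.erase i, f j := by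
  induction s using Finset.induction_on with
  | empty => simp
  | insert a s ha ih =>
    rw [Finset.prod_insert ha, Derivation.leibniz, ih, Finset.sum_insert ha,
      Finset.erase_insert ha, smul_eq_mul, smul_eq_mul, add_comm, mul_comm (∏ i ∈ s, f i),
      Finset.mul_sum]
    congr 1
    refine Finset.sum_congr rfl fun i hi => ?_
    have hia : i ≠ a := fun h => ha (h ▸ hi)
    rw [Finset.erase_insert_of_ne hia.symm, Finset.prod_insert
      (fun h => ha (Finset.mem_of_mem_erase h))]
    ring

/-- Jacobi's formula for the derivative of a determinant. -/
lemma derivation_det (d : Derivation ℝ A A) (X Y : Matrix ι ι A) (h : X * Y = 1) :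
    d X.det = X.det * ∑ i, ∑ j, Y i j * d (X j i) := by
  have hadj : X.adjugate = X.det • Y := by
    rw [← mul_one X.adjugate, ← h, ← mul_assoc, Matrix.adjugate_mul, smul_mul_assoc, one_mul]
  -- By Cramer's rule each summand is the determinant with its i-th column differentiated, so the
  -- claim reduces to Leibniz's rule in the permutation expansion.
  have h1 : ∀ i, X.det * ∑ j, Y i j * d (X j i)
      = (X.updateCol i (fun j => d (X j i))).det := fun i => by
    rw [← Matrix.cramer_apply, Matrix.cramer_eq_adjugate_mulVec, hadj, Finset.mul_sum]
    simp only [Matrix.mulVec, dotProduct, Matrix.smul_apply, smul_eq_mul, mul_assoc]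
  rw [Finset.mul_sum]
  simp only [h1]
  rw [Matrix.det_apply, map_sum]
  simp only [Matrix.det_apply]
  rw [Finset.sum_comm]
  refine Finset.sum_congr rfl fun σ _ => ?_
  have h2 : ∀ x : A, d (Equiv.Perm.sign σ • x) = Equiv.Perm.sign σ • d x := fun x => by
    rcases Int.units_eq_one_or (Equiv.Perm.sign σ) with h | h <;> simp [h]
  rw [h2, derivation_prod, Finset.smul_sum]
  refine Finset.sum_congr rfl fun i _ => ?_
  rw [← Finset.mul_prod_erase _ _ (Finset.mem_univ i)]
  congr 2
  · simp
  · refine Finset.prod_congr rfl fun j hj => ?_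
    rw [Matrix.updateCol_ne (Finset.ne_of_mem_erase hj)]

end Det

section Torsion

variable {ι A : Type*} [Fintype ι] [DecidableEq ι] [CommRing A]

/-- The trace of a torsion array. -/
def torC (L : ι → ι → ι → A) (i : ι) : A := ∑ k, L k i k

/-- The quadratic tensor of a torsion array. -/
def torQ (L : ι → ι → ι → A) (i j : ι) : A := ∑ k, ∑ l, L k l i * L l k j - torC L i * torC L j

/-- The momentum array of a torsion array. -/
def torS (L : ι → ι → ι → A) (j b c : ι) : A :=
  2 * (L b j c - L c j b) - 2 * ((if j = c then 1 else 0) * torC L b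
    - (if j = b then 1 else 0) * torC L c)

/-- The force array of a torsion array. -/
def torH (L : ι → ι → ι → A) (j b : ι) : A :=
  (if b = j then 1 else 0) * (∑ k, torQ L k k) - 2 * (∑ i, ∑ k, L k j i * L b k i)
    - 2 * torQ L b j + 2 * ∑ i, L b i j * torC L i

lemma hasDerivAt_trace_torQ {ι : Type*} [Fintype ι] {X : ℝ → ι → ι → ι → ℝ} {X' : ι → ι → ι → ℝ} {t : ℝ}
    (h : ∀ k p q, HasDerivAt (fun t => X t k p q) (X' k p q) t) :
    HasDerivAt (fun t => ∑ i, torQ (X t) i i)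
      (∑ i, (2 * (∑ k, ∑ l, X' k l i * X t l k i) - 2 * (∑ k, X' k i k) * torC (X t) i)) t := by
  refine HasDerivAt.fun_sum fun i _ => ?_
  have hC : HasDerivAt (fun t => torC (X t) i) (∑ k, X' k i k) t :=
    HasDerivAt.fun_sum fun k _ => h k i k
  have hQ : HasDerivAt (fun t => ∑ k, ∑ l, X t k l i * X t l k i)
      (∑ k, ∑ l, (X' k l i * X t l k i + X t k l i * X' l k i)) t :=
    HasDerivAt.fun_sum fun k _ => HasDerivAt.fun_sum fun l _ => (h k l i).mul (h l k i)
  refine (hQ.fun_sub (hC.fun_mul hC)).congr_deriv ?_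
  have h2 : ∑ k, ∑ l, X t k l i * X' l k i = ∑ k, ∑ l, X' k l i * X t l k i := by
    rw [Finset.sum_comm]
    exact Finset.sum_congr rfl fun _ _ => Finset.sum_congr rfl fun _ _ => mul_comm _ _
  simp only [Finset.sum_add_distrib, h2]
  ring

end Torsion

section Jet

variable {n : ℕ}

/-- The pointwise frame given by an invertible matrix. -/
def jetFrame (l : Fin n → Fin n → ℝ) (h : IsUnit (Matrix.of l).det) : ParallelFrame (Fin n) ℝ where
  -- Only the pointwise algebra of a frame is used here, so trivial derivations suffice.
  d := 0
  a i μ := (Matrix.of l)⁻¹ μ i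
  b := l
  comm _ _ _ := rfl
  ab i j := by
    have := congrFun (congrFun (Matrix.mul_nonsing_inv _ h) j) i
    rw [Matrix.mul_apply, Matrix.one_apply] at this
    simpa [mul_comm, eq_comm] using this
  ba μ ν := by
    have := congrFun (congrFun (Matrix.nonsing_inv_mul _ h) μ) ν
    rw [Matrix.mul_apply, Matrix.one_apply] at this
    simpa using this

/-- Frame components of the torsion as a function of the jet. -/
def jetL (l : Fin n → Fin n → ℝ) (w : Fin n → Fin n → Fin n → ℝ) (k p q : Fin n) : ℝ :=
  ∑ μ, ∑ ν, (Matrix.of l)⁻¹ μ p * (Matrix.of l)⁻¹ ν q * (w k μ ν - w k ν μ)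

/-- Adapted derivatives as a function of the jet. -/
def jetW (N : Fin n → Fin n → ℝ) (lx ly : Fin n → Fin n → Fin n → ℝ) (i μ ν : Fin n) : ℝ :=
  lx i μ ν - ∑ a, N a ν * ly i μ a

/-- In frame components the inverse metric is the identity, and the Lagrangian is a plain trace
depending on derivatives through the torsion only. -/
lemma lagrangian_eq (N : Fin n → Fin n → ℝ) (l : Fin n → Fin n → ℝ)
    (lx ly : Fin n → Fin n → Fin n → ℝ) (h : IsUnit (Matrix.of l).det) :
    lagrangian N l lx ly = (Matrix.of l).det * ∑ i, torQ (jetL l (jetW N lx ly)) i i := by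
  let P := jetFrame l h
  set L := jetL l (jetW N lx ly) with hL
  have hT : ∀ k μ ν, jetW N lx ly k μ ν - jetW N lx ly k ν μ = P.T2 (L k) μ ν := fun k μ ν => by
    rw [ParallelFrame.T2_eq]
    have : ∀ i, P.T1 (L k i) ν = ∑ μ, P.a i μ * (jetW N lx ly k μ ν - jetW N lx ly k ν μ) :=
      fun i => by
      have h2 : L k i = fun j => ∑ σ, P.a j σ * ∑ μ, P.a i μ
          * (jetW N lx ly k μ σ - jetW N lx ly k σ μ) := by
        ext j
        simp only [hL, jetL, Finset.mul_sum]
        rw [Finset.sum_comm]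
        refine Finset.sum_congr rfl fun _ _ => Finset.sum_congr rfl fun _ _ => ?_
        simp only [P, jetFrame]
        ring
      rw [h2, P.T1_sum_a]
    simp only [this, P.T1_sum_a]
  have hLam : ∀ α μ ν, jetLam N l lx ly α μ ν = P.M L α μ ν := fun α μ ν => by
    simp only [jetLam, jetGamma, ← Finset.sum_sub_distrib, ← mul_sub, ParallelFrame.M,
      ParallelFrame.V1, ← hT]
    rfl
  have hC : ∀ μ, jetC N l lx ly μ = P.T1 (torC L) μ := fun μ => by
    simp only [jetC, hLam, ParallelFrame.M_eq', ParallelFrame.trace_mixed, ParallelFrame.T1_sum]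
    rfl
  have hQ : ∀ μ ν, (∑ α, ∑ ε, jetLam N l lx ly α ε μ * jetLam N l lx ly ε α ν)
      - jetC N l lx ly μ * jetC N l lx ly ν = P.T2 (torQ L) μ ν := fun μ ν => by
    rw [Finset.sum_comm]
    simp only [hLam, hC, ParallelFrame.M_eq, ParallelFrame.trace_mul_mixed,
      ParallelFrame.T1_mul_T1, ParallelFrame.T2_sum, ParallelFrame.T2_sub]
    rfl
  rw [lagrangian]
  simp only [hQ]
  rw [← P.trace_T2 (torQ L)]
  rfl

lemma of_add_smul_unit2 (l : Fin n → Fin n → ℝ) (j β : Fin n) (t : ℝ) :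
    Matrix.of (l + t • unit2 j β) = Matrix.of l
      + Matrix.replicateCol Unit (Pi.single j t) * Matrix.replicateRow Unit (Pi.single β (1 : ℝ)) := by
  ext i μ
  simp only [unit2, Matrix.of_apply, Pi.add_apply, Pi.smul_apply, Matrix.add_apply,
    Matrix.mul_apply, Matrix.replicateCol_apply, Matrix.replicateRow_apply, smul_eq_mul]
  by_cases hi : i = j
  · subst hi; simp
  · simp [hi]

lemma det_add_smul_unit2 (l : Fin n → Fin n → ℝ) (h : IsUnit (Matrix.of l).det) (j β : Fin n)
    (t : ℝ) : (Matrix.of (l + t • unit2 j β)).det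
      = (Matrix.of l).det * (1 + t * (Matrix.of l)⁻¹ β j) := by
  rw [of_add_smul_unit2, Matrix.det_add_replicateCol_mul_replicateRow h]
  congr 1
  rw [Matrix.det_unique]
  simp only [Matrix.add_apply, Matrix.mul_apply, Matrix.replicateCol_apply,
    Matrix.replicateRow_apply, Matrix.one_apply_eq]
  simp [Pi.single_apply, mul_comm]

/-- Varying one entry of the coframe is a rank-one update, so the inverse is given by the
Sherman–Morrison formula. -/
lemma inv_add_smul_unit2 (l : Fin n → Fin n → ℝ) (h : IsUnit (Matrix.of l).det) (j β : Fin n)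
    {t : ℝ} (ht : 1 + t * (Matrix.of l)⁻¹ β j ≠ 0) (α i : Fin n) :
    (Matrix.of (l + t • unit2 j β))⁻¹ α i = (Matrix.of l)⁻¹ α i
      - t / (1 + t * (Matrix.of l)⁻¹ β j) * ((Matrix.of l)⁻¹ α j * (Matrix.of l)⁻¹ β i) := by
  set m := (Matrix.of l)⁻¹ with hm
  set s := t / (1 + t * m β j) with hs
  have hs' : s * (1 + t * m β j) = t := div_mul_cancel₀ _ ht
  have hlm : ∀ i k, ∑ μ, l i μ * m μ k = if i = k then 1 else 0 := fun i k => by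
    have := congrFun (congrFun (Matrix.mul_nonsing_inv _ h) i) k
    rw [Matrix.mul_apply, Matrix.one_apply] at this
    exact this
  have hX : Matrix.of (l + t • unit2 j β)
      * Matrix.of (fun α i => m α i - s * (m α j * m β i)) = 1 := by
    ext i k
    have h1 : ∀ μ, (l + t • unit2 j β) i μ = l i μ + if μ = β then (if i = j then t else 0) else 0 :=
      fun μ => by
      simp only [unit2, Pi.add_apply, Pi.smul_apply, smul_eq_mul, Pi.single_apply]
      by_cases hi : i = j
      · subst hi; simp [Pi.single_apply]
      · simp [hi]
    have h2 : ∑ μ, l i μ * (m μ k - s * (m μ j * m β k))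
        = (if i = k then 1 else 0) - s * ((if i = j then 1 else 0) * m β k) := by
      rw [← hlm, ← hlm, Finset.sum_mul, Finset.mul_sum, ← Finset.sum_sub_distrib]
      exact Finset.sum_congr rfl fun _ _ => by ring
    simp only [Matrix.mul_apply, Matrix.of_apply, h1, add_mul, Finset.sum_add_distrib, h2,
      ite_mul, zero_mul, Finset.sum_ite_eq', Finset.mem_univ, if_true, Matrix.one_apply]
    by_cases hi : i = j
    · simp only [hi, if_true]
      linear_combination -m β k * hs'
    · simp [hi]
  rw [Matrix.inv_eq_right_inv hX]
  rfl

lemma hasDerivAt_inv_add_smul_unit2 (l : Fin n → Fin n → ℝ) (h : IsUnit (Matrix.of l).det)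
    (j β α i : Fin n) :
    HasDerivAt (fun t : ℝ => (Matrix.of (l + t • unit2 j β))⁻¹ α i)
      (-((Matrix.of l)⁻¹ α j * (Matrix.of l)⁻¹ β i)) 0 := by
  set m := (Matrix.of l)⁻¹ with hm
  have h1 : HasDerivAt (fun t : ℝ => 1 + t * m β j) (m β j) 0 := by
    simpa using ((hasDerivAt_id (0 : ℝ)).mul_const (m β j)).const_add 1
  have h2 : HasDerivAt (fun t : ℝ => t / (1 + t * m β j)) 1 0 := by
    simpa using (hasDerivAt_id (0 : ℝ)).fun_div h1 (by simp)
  have h3 : HasDerivAt (fun t : ℝ => m α i - t / (1 + t * m β j) * (m α j * m β i))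
      (-(m α j * m β i)) 0 := by
    simpa using (h2.mul_const (m α j * m β i)).const_sub (m α i)
  refine h3.congr_of_eventuallyEq ?_
  have h4 : ∀ᶠ t : ℝ in nhds 0, 1 + t * m β j ≠ 0 :=
    h1.continuousAt.eventually_ne (by simp)
  filter_upwards [h4] with t ht
  exact inv_add_smul_unit2 l h j β ht α i

lemma isUnit_det_add_smul_unit2 (l : Fin n → Fin n → ℝ) (h : IsUnit (Matrix.of l).det)
    (j β : Fin n) : ∀ᶠ t : ℝ in nhds 0, IsUnit (Matrix.of (l + t • unit2 j β)).det := by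
  have h1 : ContinuousAt (fun t : ℝ => 1 + t * (Matrix.of l)⁻¹ β j) 0 := by fun_prop
  filter_upwards [h1.eventually_ne (y := 0) (by simp)] with t ht
  rw [det_add_smul_unit2 l h]
  exact (h.mul (isUnit_iff_ne_zero.mpr ht))

lemma dLag_eq (N : Fin n → Fin n → ℝ) (l : Fin n → Fin n → ℝ)
    (lx ly : Fin n → Fin n → Fin n → ℝ) (h : IsUnit (Matrix.of l).det) (j β : Fin n) :
    dLag N l lx ly j β = (Matrix.of l).det
      * ∑ b, (Matrix.of l)⁻¹ β b * torH (jetL l (jetW N lx ly)) j b := by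
  set m := (Matrix.of l)⁻¹ with hm
  set w := jetW N lx ly with hw
  set L := jetL l w with hL
  have hl0 : l + (0 : ℝ) • unit2 j β = l := by simp
  -- With the derivatives of the coframe held fixed, the torsion components vary only through the
  -- two inverse matrices in them.
  have h1 : ∀ k p q, HasDerivAt (fun t : ℝ => jetL (l + t • unit2 j β) w k p q)
      (-(m β p * L k j q) - m β q * L k p j) 0 := fun k p q => by
    have : HasDerivAt (fun t : ℝ => jetL (l + t • unit2 j β) w k p q)
        (∑ μ, ∑ ν, (-(m μ j * m β p) * m ν q + m μ p * -(m ν j * m β q)) * (w k μ ν - w k ν μ)) 0 := by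
      refine HasDerivAt.fun_sum fun μ _ => HasDerivAt.fun_sum fun ν _ => ?_
      have e1 := hasDerivAt_inv_add_smul_unit2 l h j β μ p
      have e2 := hasDerivAt_inv_add_smul_unit2 l h j β ν q
      have e3 := (e1.fun_mul e2).mul_const (w k μ ν - w k ν μ)
      rw [hl0] at e3
      exact e3
    convert this using 1
    simp only [hL, jetL, Finset.mul_sum, ← Finset.sum_neg_distrib, ← Finset.sum_sub_distrib]
    exact Finset.sum_congr rfl fun _ _ => Finset.sum_congr rfl fun _ _ => by ring
  have h2 := hasDerivAt_trace_torQ h1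
  have h3 : HasDerivAt (fun t : ℝ => (Matrix.of (l + t • unit2 j β)).det)
      ((Matrix.of l).det * m β j) 0 := by
    simp only [det_add_smul_unit2 l h]
    simpa using (((hasDerivAt_id (0 : ℝ)).mul_const (m β j)).const_add 1).const_mul
      (Matrix.of l).det
  have h4 := h3.mul h2
  rw [dLag]
  have h5 := h4.congr_of_eventuallyEq (f₁ := fun t : ℝ => lagrangian N (l + t • unit2 j β) lx ly) (by
    filter_upwards [isUnit_det_add_smul_unit2 l h j β] with t ht
    exact lagrangian_eq N _ lx ly ht)
  rw [h5.deriv]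
  simp only [hl0, ← hL]
  have e1 : ∑ i, ∑ k, ∑ p, m β p * L k j i * L p k i
      = ∑ b, m β b * ∑ i, ∑ k, L k j i * L b k i := by
    simp only [Finset.mul_sum]
    rw [Finset.sum_congr rfl fun i _ => Finset.sum_comm, Finset.sum_comm]
    exact Finset.sum_congr rfl fun _ _ => Finset.sum_congr rfl fun _ _ =>
      Finset.sum_congr rfl fun _ _ => by ring
  have e2 : ∑ i, ∑ k, ∑ p, m β i * L k p j * L p k i
      = ∑ b, m β b * ∑ k, ∑ p, L k p b * L p k j := by
    refine Finset.sum_congr rfl fun i _ => ?_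
    rw [Finset.sum_comm]
    simp only [Finset.mul_sum]
    exact Finset.sum_congr rfl fun _ _ => Finset.sum_congr rfl fun _ _ => by ring
  have e3 : ∑ i, (∑ k, m β k * L k i j) * torC L i = ∑ b, m β b * ∑ i, L b i j * torC L i := by
    simp only [Finset.sum_mul, Finset.mul_sum]
    rw [Finset.sum_comm]
    exact Finset.sum_congr rfl fun _ _ => Finset.sum_congr rfl fun _ _ => by ring
  have e4 : ∀ i, ∑ k, (-(m β i * L k j k) - m β k * L k i j)
      = -(m β i * torC L j) - ∑ k, m β k * L k i j := fun i => by
    rw [Finset.sum_sub_distrib, Finset.sum_neg_distrib, ← Finset.mul_sum]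
    rfl
  have e5 : ∑ b, m β b * torH L j b = m β j * (∑ k, torQ L k k)
      - 2 * (∑ b, m β b * ∑ i, ∑ k, L k j i * L b k i)
      - 2 * ((∑ b, m β b * ∑ k, ∑ p, L k p b * L p k j) - ∑ b, m β b * (torC L b * torC L j))
      + 2 * ∑ b, m β b * ∑ i, L b i j * torC L i := by
    have : ∀ b, m β b * torH L j b = m β b * (if b = j then 1 else 0) * (∑ k, torQ L k k)
        - 2 * (m β b * ∑ i, ∑ k, L k j i * L b k i)
        - 2 * ((m β b * ∑ k, ∑ p, L k p b * L p k j) - m β b * (torC L b * torC L j))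
        + 2 * (m β b * ∑ i, L b i j * torC L i) := fun b => by rw [torH, torQ]; ring
    simp only [this, Finset.sum_add_distrib, Finset.sum_sub_distrib, ← Finset.mul_sum,
      ← Finset.sum_mul]
    simp
  have e6 : ∑ i, (2 * (∑ k, ∑ p, (-(m β p * L k j i) - m β i * L k p j) * L p k i)
      - 2 * (∑ k, (-(m β i * L k j k) - m β k * L k i j)) * torC L i)
      = -2 * (∑ i, ∑ k, ∑ p, m β p * L k j i * L p k i)
        - 2 * (∑ i, ∑ k, ∑ p, m β i * L k p j * L p k i)
        + 2 * (∑ b, m β b * (torC L b * torC L j))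
        + 2 * ∑ i, (∑ k, m β k * L k i j) * torC L i := by
    have : ∀ i, 2 * (∑ k, ∑ p, (-(m β p * L k j i) - m β i * L k p j) * L p k i)
        - 2 * (∑ k, (-(m β i * L k j k) - m β k * L k i j)) * torC L i
        = -2 * (∑ k, ∑ p, m β p * L k j i * L p k i) - 2 * (∑ k, ∑ p, m β i * L k p j * L p k i)
          + 2 * (m β i * (torC L i * torC L j)) + 2 * ((∑ k, m β k * L k i j) * torC L i) :=
      fun i => by
      simp only [e4, sub_mul, neg_mul, Finset.sum_sub_distrib, Finset.sum_neg_distrib]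
      ring
    rw [Finset.sum_congr rfl fun i _ => this i]
    simp only [Finset.sum_add_distrib, Finset.sum_sub_distrib, ← Finset.mul_sum]
  rw [e6, e5, e1, e2, e3]
  ring

lemma jetW_add_x (N : Fin n → Fin n → ℝ) (lx ly : Fin n → Fin n → Fin n → ℝ) (j β γ : Fin n)
    (t : ℝ) : jetW N (lx + t • unit3 j β γ) ly = jetW N lx ly + t • unit3 j β γ := by
  ext i μ ν
  simp only [jetW, Pi.add_apply]
  ring

lemma jetL_unit3 (l : Fin n → Fin n → ℝ) (j β γ k p q : Fin n) :
    jetL l (unit3 j β γ) k p q = if k = j then (Matrix.of l)⁻¹ β p * (Matrix.of l)⁻¹ γ q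
      - (Matrix.of l)⁻¹ γ p * (Matrix.of l)⁻¹ β q else 0 := by
  by_cases hk : k = j
  · subst hk
    have h : ∀ μ ν, unit3 k β γ k μ ν = (if μ = β then 1 else 0) * (if ν = γ then 1 else 0) :=
      fun μ ν => by
      by_cases hμ : μ = β
      · subst hμ; simp [unit3, Pi.single_apply]
      · simp [unit3, hμ]
    simp only [jetL, h, mul_sub, Finset.sum_sub_distrib]
    simp
  · have h : ∀ μ ν, unit3 j β γ k μ ν = 0 := fun μ ν => by simp [unit3, hk]
    simp [jetL, h, hk]

lemma jetL_add (l : Fin n → Fin n → ℝ) (v w : Fin n → Fin n → Fin n → ℝ) (k p q : Fin n) :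
    jetL l (v + w) k p q = jetL l v k p q + jetL l w k p q := by
  simp only [jetL, Pi.add_apply, ← Finset.sum_add_distrib]
  exact Finset.sum_congr rfl fun _ _ => Finset.sum_congr rfl fun _ _ => by ring

lemma jetL_smul (l : Fin n → Fin n → ℝ) (t : ℝ) (v : Fin n → Fin n → Fin n → ℝ) (k p q : Fin n) :
    jetL l (t • v) k p q = t * jetL l v k p q := by
  simp only [jetL, Pi.smul_apply, smul_eq_mul, Finset.mul_sum]
  exact Finset.sum_congr rfl fun _ _ => Finset.sum_congr rfl fun _ _ => by ring

/-- The derivative of the Lagrangian in the direction of the adapted derivatives. -/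
def jetMomentum (l : Fin n → Fin n → ℝ) (w : Fin n → Fin n → Fin n → ℝ) :
    (Fin n → Fin n → Fin n → ℝ) →ₗ[ℝ] ℝ where
  toFun v := (Matrix.of l).det * ∑ i, (2 * (∑ k, ∑ p, jetL l v k p i * jetL l w p k i)
        - 2 * (∑ k, jetL l v k i k) * torC (jetL l w) i)
  map_add' v v' := by
    simp only [jetL_add, add_mul, mul_add, Finset.sum_add_distrib, Finset.sum_sub_distrib]
    ring
  map_smul' t v := by
    simp only [jetL_smul, mul_assoc, ← Finset.mul_sum, RingHom.id_apply, smul_eq_mul,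
      Finset.sum_sub_distrib]
    ring

lemma hasDerivAt_lagrangian_w (l : Fin n → Fin n → ℝ) (w v : Fin n → Fin n → Fin n → ℝ) :
    HasDerivAt (fun t : ℝ => (Matrix.of l).det * ∑ i, torQ (jetL l (w + t • v)) i i)
      (jetMomentum l w v) 0 := by
  have h1 : ∀ k p q, HasDerivAt (fun t : ℝ => jetL l (w + t • v) k p q) (jetL l v k p q) 0 :=
    fun k p q => by
    simp only [jetL_add, jetL_smul]
    simpa using ((hasDerivAt_id (0 : ℝ)).mul_const (jetL l v k p q)).const_add (jetL l w k p q)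
  have h2 := (hasDerivAt_trace_torQ h1).const_mul (Matrix.of l).det
  simpa [jetMomentum] using h2

lemma dLagX_eq_jetMomentum (N : Fin n → Fin n → ℝ) (l : Fin n → Fin n → ℝ)
    (lx ly : Fin n → Fin n → Fin n → ℝ) (h : IsUnit (Matrix.of l).det) (j β γ : Fin n) :
    dLagX N l lx ly j β γ = jetMomentum l (jetW N lx ly) (unit3 j β γ) := by
  rw [dLagX]
  simp only [lagrangian_eq N l _ ly h, jetW_add_x]
  exact (hasDerivAt_lagrangian_w l _ _).deriv

lemma dLagX_eq (N : Fin n → Fin n → ℝ) (l : Fin n → Fin n → ℝ)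
    (lx ly : Fin n → Fin n → Fin n → ℝ) (h : IsUnit (Matrix.of l).det) (j β γ : Fin n) :
    dLagX N l lx ly j β γ = (Matrix.of l).det
      * ∑ c, (Matrix.of l)⁻¹ γ c * ∑ b, (Matrix.of l)⁻¹ β b
        * torS (jetL l (jetW N lx ly)) j b c := by
  rw [dLagX_eq_jetMomentum N l lx ly h, jetMomentum, LinearMap.coe_mk, AddHom.coe_mk]
  set L := jetL l (jetW N lx ly)
  set m := (Matrix.of l)⁻¹
  congr 1
  have h1 : ∀ i, 2 * (∑ k, ∑ p, jetL l (unit3 j β γ) k p i * L p k i)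
      - 2 * (∑ k, jetL l (unit3 j β γ) k i k) * torC L i
      = 2 * (∑ p, m β p * m γ i * L p j i) - 2 * (∑ p, m γ p * m β i * L p j i)
        - 2 * (m γ j * (m β i * torC L i)) + 2 * (m β j * (m γ i * torC L i)) := fun i => by
    have e1 : ∑ k, ∑ p, jetL l (unit3 j β γ) k p i * L p k i
        = (∑ p, m β p * m γ i * L p j i) - ∑ p, m γ p * m β i * L p j i := by
      rw [Finset.sum_comm, ← Finset.sum_sub_distrib]
      refine Finset.sum_congr rfl fun p _ => ?_
      simp only [jetL_unit3, ite_mul, zero_mul, Finset.sum_ite_eq', Finset.mem_univ, if_true]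
      ring
    have e2 : ∑ k, jetL l (unit3 j β γ) k i k = m β i * m γ j - m γ i * m β j := by
      simp only [jetL_unit3, Finset.sum_ite_eq', Finset.mem_univ, if_true]
      rfl
    rw [e1, e2]
    ring
  have h2 : ∀ c, m γ c * ∑ b, m β b * torS L j b c
      = 2 * (∑ b, m β b * m γ c * L b j c) - 2 * (∑ b, m γ c * m β b * L c j b)
        - 2 * ((m γ c * if j = c then 1 else 0) * ∑ b, m β b * torC L b)
        + 2 * (m β j * (m γ c * torC L c)) := fun c => by
    have : ∀ b, m γ c * (m β b * torS L j b c) = 2 * (m β b * m γ c * L b j c)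
        - 2 * (m γ c * m β b * L c j b)
        - 2 * ((m γ c * if j = c then 1 else 0) * (m β b * torC L b))
        + 2 * (m β b * (if j = b then 1 else 0) * (m γ c * torC L c)) := fun b => by
      rw [torS]; ring
    rw [Finset.mul_sum, Finset.sum_congr rfl fun b _ => this b]
    simp only [Finset.sum_add_distrib, Finset.sum_sub_distrib, ← Finset.mul_sum, ← Finset.sum_mul]
    simp
  rw [Finset.sum_congr rfl fun i _ => h1 i, Finset.sum_congr rfl fun c _ => h2 c]
  simp only [Finset.sum_add_distrib, Finset.sum_sub_distrib, ← Finset.mul_sum, ← Finset.sum_mul]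
  rw [Finset.sum_comm (f := fun i p => m γ p * m β i * L p j i)]
  simp

/-- Both kinds of derivatives enter through the adapted derivative λ_{iμ,ν} - N^a_ν λ_{iμ;a}, so
this is the chain rule. -/
lemma dLagY_eq (N : Fin n → Fin n → ℝ) (l : Fin n → Fin n → ℝ)
    (lx ly : Fin n → Fin n → Fin n → ℝ) (h : IsUnit (Matrix.of l).det) (j β a : Fin n) :
    dLagY N l lx ly j β a = -∑ γ, N a γ * dLagX N l lx ly j β γ := by
  have hw : ∀ t : ℝ, jetW N lx (ly + t • unit3 j β a)
      = jetW N lx ly + t • (-∑ γ, N a γ • unit3 j β γ) := fun t => by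
    ext i μ ν
    simp only [jetW, Pi.add_apply, Pi.smul_apply, Pi.neg_apply, Finset.sum_apply, smul_eq_mul,
      mul_add, Finset.sum_add_distrib]
    have : ∑ x, N x ν * (t * unit3 j β a i μ x) = t * ∑ x, N a x * unit3 j β x i μ ν := by
      by_cases hi : i = j
      · subst hi
        by_cases hμ : μ = β
        · subst hμ; simp [unit3, Pi.single_apply, mul_comm]
        · simp [unit3, hμ]
      · simp [unit3, hi]
    rw [this]
    ring
  rw [dLagY]
  simp only [lagrangian_eq N l lx _ h, hw, dLagX_eq_jetMomentum N l lx ly h]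
  rw [(hasDerivAt_lagrangian_w l _ _).deriv, map_neg, map_sum]
  simp only [map_smul, smul_eq_mul]

end Jet

end EAP
end

/-! ### Chart data as a parallel frame over smooth functions -/

noncomputable section
namespace EAP

section Smooth

variable {E : Type*} [NormedAddCommGroup E] [NormedSpace ℝ E] {D : Set E}

/-- A smooth function as an element of the algebra of smooth functions. -/
def toSmooth (F : E → ℝ) (hF : ContDiffOn ℝ ∞ F D) : smoothFn D :=
  ⟨fun u => F u, F, hF, fun _ => rfl⟩

/-- Evaluation at a point. -/
def ev (u : D) : smoothFn D →ₐ[ℝ] ℝ := (Pi.evalAlgHom ℝ (fun _ : D => ℝ) u).comp (smoothFn D).val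

lemma smoothFn_ext {f g : smoothFn D} (h : ∀ u, ev u f = ev u g) : f = g := by
  ext u
  exact h u

lemma ev_half (u : D) : ev u (ParallelFrame.half (smoothFn D)) = 1 / 2 :=
  (ev u).commutes _

lemma contDiffOn_det {ι : Type*} [Fintype ι] [DecidableEq ι] {X : E → Matrix ι ι ℝ}
    (h : ∀ i j, ContDiffOn ℝ ∞ (fun u => X u i j) D) :
    ContDiffOn ℝ ∞ (fun u => (X u).det) D := by
  simp only [Matrix.det_apply]
  refine ContDiffOn.sum fun σ _ => ?_
  refine ContDiffOn.const_smul _ ?_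
  exact contDiffOn_prod fun i _ => h _ _

lemma contDiffOn_inv {ι : Type*} [Fintype ι] [DecidableEq ι] {X : E → Matrix ι ι ℝ}
    (h : ∀ i j, ContDiffOn ℝ ∞ (fun u => X u i j) D) (h0 : ∀ u ∈ D, (X u).det ≠ 0) (i j : ι) :
    ContDiffOn ℝ ∞ (fun u => (X u)⁻¹ i j) D := by
  simp only [Matrix.inv_def, Ring.inverse_eq_inv', Matrix.smul_apply, smul_eq_mul,
    Matrix.adjugate_apply]
  refine ((contDiffOn_det h).inv h0).mul (contDiffOn_det fun k l => ?_)
  simp only [Matrix.updateRow_apply]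
  split_ifs
  · exact contDiffOn_const
  · exact h _ _

end Smooth

namespace LocalData

variable {n : ℕ}

/-- The components are smooth on an open set, with independent horizontal and vertical parts. -/
structure IsSmoothOn (S : LocalData n) (D : Set (Coord n)) : Prop where
  isOpen : IsOpen D
  N : ∀ a μ, ContDiffOn ℝ ∞ (fun u => S.N u a μ) D
  lamH : ∀ i α, ContDiffOn ℝ ∞ (fun u => S.lamH u i α) D
  lamV : ∀ i a, ContDiffOn ℝ ∞ (fun u => S.lamV u i a) D
  indepH : ∀ u ∈ D, LinearIndependent ℝ (S.lamH u)
  indepV : ∀ u ∈ D, LinearIndependent ℝ (S.lamV u)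

variable {S : LocalData n} {D : Set (Coord n)}

lemma isUnit_det_of_linearIndependent {l : Fin n → Fin n → ℝ} (h : LinearIndependent ℝ l) :
    IsUnit (Matrix.of l).det :=
  (Matrix.isUnit_iff_isUnit_det _).mp (Matrix.linearIndependent_rows_iff_isUnit.mp h)

lemma contDiffOn_coframe {lam : Coord n → Fin n → Fin n → ℝ}
    (h : ∀ i α, ContDiffOn ℝ ∞ (fun u => lam u i α) D)
    (hi : ∀ u ∈ D, LinearIndependent ℝ (lam u)) (i α : Fin n) :
    ContDiffOn ℝ ∞ (fun u => (Matrix.of (lam u))⁻¹ α i) D :=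
  contDiffOn_inv (X := fun u => Matrix.of (lam u)) h
    (fun u hu => (isUnit_det_of_linearIndependent (hi u hu)).ne_zero) α i

namespace IsSmoothOn

variable (h : S.IsSmoothOn D)
include h

/-- The nonlinear connection as smooth functions. -/
def NF (a μ : Fin n) : smoothFn D := toSmooth _ (h.N a μ)

/-- `∂/∂x^μ` on smooth functions. -/
def dx (μ : Fin n) : Derivation ℝ (smoothFn D) (smoothFn D) :=
  pd h.isOpen (EuclideanSpace.single μ 1, 0)

/-- `∂/∂y^a` on smooth functions. -/
def dy (a : Fin n) : Derivation ℝ (smoothFn D) (smoothFn D) :=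
  pd h.isOpen (0, EuclideanSpace.single a 1)

/-- `δ_μ` on smooth functions. -/
def dl (μ : Fin n) : Derivation ℝ (smoothFn D) (smoothFn D) :=
  h.dx μ - ∑ a, h.NF a μ • h.dy a

lemma dl_apply (μ : Fin n) (f : smoothFn D) :
    h.dl μ f = h.dx μ f - ∑ a, h.NF a μ * h.dy a f := by
  have h1 : ⇑(∑ a, h.NF a μ • h.dy a) = ∑ a, ⇑(h.NF a μ • h.dy a) :=
    map_sum (Derivation.coeFnAddMonoidHom (R := ℝ) (A := smoothFn D) (M := smoothFn D)) _ _
  rw [dl, Derivation.sub_apply, h1, Finset.sum_apply]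
  rfl

lemma pdx_eq {F : Coord n → ℝ} {f : smoothFn D} (hF : ∀ v (hv : v ∈ D), F v = ev ⟨v, hv⟩ f)
    {u : Coord n} (hu : u ∈ D) (μ : Fin n) : pdx μ F u = ev ⟨u, hu⟩ (h.dx μ f) :=
  fderiv_eq_pd h.isOpen hF hu _

lemma pdy_eq {F : Coord n → ℝ} {f : smoothFn D} (hF : ∀ v (hv : v ∈ D), F v = ev ⟨v, hv⟩ f)
    {u : Coord n} (hu : u ∈ D) (a : Fin n) : pdy a F u = ev ⟨u, hu⟩ (h.dy a f) :=
  fderiv_eq_pd h.isOpen hF hu _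

/-- The bridge from analysis to algebra: an ordinary function agreeing on `D` with an element of the
algebra is differentiated by the corresponding derivation. The `_ev` lemmas involving adapted
derivatives rest on it. -/
lemma del_eq {F : Coord n → ℝ} {f : smoothFn D} (hF : ∀ v (hv : v ∈ D), F v = ev ⟨v, hv⟩ f)
    {u : Coord n} (hu : u ∈ D) (μ : Fin n) : S.del μ F u = ev ⟨u, hu⟩ (h.dl μ f) := by
  rw [dl_apply, map_sub, map_sum, del, h.pdx_eq hF hu]
  simp only [map_mul, h.pdy_eq hF hu]
  rfl

/-- The commutator of adapted derivatives is vertical, with the curvature of `N` as coefficients. -/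
lemma dl_comm_apply (μ ν : Fin n) (f : smoothFn D) :
    h.dl μ (h.dl ν f) - h.dl ν (h.dl μ f)
      = ∑ a, (h.dl ν (h.NF a μ) - h.dl μ (h.NF a ν)) * h.dy a f := by
  have h1 : ∀ μ ν, h.dl μ (h.dl ν f) = h.dx μ (h.dx ν f)
      - (∑ a, h.NF a μ * h.dx ν (h.dy a f)) - (∑ a, h.NF a ν * h.dx μ (h.dy a f))
      + (∑ a, ∑ b, h.NF a ν * (h.NF b μ * h.dy b (h.dy a f)))
      - ∑ a, h.dl μ (h.NF a ν) * h.dy a f := fun μ ν => by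
    rw [h.dl_apply ν, map_sub, map_sum]
    simp only [Derivation.leibniz, smul_eq_mul, h.dl_apply μ (h.dx ν f),
      fun a => h.dl_apply μ (h.dy a f), Finset.sum_add_distrib, mul_sub, Finset.sum_sub_distrib,
      Finset.mul_sum, mul_comm (h.dy _ f) (h.dl μ _)]
    have : ∀ a, h.dy a (h.dx ν f) = h.dx ν (h.dy a f) := fun a => pd_comm _ _ _ _
    simp only [this]
    ring
  rw [h1, h1, show h.dx μ (h.dx ν f) = h.dx ν (h.dx μ f) from pd_comm _ _ _ _,
    Finset.sum_comm (f := fun a b => h.NF a ν * (h.NF b μ * h.dy b (h.dy a f)))]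
  have h2 : ∑ b, ∑ a, h.NF a ν * (h.NF b μ * h.dy b (h.dy a f))
      = ∑ a, ∑ b, h.NF a μ * (h.NF b ν * h.dy b (h.dy a f)) :=
    Finset.sum_congr rfl fun b _ => Finset.sum_congr rfl fun a _ => by
      rw [show h.dy b (h.dy a f) = h.dy a (h.dy b f) from pd_comm _ _ _ _]; ring
  rw [h2]
  simp only [sub_mul, Finset.sum_sub_distrib]
  ring

lemma curvN_eq {u : Coord n} (hu : u ∈ D) (a μ ν : Fin n) :
    S.curvN u a μ ν = ev ⟨u, hu⟩ (h.dl ν (h.NF a μ) - h.dl μ (h.NF a ν)) := by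
  rw [curvN, h.del_eq (f := h.NF a μ) (fun _ _ => rfl) hu,
    h.del_eq (f := h.NF a ν) (fun _ _ => rfl) hu, map_sub]

lemma dl_comm (hR : S.IntegrableN D) (μ ν : Fin n) (f : smoothFn D) :
    h.dl μ (h.dl ν f) = h.dl ν (h.dl μ f) := by
  rw [← sub_eq_zero, dl_comm_apply]
  refine Finset.sum_eq_zero fun a _ => ?_
  have : h.dl ν (h.NF a μ) - h.dl μ (h.NF a ν) = 0 := smoothFn_ext fun u => by
    rw [← h.curvN_eq u.2, hR u u.2, map_zero]
  rw [this, zero_mul]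

/-- The horizontal coframe as smooth functions. -/
def bH (i α : Fin n) : smoothFn D := toSmooth (fun u => S.coH u i α)
  (contDiffOn_coframe h.lamH h.indepH i α)

/-- The vertical coframe as smooth functions. -/
def bV (i a : Fin n) : smoothFn D := toSmooth (fun u => S.coV u i a)
  (contDiffOn_coframe h.lamV h.indepV i a)

/-- The horizontal frame as smooth functions. -/
def aH (i α : Fin n) : smoothFn D := toSmooth _ (h.lamH i α)

/-- The vertical frame as smooth functions. -/
def aV (i a : Fin n) : smoothFn D := toSmooth _ (h.lamV i a)

omit h in
lemma sum_frame_mul {lam : Fin n → Fin n → ℝ} (hi : LinearIndependent ℝ lam) (i j : Fin n) :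
    ∑ μ, lam i μ * (Matrix.of lam)⁻¹ μ j = if i = j then 1 else 0 := by
  have := congrFun (congrFun (Matrix.mul_nonsing_inv _ (isUnit_det_of_linearIndependent hi)) i) j
  rw [Matrix.mul_apply, Matrix.one_apply] at this
  exact this

omit h in
lemma sum_frame_mul' {lam : Fin n → Fin n → ℝ} (hi : LinearIndependent ℝ lam) (μ ν : Fin n) :
    ∑ i, lam i μ * (Matrix.of lam)⁻¹ ν i = if μ = ν then 1 else 0 := by
  have := congrFun (congrFun (Matrix.nonsing_inv_mul _ (isUnit_det_of_linearIndependent hi)) ν) μ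
  rw [Matrix.mul_apply, Matrix.one_apply] at this
  simp only [eq_comm (a := μ), ← this]
  exact Finset.sum_congr rfl fun _ _ => mul_comm _ _

/-- The horizontal fundamental fields as a frame over the smooth functions. -/
def frame (hR : S.IntegrableN D) : ParallelFrame (Fin n) (smoothFn D) where
  d := h.dl
  a := h.aH
  b := h.bH
  comm := h.dl_comm hR
  ab i j := smoothFn_ext fun u => by
    simp only [map_sum, map_mul]
    refine (sum_frame_mul (h.indepH u u.2) i j).trans ?_
    split_ifs <;> simp
  ba μ ν := smoothFn_ext fun u => by
    simp only [map_sum, map_mul]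
    refine (sum_frame_mul' (h.indepH u u.2) μ ν).trans ?_
    split_ifs <;> simp

end IsSmoothOn
end LocalData
end EAP
end

/-! ### Geometric objects of the chart as values of frame expressions -/

noncomputable section
namespace EAP
namespace LocalData
namespace IsSmoothOn

variable {n : ℕ} {S : LocalData n} {D : Set (Coord n)} (h : S.IsSmoothOn D)
  (hR : S.IntegrableN D) {u : Coord n} (hu : u ∈ D)

open ParallelFrame
include h

lemma g_ev (α β : Fin n) : S.g u α β = ev ⟨u, hu⟩ ((h.frame hR).g α β) := by
  simp only [ParallelFrame.g, map_sum, map_mul]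
  rfl

lemma gInv_ev (α β : Fin n) : S.gInv u α β = ev ⟨u, hu⟩ ((h.frame hR).gInv α β) := by
  simp only [ParallelFrame.gInv, map_sum, map_mul]
  rfl

lemma Gam_ev (α μ ν : Fin n) : S.Gam u α μ ν = ev ⟨u, hu⟩ ((h.frame hR).Gam α μ ν) := by
  simp only [ParallelFrame.Gam, map_sum, map_mul]
  refine Finset.sum_congr rfl fun i _ => congrArg _ ?_
  exact h.del_eq (f := h.bH i μ) (fun _ _ => rfl) hu ν

lemma oGam_ev (α μ ν : Fin n) : S.oGam u α μ ν = ev ⟨u, hu⟩ ((h.frame hR).oGam α μ ν) := by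
  have hd : ∀ μ α β, S.del μ (fun v => S.g v α β) u
      = ev ⟨u, hu⟩ ((h.frame hR).d μ ((h.frame hR).g α β)) := fun μ α β =>
    h.del_eq (fun v hv => h.g_ev hR hv α β) hu μ
  simp only [ParallelFrame.oGam, LocalData.oGam, map_sum, map_mul, map_sub, map_add, ev_half, hd,
    h.gInv_ev hR hu]

lemma Lam_ev (α μ ν : Fin n) : S.Lam u α μ ν = ev ⟨u, hu⟩ ((h.frame hR).Lam α μ ν) := by
  simp only [ParallelFrame.Lam, LocalData.Lam, map_sub, h.Gam_ev hR hu]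

lemma C_ev (μ : Fin n) : S.C u μ = ev ⟨u, hu⟩ ((h.frame hR).C μ) := by
  simp only [ParallelFrame.C, LocalData.C, map_sum, h.Lam_ev hR hu]

lemma ga_ev (α μ ν : Fin n) : S.ga u α μ ν = ev ⟨u, hu⟩ ((h.frame hR).ga α μ ν) := by
  simp only [ParallelFrame.ga, LocalData.ga, map_sub, h.Gam_ev hR hu, h.oGam_ev hR hu]

/-- The vertical term of the curvature carries a factor R^a_{μν}, so integrability leaves the
classical Levi-Civita expression. -/
lemma oRiem_ev (α β μ ν : Fin n) :
    S.oRiem u α β μ ν = ev ⟨u, hu⟩ ((h.frame hR).oRiem α β μ ν) := by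
  have hd : ∀ κ α μ ν, S.del κ (fun v => S.oGam v α μ ν) u
      = ev ⟨u, hu⟩ ((h.frame hR).d κ ((h.frame hR).oGam α μ ν)) := fun κ α μ ν =>
    h.del_eq (fun v hv => h.oGam_ev hR hv α μ ν) hu κ
  simp only [ParallelFrame.oRiem, LocalData.oRiem, map_sum, map_mul, map_sub, map_add, hd,
    h.oGam_ev hR hu, hR u hu, zero_mul, Finset.sum_const_zero, sub_zero]

lemma oRic_ev (β ν : Fin n) : S.oRic u β ν = ev ⟨u, hu⟩ ((h.frame hR).oRic β ν) := by
  simp only [ParallelFrame.oRic, LocalData.oRic, map_sum, h.oRiem_ev hR hu]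

lemma oScal_ev : S.oScal u = ev ⟨u, hu⟩ (h.frame hR).oScal := by
  simp only [ParallelFrame.oScal, LocalData.oScal, map_sum, map_mul, h.oRic_ev hR hu,
    h.gInv_ev hR hu]

lemma oEin_ev (μ ν : Fin n) : S.oEin u μ ν = ev ⟨u, hu⟩ ((h.frame hR).oEin μ ν) := by
  simp only [ParallelFrame.oEin, LocalData.oEin, map_sub, map_mul, ev_half, h.oRic_ev hR hu,
    h.oScal_ev hR hu, h.g_ev hR hu]

/-- `N_β` as a smooth function. -/
def NDF (β : Fin n) : smoothFn D := ∑ a, h.dy a (h.NF a β)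

/-- The frame components of `N_β`. -/
def nF (i : Fin n) : smoothFn D := ∑ μ, h.aH i μ * h.NDF μ

lemma T1_nF (β : Fin n) : (h.frame hR).T1 h.nF β = h.NDF β := (h.frame hR).T1_sum_a h.NDF β

lemma NDown_ev' (β : Fin n) : S.NDown u β = ev ⟨u, hu⟩ (h.NDF β) := by
  simp only [NDown, NDF, map_sum]
  exact Finset.sum_congr rfl fun a _ => h.pdy_eq (f := h.NF a β) (fun _ _ => rfl) hu a

lemma NDown_ev (β : Fin n) : S.NDown u β = ev ⟨u, hu⟩ ((h.frame hR).T1 h.nF β) := by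
  rw [h.T1_nF hR, h.NDown_ev' hu]

lemma NUp_ev (β : Fin n) : S.NUp u β = ev ⟨u, hu⟩ ((h.frame hR).V1 h.nF β) := by
  simp only [NUp, h.gInv_ev hR hu, h.NDown_ev hR hu, ← map_mul, ← map_sum, sum_gInv_mul_T1]

lemma gaD_ev (α μ ν : Fin n) :
    S.gaD u α μ ν = ev ⟨u, hu⟩ ((h.frame hR).T3 (h.frame hR).G α μ ν) := by
  simp only [gaD, h.g_ev hR hu, h.ga_ev hR hu, ← map_mul, ← map_sum, ga_eq, sum_g_mul_M]

lemma LamD_ev (α μ ν : Fin n) :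
    S.LamD u α μ ν = ev ⟨u, hu⟩ ((h.frame hR).T3 (h.frame hR).L α μ ν) := by
  simp only [LamD, h.g_ev hR hu, h.Lam_ev hR hu, ← map_mul, ← map_sum, Lam_eq, sum_g_mul_M]

lemma gaU_ev (μ ν α : Fin n) : S.gaU u μ ν α
    = ev ⟨u, hu⟩ ((h.frame hR).M (fun k i j => (h.frame hR).G i j k) α μ ν) := by
  simp only [gaU, h.gInv_ev hR hu, h.gaD_ev hR hu, ← map_mul, ← map_sum, sum_gInv_mul_T3]

lemma xi_ev (μ ν : Fin n) : S.xi u μ ν = ev ⟨u, hu⟩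
    ((h.frame hR).T2 (fun i j => ∑ k, (h.frame hR).D k ((h.frame hR).G i j k)) μ ν) := by
  have hd : ∀ κ μ ν α, S.del κ (fun v => S.gaU v μ ν α) u = ev ⟨u, hu⟩
      ((h.frame hR).d κ ((h.frame hR).M (fun k i j => (h.frame hR).G i j k) α μ ν)) :=
    fun κ μ ν α => h.del_eq (fun v hv => h.gaU_ev hR hv μ ν α) hu κ
  rw [← (h.frame hR).div_M (fun k i j => (h.frame hR).G i j k)]
  simp only [xi, hd, h.gaU_ev hR hu, h.Gam_ev hR hu, map_sum, map_mul, map_sub, map_add]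

lemma ga2_ev (μ ν : Fin n) : S.ga2 u μ ν = ev ⟨u, hu⟩
    ((h.frame hR).T2 (fun i j => ∑ k, (h.frame hR).c k * (h.frame hR).G i j k) μ ν) := by
  simp only [ga2, h.C_ev hR hu, h.gaU_ev hR hu, ← map_mul, ← map_sum, C_eq, sum_T1_mul_M]

lemma eta_ev (μ ν : Fin n) : S.eta u μ ν = ev ⟨u, hu⟩
    ((h.frame hR).T2 (fun i j => ∑ k, (h.frame hR).c k * (h.frame hR).L k i j) μ ν) := by
  simp only [eta, h.C_ev hR hu, h.Lam_ev hR hu, ← map_mul, ← map_sum, C_eq, Lam_eq, sum_T1_mul_M]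

lemma sig_ev (μ ν : Fin n) :
    S.sig u μ ν = ev ⟨u, hu⟩ ((h.frame hR).T2 (h.frame hR).sigF μ ν) := by
  simp only [sig, h.ga_ev hR hu, ← map_mul, ← map_sum, sum_ga_sig]

lemma varpi_ev (μ ν : Fin n) :
    S.varpi u μ ν = ev ⟨u, hu⟩ ((h.frame hR).T2 (h.frame hR).varpiF μ ν) := by
  simp only [varpi, h.ga_ev hR hu, ← map_mul, ← map_add, ← map_sum, sum_ga_varpi]

lemma tr_ev {t : Coord n → Fin n → Fin n → ℝ} {τ : Fin n → Fin n → smoothFn D}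
    (ht : ∀ μ ν, t u μ ν = ev ⟨u, hu⟩ ((h.frame hR).T2 τ μ ν)) :
    S.tr t u = ev ⟨u, hu⟩ (∑ i, τ i i) := by
  simp only [tr, h.gInv_ev hR hu, ht, ← map_mul, ← map_sum, trace_T2]

lemma Z_ev (μ ν : Fin n) : S.Z u μ ν = ev ⟨u, hu⟩
    ((h.frame hR).T2 (fun i j => (h.frame hR).c i * h.nF j) μ ν) := by
  rw [Z, h.C_ev hR hu, h.NDown_ev hR hu, ← map_mul, C_eq, T1_mul_T1]

lemma sum_NUp_gaD_ev (μ ν : Fin n) : ∑ β, S.NUp u β * S.gaD u β μ ν = ev ⟨u, hu⟩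
    ((h.frame hR).T2 (fun i j => ∑ k, h.nF k * (h.frame hR).G k i j) μ ν) := by
  simp only [h.NUp_ev hR hu, h.gaD_ev hR hu, ← map_mul, ← map_sum, sum_V1_mul_T3]

lemma sum_NUp_gaD_ev' (μ ν : Fin n) : ∑ β, S.NUp u β * S.gaD u μ ν β = ev ⟨u, hu⟩
    ((h.frame hR).T2 (fun i j => ∑ k, h.nF k * (h.frame hR).G i j k) μ ν) := by
  simp only [h.NUp_ev hR hu, h.gaD_ev hR hu, ← map_mul, ← map_sum, sum_V1_mul_T3']

lemma sum_NUp_LamD_ev (μ ν : Fin n) : ∑ β, S.NUp u β * S.LamD u β μ ν = ev ⟨u, hu⟩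
    ((h.frame hR).T2 (fun i j => ∑ k, h.nF k * (h.frame hR).L k i j) μ ν) := by
  simp only [h.NUp_ev hR hu, h.LamD_ev hR hu, ← map_mul, ← map_sum, sum_V1_mul_T3]

lemma Mt_ev (μ ν : Fin n) : S.Mt u μ ν = ev ⟨u, hu⟩
    ((h.frame hR).T2 (fun i j => ∑ k, h.nF k * (h.frame hR).L i j k) μ ν) := by
  simp only [Mt, h.NUp_ev hR hu, h.LamD_ev hR hu, ← map_mul, ← map_sum, sum_V1_mul_T3']

lemma sum_NDown_ga_ev (μ ν : Fin n) : ∑ β, S.NDown u β * S.ga u β μ ν = ev ⟨u, hu⟩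
    ((h.frame hR).T2 (fun i j => ∑ k, h.nF k * (h.frame hR).G k i j) μ ν) := by
  simp only [h.NDown_ev hR hu, h.ga_ev hR hu, ← map_mul, ← map_sum, ga_eq, sum_T1_mul_M]

lemma sum_NDown_Lam_ev (μ ν : Fin n) : ∑ β, S.NDown u β * S.Lam u β μ ν = ev ⟨u, hu⟩
    ((h.frame hR).T2 (fun i j => ∑ k, h.nF k * (h.frame hR).L k i j) μ ν) := by
  simp only [h.NDown_ev hR hu, h.Lam_ev hR hu, ← map_mul, ← map_sum, Lam_eq, sum_T1_mul_M]

include hR hu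

lemma sum_NDown_Om (μ ν : Fin n) : ∑ β, S.NDown u β * S.Om u β μ ν
    = (∑ β, S.NUp u β * S.gaD u β μ ν) + ∑ β, S.NUp u β * S.gaD u β ν μ := by
  simp only [h.sum_NUp_gaD_ev hR hu, ← h.sum_NDown_ga_ev hR hu, Om, mul_add,
    Finset.sum_add_distrib]

lemma T_reduced (μ ν : Fin n) : S.T u μ ν =
    1 / 2 * S.g u μ ν * (S.tr S.sig u - S.tr S.varpi u + 2 * S.tr S.Z u)
    - (S.sig u μ ν - S.varpi u μ ν)
    + (1 / 2 * ((∑ β, S.NUp u β * S.gaD u β μ ν) + ∑ β, S.NUp u β * S.gaD u β ν μ)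
      - 1 / 2 * (S.Z u μ ν + S.Z u ν μ)) := by
  have hQ : ∀ μ ν, S.Q u μ ν = 0 := fun μ ν => by simp [Q, hR u hu]
  simp [T, tr, hQ, sym, hR u hu, h.sum_NDown_Om hR hu]

lemma T_ev (μ ν : Fin n) :
    S.T u μ ν = ev ⟨u, hu⟩ ((h.frame hR).T2 ((h.frame hR).TF h.nF) μ ν) := by
  rw [h.T_reduced hR hu, h.tr_ev hR hu (h.sig_ev hR hu), h.tr_ev hR hu (h.varpi_ev hR hu),
    h.tr_ev hR hu (h.Z_ev hR hu), h.sig_ev hR hu, h.varpi_ev hR hu, h.sum_NUp_gaD_ev hR hu,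
    h.sum_NUp_gaD_ev hR hu, h.Z_ev hR hu, h.Z_ev hR hu, h.g_ev hR hu, ← ev_half ⟨u, hu⟩,
    ← map_ofNat (ev ⟨u, hu⟩) 2]
  simp only [← map_mul, ← map_add, ← map_sub]
  congr 1
  rw [g_eq, T2_swap _ _ μ ν, T2_swap _ _ μ ν, mul_right_comm]
  simp only [mul_T2, T2_add, T2_sub]
  refine T2_congr _ (fun i j => ?_) _ _
  simp only [TF, mul_add, Finset.sum_add_distrib]
  ring

omit h in
lemma F_reduced (μ ν : Fin n) : S.F u μ ν =
    S.ga2 u μ ν - S.xi u μ ν + S.eta u μ ν + ∑ β, S.NDown u β * S.Lam u β μ ν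
    + (1 / 2 * (S.Mt u μ ν - S.Mt u ν μ) - 1 / 2 * (S.Z u μ ν - S.Z u ν μ)) := by
  simp [F, skew, hR u hu]

lemma F_ev (μ ν : Fin n) :
    S.F u μ ν = ev ⟨u, hu⟩ ((h.frame hR).T2 ((h.frame hR).FF h.nF) μ ν) := by
  rw [F_reduced hR hu, h.ga2_ev hR hu, h.xi_ev hR hu, h.eta_ev hR hu, h.sum_NDown_Lam_ev hR hu,
    h.Mt_ev hR hu, h.Mt_ev hR hu, h.Z_ev hR hu, h.Z_ev hR hu, ← ev_half ⟨u, hu⟩]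
  simp only [← map_mul, ← map_add, ← map_sub]
  congr 1
  rw [T2_swap _ _ μ ν, T2_swap _ _ μ ν]
  simp only [mul_T2, T2_add, T2_sub]
  exact T2_congr _ (fun i j => by simp only [FF]) _ _

lemma T_form (μ ν : Fin n) : S.T u μ ν =
    (1 / 2 * S.g u μ ν * (S.tr S.sig u - S.tr S.varpi u) + (S.varpi u μ ν - S.sig u μ ν))
      + S.g u μ ν * S.tr S.Z u + sym S.A u μ ν := by
  rw [h.T_reduced hR hu, sym, A, A]
  ring

lemma F_form (μ ν : Fin n) : S.F u μ ν = (S.ga2 u μ ν - S.xi u μ ν + S.eta u μ ν)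
    + (∑ β, S.NUp u β * (S.gaD u μ ν β + S.LamD u β μ ν)) + skew S.A u μ ν := by
  -- By skewness of the contortion, the part of Λ_{μνβ} skew in μ and ν is γ_{μνβ} + ½(γ_{βμν} -
  -- γ_{βνμ}); the last bracket is what A_{[μν]} supplies.
  have key : 1 / 2 * (S.Mt u μ ν - S.Mt u ν μ) = (∑ β, S.NUp u β * S.gaD u μ ν β)
      + 1 / 2 * ((∑ β, S.NUp u β * S.gaD u β μ ν) - ∑ β, S.NUp u β * S.gaD u β ν μ) := by
    rw [h.Mt_ev hR hu, h.Mt_ev hR hu, h.sum_NUp_gaD_ev hR hu, h.sum_NUp_gaD_ev hR hu,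
      h.sum_NUp_gaD_ev' hR hu, ← ev_half ⟨u, hu⟩]
    simp only [← map_mul, ← map_add, ← map_sub]
    congr 1
    rw [T2_swap _ _ μ ν, T2_swap _ (fun i j => ∑ k, h.nF k * (h.frame hR).G k i j) μ ν]
    simp only [mul_T2, T2_add, T2_sub]
    refine T2_congr _ (fun i j => ?_) _ _
    simp only [← Finset.sum_sub_distrib, Finset.mul_sum, ← Finset.sum_add_distrib]
    refine Finset.sum_congr rfl fun k _ => ?_
    have h2 := two_mul_half (A := smoothFn D)
    rw [← G_sub, ← G_sub, (h.frame hR).G_swap k i, (h.frame hR).G_swap k j,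
      (h.frame hR).G_swap i j]
    linear_combination (h.nF k * (h.frame hR).G i j k) * h2
  rw [F_reduced hR hu, skew, A, A, key]
  simp only [mul_add, Finset.sum_add_distrib, h.sum_NUp_LamD_ev hR hu,
    h.sum_NDown_Lam_ev hR hu]
  ring

end IsSmoothOn
end LocalData
end EAP
end

/-! ### The Euler–Lagrange equations in frame components -/

noncomputable section
namespace EAP

section Torsion

variable {ι A B : Type*} [Fintype ι] [DecidableEq ι] [CommRing A] [CommRing B]
  (f : A →+* B) (L : ι → ι → ι → A)

omit [DecidableEq ι] in
lemma map_torC (i : ι) : f (torC L i) = torC (fun k p q => f (L k p q)) i := by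
  simp only [torC, map_sum]

omit [DecidableEq ι] in
lemma map_torQ (i j : ι) : f (torQ L i j) = torQ (fun k p q => f (L k p q)) i j := by
  simp only [torQ, map_sum, map_sub, map_mul, map_torC]

lemma map_torS (j b c : ι) : f (torS L j b c) = torS (fun k p q => f (L k p q)) j b c := by
  simp only [torS, map_sub, map_mul, map_torC, apply_ite f, map_one, map_zero, map_ofNat]

lemma map_torH (j b : ι) : f (torH L j b) = torH (fun k p q => f (L k p q)) j b := by
  simp only [torH, map_sum, map_sub, map_add, map_mul, map_torC, map_torQ, apply_ite f, map_one,
    map_zero, map_ofNat]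

end Torsion

namespace LocalData
namespace IsSmoothOn

variable {n : ℕ} {S : LocalData n} {D : Set (Coord n)} (h : S.IsSmoothOn D)
  (hR : S.IntegrableN D) {u : Coord n} (hu : u ∈ D)

open ParallelFrame
include h

/-- The density `det (λ_{iα})` as a smooth function. -/
def den : smoothFn D := (Matrix.of h.bH).det

lemma den_ev : (Matrix.of (S.coH u)).det = ev ⟨u, hu⟩ h.den := by
  rw [den, AlgHom.map_det]
  rfl

include hu in
lemma isUnit_det_coH : IsUnit (Matrix.of (S.coH u)).det := by
  have h1 : Matrix.of (S.coH u) = ((Matrix.of (S.lamH u))⁻¹).transpose := rfl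
  rw [h1, Matrix.det_transpose, Matrix.isUnit_nonsing_inv_det_iff]
  exact isUnit_det_of_linearIndependent (h.indepH u hu)

include hu in
lemma coH_inv (α i : Fin n) : (Matrix.of (S.coH u))⁻¹ α i = S.lamH u i α := by
  have h1 : Matrix.of (S.coH u) = ((Matrix.of (S.lamH u))⁻¹).transpose := rfl
  rw [h1, ← Matrix.transpose_nonsing_inv, Matrix.nonsing_inv_nonsing_inv _
    (isUnit_det_of_linearIndependent (h.indepH u hu))]
  rfl

/-- Jacobi's formula gives the trace of the canonical coefficients, which is `kap`. This is the
density property required by `sum_d_momentum`. -/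
lemma dl_den (γ : Fin n) : h.dl γ h.den = h.den * (h.frame hR).kap γ := by
  have hXY : Matrix.of h.bH * (Matrix.of fun α i => h.aH i α) = 1 := by
    ext i j : 1
    rw [Matrix.mul_apply, Matrix.one_apply]
    have := (h.frame hR).ab j i
    simp only [eq_comm (a := i), ← this]
    exact Finset.sum_congr rfl fun _ _ => mul_comm _ _
  rw [den, derivation_det _ _ _ hXY, kap_eq]
  rfl

lemma jetL_ev (k p q : Fin n) :
    jetL (S.coH u) (jetW (S.N u) (S.coHx u) (S.coHy u)) k p q
      = ev ⟨u, hu⟩ ((h.frame hR).L k p q) := by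
  have hw : ∀ μ ν, jetW (S.N u) (S.coHx u) (S.coHy u) k μ ν = ev ⟨u, hu⟩ (h.dl ν (h.bH k μ)) :=
    fun μ ν => h.del_eq (f := h.bH k μ) (fun _ _ => rfl) hu ν
  have hB : ∀ p q, (h.frame hR).B k p q
      = ∑ μ, ∑ ν, h.aH p μ * h.aH q ν * h.dl ν (h.bH k μ) := fun p q => by
    simp only [B, D_apply, Finset.mul_sum, mul_assoc]
    rfl
  rw [ParallelFrame.L, hB, hB, Finset.sum_comm (f := fun μ ν => h.aH q μ * _ * _)]
  simp only [jetL, hw, h.coH_inv hu, map_sub, map_sum, map_mul, ← Finset.sum_sub_distrib]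
  refine Finset.sum_congr rfl fun μ _ => Finset.sum_congr rfl fun ν _ => ?_
  change S.lamH u p μ * S.lamH u q ν * _ = S.lamH u p μ * S.lamH u q ν * _
    - S.lamH u q ν * S.lamH u p μ * _
  ring

/-- The momentum `∂𝓗/∂λ_{jβ,γ}` as a smooth function. -/
def mom (j β γ : Fin n) : smoothFn D :=
  h.den * (h.frame hR).V1 (fun c => (h.frame hR).V1 (fun b => (h.frame hR).S j b c) β) γ

lemma V1_ev (f : Fin n → smoothFn D) (α : Fin n) :
    ev ⟨u, hu⟩ ((h.frame hR).V1 f α) = ∑ i, S.lamH u i α * ev ⟨u, hu⟩ (f i) := by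
  simp only [V1, map_sum, map_mul]
  rfl

lemma dLagX_ev (j β γ : Fin n) :
    dLagX (S.N u) (S.coH u) (S.coHx u) (S.coHy u) j β γ = ev ⟨u, hu⟩ (h.mom hR j β γ) := by
  have hS : ∀ b c, torS (jetL (S.coH u) (jetW (S.N u) (S.coHx u) (S.coHy u))) j b c
      = ev ⟨u, hu⟩ ((h.frame hR).S j b c) := fun b c => by
    rw [show jetL (S.coH u) (jetW (S.N u) (S.coHx u) (S.coHy u))
      = fun k p q => ev ⟨u, hu⟩ ((h.frame hR).L k p q) from
        funext fun k => funext fun p => funext fun q => h.jetL_ev hR hu k p q]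
    exact (map_torS (ev ⟨u, hu⟩ : smoothFn D →+* ℝ) _ j b c).symm
  rw [dLagX_eq _ _ _ _ (h.isUnit_det_coH hu), h.den_ev hu, mom, map_mul]
  simp only [h.V1_ev hR hu, h.coH_inv hu, hS]

lemma dLag_ev (j β : Fin n) : dLag (S.N u) (S.coH u) (S.coHx u) (S.coHy u) j β
    = ev ⟨u, hu⟩ (h.den * (h.frame hR).V1 ((h.frame hR).dH j) β) := by
  have hH : ∀ b, torH (jetL (S.coH u) (jetW (S.N u) (S.coHx u) (S.coHy u))) j b
      = ev ⟨u, hu⟩ ((h.frame hR).dH j b) := fun b => by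
    rw [show jetL (S.coH u) (jetW (S.N u) (S.coHx u) (S.coHy u))
      = fun k p q => ev ⟨u, hu⟩ ((h.frame hR).L k p q) from
        funext fun k => funext fun p => funext fun q => h.jetL_ev hR hu k p q]
    exact (map_torH (ev ⟨u, hu⟩ : smoothFn D →+* ℝ) _ j b).symm
  rw [dLag_eq _ _ _ _ (h.isUnit_det_coH hu), h.den_ev hu, map_mul]
  simp only [h.V1_ev hR hu, h.coH_inv hu, hH]

lemma dLagY_ev (j β a : Fin n) : dLagY (S.N u) (S.coH u) (S.coHx u) (S.coHy u) j β a
    = ev ⟨u, hu⟩ (-∑ γ, h.NF a γ * h.mom hR j β γ) := by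
  rw [dLagY_eq _ _ _ _ (h.isUnit_det_coH hu)]
  simp only [h.dLagX_ev hR hu, map_neg, map_sum, map_mul]
  rfl

/-- The vertical momenta are -N^a_γ times the horizontal ones. Differentiating them by ∂/∂y^a
completes ∂_γ to δ_γ, and the derivative falling on N^a_γ leaves the N_γ term. -/
lemma eulerLagrange_ev (j β : Fin n) : S.eulerLagrange u j β
    = ev ⟨u, hu⟩ (h.den * (h.frame hR).V1 (fun b => (h.frame hR).el h.nF b j) β) := by
  have hx : ∀ γ, pdx γ (fun v => dLagX (S.N v) (S.coH v) (S.coHx v) (S.coHy v) j β γ) u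
      = ev ⟨u, hu⟩ (h.dx γ (h.mom hR j β γ)) := fun γ =>
    h.pdx_eq (fun v hv => h.dLagX_ev hR hv j β γ) hu γ
  have hy : ∀ a, pdy a (fun v => dLagY (S.N v) (S.coH v) (S.coHx v) (S.coHy v) j β a) u
      = ev ⟨u, hu⟩ (h.dy a (-∑ γ, h.NF a γ * h.mom hR j β γ)) := fun a =>
    h.pdy_eq (fun v hv => h.dLagY_ev hR hv j β a) hu a
  rw [eulerLagrange]
  simp only [hx, hy, h.dLag_ev hR hu, ← map_sum, ← map_sub]
  congr 1
  have h1 : ∑ γ, h.dl γ (h.mom hR j β γ) = h.den * (h.frame hR).V1 ((h.frame hR).divS j) β :=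
    (h.frame hR).sum_d_momentum (h.dl_den hR) j β
  have h2 : ∑ γ, h.NDF γ * h.mom hR j β γ
      = h.den * (h.frame hR).V1 (fun b => ∑ c, h.nF c * (h.frame hR).S j b c) β := by
    have : ∀ γ, h.NDF γ * h.mom hR j β γ = h.den
        * ((h.frame hR).V1 (fun c => (h.frame hR).V1 (fun b => (h.frame hR).S j b c) β) γ
          * (h.frame hR).T1 h.nF γ) := fun γ => by
      rw [h.T1_nF hR, mom]
      ring
    simp only [this, ← Finset.mul_sum, sum_V1_mul_T1]
    congr 1
    simp only [mul_comm _ (h.nF _), mul_V1, V1_sum]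
  have h3 : ∑ γ, h.dl γ (h.mom hR j β γ) = (∑ γ, h.dx γ (h.mom hR j β γ))
      - ∑ γ, ∑ a, h.NF a γ * h.dy a (h.mom hR j β γ) := by
    simp only [dl_apply, Finset.sum_sub_distrib]
  have h4 : ∑ a, h.dy a (-∑ γ, h.NF a γ * h.mom hR j β γ)
      = -(∑ γ, ∑ a, h.NF a γ * h.dy a (h.mom hR j β γ)) - ∑ γ, h.NDF γ * h.mom hR j β γ := by
    rw [Finset.sum_comm]
    simp only [map_neg, map_sum, Derivation.leibniz, smul_eq_mul, Finset.sum_add_distrib, NDF,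
      Finset.sum_mul, Finset.sum_neg_distrib]
    rw [Finset.sum_comm (f := fun γ a => h.dy a (h.NF a γ) * h.mom hR j β γ)]
    simp only [mul_comm (h.mom hR j β _)]
    ring
  have h5 : (h.frame hR).V1 (fun b => (h.frame hR).el h.nF b j) β
      = (h.frame hR).V1 ((h.frame hR).dH j) β - (h.frame hR).V1 ((h.frame hR).divS j) β
        + (h.frame hR).V1 (fun b => ∑ c, h.nF c * (h.frame hR).S j b c) β := by
    simp only [V1_sub, V1_add, el_eq]
  rw [h5]
  linear_combination -h1 + h2 + h3 - h4

/-- The determinant of the coframe and the frame itself are invertible, so the field equations can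
be stripped of both. -/
lemma el_eq_zero (hE : S.FieldEquations D) (b j : Fin n) : (h.frame hR).el h.nF b j = 0 := by
  refine (h.frame hR).V1_inj (f := fun b => (h.frame hR).el h.nF b j) (g := 0) (fun β => ?_) b
  refine smoothFn_ext fun u => ?_
  have h1 := h.eulerLagrange_ev hR u.2 j β
  rw [hE u u.2, map_mul] at h1
  have h2 : (h.frame hR).V1 0 β = 0 := by simp [V1]
  rw [h2, map_zero]
  refine (mul_eq_zero.mp h1.symm).resolve_left ?_
  rw [← h.den_ev u.2]
  exact (h.isUnit_det_coH u.2).ne_zero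

lemma Ein_eq_TF (hE : S.FieldEquations D) (i j : Fin n) :
    (h.frame hR).Ein i j = (h.frame hR).TF h.nF i j := by
  have h1 := (h.frame hR).el_symm h.nF i j
  rw [h.el_eq_zero hR hE, h.el_eq_zero hR hE, add_zero] at h1
  have h2 := two_mul_half (A := smoothFn D)
  -- Multiplication by `half ^ 2` divides the relation by 4.
  linear_combination (half (smoothFn D) ^ 2) * h1 -
    ((h.frame hR).Ein i j - (h.frame hR).TF h.nF i j) * (2 * half (smoothFn D) + 1) * h2

lemma FF_eq_dc (hE : S.FieldEquations D) (i j : Fin n) :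
    (h.frame hR).FF h.nF i j = (h.frame hR).dc i j := by
  have h1 := (h.frame hR).el_skew h.nF i j
  rw [h.el_eq_zero hR hE, h.el_eq_zero hR hE, sub_zero] at h1
  have h2 := two_mul_half (A := smoothFn D)
  linear_combination -(half (smoothFn D) ^ 2) * h1 -
    ((h.frame hR).FF h.nF i j - (h.frame hR).dc i j) * (2 * half (smoothFn D) + 1) * h2

end IsSmoothOn
end LocalData
end EAP
end

/-! ### Cartan-type connections and the consequences of the field equations -/

noncomputable section
namespace EAP
namespace LocalData

/-- The directional coordinate `y^a` as a linear form. -/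
def dirCoord {n : ℕ} (a : Fin n) : Coord n →L[ℝ] ℝ :=
  (EuclideanSpace.proj a : EuclideanSpace ℝ (Fin n) →L[ℝ] ℝ).comp
    (ContinuousLinearMap.snd ℝ (EuclideanSpace ℝ (Fin n)) (EuclideanSpace ℝ (Fin n)))

/-- The directional coordinates as smooth functions. -/
def yF {n : ℕ} (D : Set (Coord n)) (a : Fin n) : smoothFn D :=
  toSmooth (fun u => u.2 a) (dirCoord a).contDiff.contDiffOn

lemma pdx_y {n : ℕ} (μ a : Fin n) (u : Coord n) : pdx μ (fun v => v.2 a) u = 0 := by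
  have h1 : HasFDerivAt (fun v : Coord n => v.2 a) (dirCoord a) u := (dirCoord a).hasFDerivAt
  rw [pdx, h1.fderiv]
  simp [dirCoord]

lemma pdy_y {n : ℕ} (c a : Fin n) (u : Coord n) :
    pdy c (fun v => v.2 a) u = if a = c then 1 else 0 := by
  have h1 : HasFDerivAt (fun v : Coord n => v.2 a) (dirCoord a) u := (dirCoord a).hasFDerivAt
  rw [pdy, h1.fderiv]
  simp [dirCoord]

/-- The vertical condition amounts to y^b C^a_{bc} = 0, which removes the N-dependent part of y^b
Γ^a_{bμ}. Since δ_μ y^a = -N^a_μ, the horizontal condition then solves for N. -/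
lemma CartanType.N_eq {n : ℕ} {S : LocalData n} {D : Set (Coord n)} (hC : S.CartanType D)
    {u : Coord n} (hu : u ∈ D) (a μ : Fin n) :
    S.N u a μ = ∑ b, u.2 b * ∑ i, S.lamV u i a * pdx μ (fun v => S.coV v i b) u := by
  have h1 := (hC u hu).1 a μ
  have h2 : ∀ c, ∑ b, u.2 b * S.CV u a b c = 0 := fun c => by
    have := (hC u hu).2 a c
    rw [pdy_y] at this
    linear_combination this
  have h3 : ∑ b, u.2 b * S.GamV u a b μ
      = (∑ b, u.2 b * ∑ i, S.lamV u i a * pdx μ (fun v => S.coV v i b) u)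
        - ∑ c, S.N u c μ * ∑ b, u.2 b * S.CV u a b c := by
    simp only [GamV, CV, del, mul_sub, Finset.sum_sub_distrib, Finset.mul_sum]
    congr 1
    rw [Finset.sum_comm' (t' := Finset.univ) (s' := fun _ => Finset.univ) (by simp)]
    conv_rhs => rw [Finset.sum_comm]
    rw [Finset.sum_comm]
    refine Finset.sum_congr rfl fun b _ => ?_
    rw [Finset.sum_comm]
    exact Finset.sum_congr rfl fun c _ => Finset.sum_congr rfl fun i _ => by ring
  simp only [del, pdx_y, pdy_y, h3, h2] at h1
  simp only [mul_ite, mul_one, mul_zero, Finset.sum_ite_eq, Finset.mem_univ, if_true,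
    Finset.sum_const_zero] at h1
  linear_combination -h1

namespace IsSmoothOn

variable {n : ℕ} {S : LocalData n} {D : Set (Coord n)} (h : S.IsSmoothOn D)

open ParallelFrame
include h

lemma aV_mul_bV (i j : Fin n) : ∑ a, h.aV i a * h.bV j a = if i = j then 1 else 0 :=
  smoothFn_ext fun u => by
    simp only [map_sum, map_mul]
    refine (sum_frame_mul (h.indepV u u.2) i j).trans ?_
    split_ifs <;> simp

lemma aV_mul_bV' (a b : Fin n) : ∑ i, h.aV i a * h.bV i b = if a = b then 1 else 0 :=
  smoothFn_ext fun u => by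
    simp only [map_sum, map_mul]
    refine (sum_frame_mul' (h.indepV u u.2) a b).trans ?_
    split_ifs <;> simp

/-- Contraction of a derived identity with the vertical coframe. -/
lemma derivation_sum_bV_mul_yF (d : Derivation ℝ (smoothFn D) (smoothFn D))
    {r : Fin n → smoothFn D}
    (hd : ∀ a, d (yF D a) + ∑ b, yF D b * ∑ i, h.aV i a * d (h.bV i b) = r a) (i : Fin n) :
    d (∑ a, h.bV i a * yF D a) = ∑ a, h.bV i a * r a := by
  have h1 : ∑ a, h.bV i a * ∑ b, yF D b * ∑ j, h.aV j a * d (h.bV j b)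
      = ∑ b, yF D b * d (h.bV i b) := by
    simp only [Finset.mul_sum]
    rw [Finset.sum_comm]
    refine Finset.sum_congr rfl fun b _ => ?_
    rw [Finset.sum_comm]
    have : ∀ j, ∑ a, h.bV i a * (yF D b * (h.aV j a * d (h.bV j b)))
        = (if j = i then 1 else 0) * (yF D b * d (h.bV j b)) := fun j => by
      rw [← h.aV_mul_bV, Finset.sum_mul]
      exact Finset.sum_congr rfl fun a _ => by ring
    simp [this]
  simp only [← hd, mul_add, Finset.sum_add_distrib, h1, map_sum, Derivation.leibniz, smul_eq_mul]

/-- For y_i = λ_{ia} y^a the two Cartan conditions read δ_μ y_i = 0 and ∂y_i/∂y^c = λ_{ic}. The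
commutator of δ_μ and δ_ν on y_i is therefore both zero and R^a_{μν} λ_{ia}, and the vertical
coframe is invertible. -/
lemma integrableN_of_cartanType (hC : S.CartanType D) : S.IntegrableN D := by
  have hx : ∀ μ i, h.dl μ (∑ a, h.bV i a * yF D a) = 0 := fun μ i => by
    rw [h.derivation_sum_bV_mul_yF (h.dl μ) (r := 0) (fun a => smoothFn_ext fun u => ?_) i]
    · simp
    · have h1 := (hC u u.2).1 a μ
      simp only [GamV] at h1
      rw [h.del_eq (f := yF D a) (fun _ _ => rfl) u.2] at h1
      simp only [fun i b => h.del_eq (F := fun v => S.coV v i b) (f := h.bV i b)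
        (fun _ _ => rfl) u.2] at h1
      simp only [map_add, map_sum, map_mul, Pi.zero_apply, map_zero]
      exact h1
  have hy : ∀ c i, h.dy c (∑ a, h.bV i a * yF D a) = h.bV i c := fun c i => by
    rw [h.derivation_sum_bV_mul_yF (h.dy c) (r := fun a => if a = c then 1 else 0)
      (fun a => smoothFn_ext fun u => ?_) i]
    · simp
    · have h1 := (hC u u.2).2 a c
      simp only [CV] at h1
      rw [h.pdy_eq (f := yF D a) (fun _ _ => rfl) u.2] at h1
      simp only [fun i b => h.pdy_eq (F := fun v => S.coV v i b) (f := h.bV i b)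
        (fun _ _ => rfl) u.2] at h1
      simp only [map_add, map_sum, map_mul, apply_ite (ev u), map_one, map_zero]
      exact h1
  intro u hu a μ ν
  rw [h.curvN_eq hu]
  have h1 : ∀ i, ∑ a, (h.dl ν (h.NF a μ) - h.dl μ (h.NF a ν)) * h.bV i a = 0 := fun i => by
    have := h.dl_comm_apply μ ν (∑ a, h.bV i a * yF D a)
    simp only [hx, hy, map_zero, sub_zero] at this
    exact this.symm
  have h2 : ∑ i, h.aV i a * ∑ b, (h.dl ν (h.NF b μ) - h.dl μ (h.NF b ν)) * h.bV i b
      = h.dl ν (h.NF a μ) - h.dl μ (h.NF a ν) := by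
    simp only [Finset.mul_sum]
    rw [Finset.sum_comm]
    have : ∀ b, ∑ i, h.aV i a * ((h.dl ν (h.NF b μ) - h.dl μ (h.NF b ν)) * h.bV i b)
        = (if a = b then 1 else 0) * (h.dl ν (h.NF b μ) - h.dl μ (h.NF b ν)) := fun b => by
      rw [← h.aV_mul_bV', Finset.sum_mul]
      exact Finset.sum_congr rfl fun i _ => by ring
    simp [this]
  rw [← h2]
  simp [h1]

variable (hR : S.IntegrableN D) (hE : S.FieldEquations D) {u : Coord n} (hu : u ∈ D)
include hR hE hu

lemma oEin_eq_T (μ ν : Fin n) : S.oEin u μ ν = S.T u μ ν := by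
  rw [h.oEin_ev hR hu, h.T_ev hR hu, oEin_eq]
  exact congrArg _ (T2_congr _ (h.Ein_eq_TF hR hE) _ _)

lemma T_comm (μ ν : Fin n) : S.T u μ ν = S.T u ν μ := by
  have h1 : ∀ α β, S.g u α β = S.g u β α := fun α β =>
    Finset.sum_congr rfl fun _ _ => mul_comm _ _
  rw [← h.oEin_eq_T hR hE hu, ← h.oEin_eq_T hR hE hu, LocalData.oEin, LocalData.oEin,
    h1 μ ν, h.oRic_ev hR hu, h.oRic_ev hR hu, oRic_comm]

lemma F_eq_ev_curl (μ ν : Fin n) : S.F u μ ν = ev ⟨u, hu⟩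
    ((h.frame hR).d ν ((h.frame hR).C μ) - (h.frame hR).d μ ((h.frame hR).C ν)) := by
  rw [h.F_ev hR hu, curl_C]
  exact congrArg _ (T2_congr _ (h.FF_eq_dc hR hE) _ _)

lemma F_eq_curl (μ ν : Fin n) :
    S.F u μ ν = S.del ν (fun v => S.C v μ) u - S.del μ (fun v => S.C v ν) u := by
  rw [h.F_eq_ev_curl hR hE hu, h.del_eq (fun v hv => h.C_ev hR hv μ) hu,
    h.del_eq (fun v hv => h.C_ev hR hv ν) hu, map_sub]
  rfl

/-- The equality of T with the Einstein tensor holds on all of the open set `D`, so it may be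
differentiated; the rest is `div_oEin`. -/
lemma div_T (ν : Fin n) : ∑ μ, S.ocovUD S.TUp u μ ν μ = 0 := by
  let V : Fin n → Fin n → smoothFn D := fun μ ν =>
    ∑ ε, (h.frame hR).gInv μ ε * (h.frame hR).oEin ε ν
  have hV : ∀ v (hv : v ∈ D) μ ν, S.TUp v μ ν = ev ⟨v, hv⟩ (V μ ν) := fun v hv μ ν => by
    simp only [TUp, V, ← h.oEin_eq_T hR hE hv, h.oEin_ev hR hv, h.gInv_ev hR hv, map_sum, map_mul]
  have hd : ∀ κ μ ν, S.del κ (fun v => S.TUp v μ ν) u = ev ⟨u, hu⟩ ((h.frame hR).d κ (V μ ν)) :=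
    fun κ μ ν => h.del_eq (fun v hv => hV v hv μ ν) hu κ
  have h1 := congrArg (ev ⟨u, hu⟩) ((h.frame hR).div_oEin V (fun _ _ => rfl) ν)
  simp only [map_sum, map_sub, map_add, map_mul, map_zero] at h1
  simp only [ocovUD, hd, hV u hu, h.oGam_ev hR hu]
  exact h1

lemma cyclic_F (μ ν σ : Fin n) :
    S.ocovDD S.F u μ ν σ + S.ocovDD S.F u ν σ μ + S.ocovDD S.F u σ μ ν = 0 := by
  let Φ : Fin n → Fin n → smoothFn D := fun μ ν =>
    (h.frame hR).d ν ((h.frame hR).C μ) - (h.frame hR).d μ ((h.frame hR).C ν)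
  have hd : ∀ κ μ ν, S.del κ (fun v => S.F v μ ν) u = ev ⟨u, hu⟩ ((h.frame hR).d κ (Φ μ ν)) :=
    fun κ μ ν => h.del_eq (fun v hv => h.F_eq_ev_curl hR hE hv μ ν) hu κ
  have h1 := congrArg (ev ⟨u, hu⟩) ((h.frame hR).cyclic_curl Φ _ (fun _ _ => rfl) μ ν σ)
  simp only [map_sum, map_sub, map_add, map_mul, map_zero] at h1
  have h2 : ∀ μ ν, S.F u μ ν = ev ⟨u, hu⟩ (Φ μ ν) := h.F_eq_ev_curl hR hE hu
  simp only [ocovDD, hd, h2, h.oGam_ev hR hu]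
  exact h1

/-- F is a curl, hence skew, and raising indices keeps it skew; `div_div_skew` applies. -/
lemma div_J : ∑ μ, S.ocovU S.J u μ μ = 0 := by
  let Φ : Fin n → Fin n → smoothFn D := fun μ ν =>
    (h.frame hR).d ν ((h.frame hR).C μ) - (h.frame hR).d μ ((h.frame hR).C ν)
  let Ψ : Fin n → Fin n → smoothFn D := fun μ ν =>
    ∑ α, ∑ β, (h.frame hR).gInv μ α * (h.frame hR).gInv ν β * Φ α β
  let Y : Fin n → smoothFn D := fun μ => ∑ ν, ((h.frame hR).d ν (Ψ μ ν)
    + ∑ ε, Ψ ε ν * (h.frame hR).oGam μ ε ν + ∑ ε, Ψ μ ε * (h.frame hR).oGam ν ε ν)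
  have hs : ∀ μ ν, Ψ μ ν = -Ψ ν μ := fun μ ν => by
    simp only [Ψ]
    rw [Finset.sum_comm]
    simp only [← Finset.sum_neg_distrib]
    exact Finset.sum_congr rfl fun _ _ => Finset.sum_congr rfl fun _ _ => by simp only [Φ]; ring
  have hΨ : ∀ v (hv : v ∈ D) μ ν, S.FUp v μ ν = ev ⟨v, hv⟩ (Ψ μ ν) := fun v hv μ ν => by
    simp only [FUp, Ψ, h.F_eq_ev_curl hR hE hv, h.gInv_ev hR hv, map_sum, map_mul, Φ]
  have hY : ∀ v (hv : v ∈ D) μ, S.J v μ = ev ⟨v, hv⟩ (Y μ) := fun v hv μ => by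
    have hd : ∀ κ μ ν, S.del κ (fun v => S.FUp v μ ν) v = ev ⟨v, hv⟩ ((h.frame hR).d κ (Ψ μ ν)) :=
      fun κ μ ν => h.del_eq (fun v hv => hΨ v hv μ ν) hv κ
    simp only [J, ocovUU, hd, hΨ v hv, h.oGam_ev hR hv, Y, map_sum, map_add, map_mul]
  have hd : ∀ κ μ, S.del κ (fun v => S.J v μ) u = ev ⟨u, hu⟩ ((h.frame hR).d κ (Y μ)) :=
    fun κ μ => h.del_eq (fun v hv => hY v hv μ) hu κ
  have h1 := congrArg (ev ⟨u, hu⟩) ((h.frame hR).div_div_skew Ψ hs Y (fun _ => rfl))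
  simp only [map_sum, map_add, map_mul, map_zero] at h1
  simp only [ocovU, hd, hY u hu, h.oGam_ev hR hu]
  exact h1

end IsSmoothOn
end LocalData
end EAP
end

/-! ### The main theorem -/

theorem mainTheorem6 {n : ℕ} {M : Type*} [TopologicalSpace M]
    [ChartedSpace (EuclideanSpace ℝ (Fin n)) M] [IsManifold (𝓡 n) ∞ M]
    (W : Set (TangentBundle (𝓡 n) M)) (hW : IsOpen W) (E : EAP.Space n M W)
    (e : OpenPartialHomeomorph M (EuclideanSpace ℝ (Fin n)))
    (he : e ∈ IsManifold.maximalAtlas (𝓡 n) ∞ M)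
    (S : EAP.LocalData n) (hS : S = E.comp e)
    (D : Set (EAP.Coord n)) (hD : D = EAP.chartDom W e) :
    -- the integrability case
    (S.IntegrableN D → S.FieldEquations D → ∀ u ∈ D,
      -- the energy–momentum tensor: symmetry, form, Einstein equations, conservation law
      (∀ μ ν, S.T u μ ν = S.T u ν μ) ∧
      (∀ μ ν, S.T u μ ν =
        (1 / 2 * S.g u μ ν * (S.tr S.sig u - S.tr S.varpi u) + (S.varpi u μ ν - S.sig u μ ν))
          + S.g u μ ν * S.tr S.Z u + EAP.LocalData.sym S.A u μ ν) ∧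
      (∀ μ ν, S.oEin u μ ν = S.T u μ ν) ∧
      (∀ ν, ∑ μ, S.ocovUD S.TUp u μ ν μ = 0) ∧
      -- the electromagnetic field: form, Maxwell equations, cyclic identity, conserved current
      (∀ μ ν, S.F u μ ν =
        (S.ga2 u μ ν - S.xi u μ ν + S.eta u μ ν)
          + (∑ β, S.NUp u β * (S.gaD u μ ν β + S.LamD u β μ ν))
          + EAP.LocalData.skew S.A u μ ν) ∧
      (∀ μ ν, S.F u μ ν = S.del ν (fun v => S.C v μ) u - S.del μ (fun v => S.C v ν) u) ∧
      (∀ μ ν σ, S.ocovDD S.F u μ ν σ + S.ocovDD S.F u ν σ μ + S.ocovDD S.F u σ μ ν = 0) ∧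
      ∑ μ, S.ocovU S.J u μ μ = 0) ∧
    -- the Cartan-type case is a special case of it
    (S.CartanType D →
      (∀ u ∈ D, ∀ a μ, S.N u a μ =
        ∑ b, u.2 b * ∑ i, S.lamV u i a * EAP.pdx μ (fun v => S.coV v i b) u) ∧
      S.IntegrableN D) := by
  subst hS hD
  have h : (E.comp e).IsSmoothOn (EAP.chartDom W e) :=
    ⟨EAP.isOpen_chartDom hW he, E.smooth_N e he, E.smooth_lamH e he, E.smooth_lamV e he,
      E.indep_lamH e he, E.indep_lamV e he⟩
  refine ⟨fun hR hE u hu => ⟨h.T_comm hR hE hu, h.T_form hR hu, h.oEin_eq_T hR hE hu,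
    h.div_T hR hE hu, h.F_form hR hu, h.F_eq_curl hR hE hu, h.cyclic_F hR hE hu,
    h.div_J hR hE hu⟩, fun hC => ⟨fun u hu => hC.N_eq hu, h.integrableN_of_cartanType hC⟩⟩
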